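/- Let $d\in\{2,3\}$, let $K\subset\mathbb R^d$ be a closed nondegenerate $d$-simplex with diameter $h_K$ and outward unit normal $\mathbf n$, let $\tau=h_K^{-1}$, $k\ge 1$ an integer, and $H_a,N,R_m>0$. Let $\mathcal P_m$ denote the polynomials of total degree at most $m$, $(\cdot,\cdot)_K$ and $\langle\cdot,\cdot\rangle_{\partial K}$ the $L^2$ scalar products, $\mathbf v\times\mathbf w=v_1w_2-v_2w_1$ if $d=2$ and the usual cross product if $d=3$, and $\nabla\times\phi=(\partial_2\phi,-\partial_1\phi)$ for scalar $\phi$ if $d=2$ and the usual curl if $d=3$. For an interior part $v_o$ and a boundary part $v_b$ the discrete weak gradient $\nabla_{w,m}\{v_o,v_b\}\in[\mathcal P_m(K)]^d$, weak divergence $\nabla_{w,m}\cdot\{\mathbf w_o,\mathbf w_b\}\in\mathcal P_m(K)$ and weak curl $\nabla_{w,m}\times\{\mathbf w_o,\mathbf w_b\}\in[\mathcal P_m(K)]^{2d-3}$ are defined by $$(\nabla_{w,m}\{v_o,v_b\},\phi)_K=-(v_o,\nabla\cdot\phi)_K+\langle v_b,\phi\cdot\mathbf n\rangle_{\partial K},\quad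 (\nabla_{w,m}\cdot\{\mathbf w_o,\mathbf w_b\},\phi)_K=-(\mathbf w_o,\nabla\phi)_K+\langle\mathbf w_b\cdot\mathbf n,\phi\rangle_{\partial K},$$ $$(\nabla_{w,m}\times\{\mathbf w_o,\mathbf w_b\},\phi)_K=(\mathbf w_o,\nabla\times\phi)_K-\langle\mathbf w_b\times\mathbf n,\phi\rangle_{\partial K}$$ for all $\phi$ in $[\mathcal P_m(K)]^d$, $\mathcal P_m(K)$, $[\mathcal P_m(K)]^{2d-3}$, respectively. The weak gradient of a vector and the weak divergence of a tensor are taken row by row, where $(\mathbf u\otimes\Phi)_{ij}=u_i\Phi_j$. Let $\mathbf f,\mathbf g\in[L^2(K)]^d$, and let numerical traces be given on $\partial K$ which on each face $e$ of $K$ satisfy $\mathbf u_{hb},\mathbf B_{hb}\in[\mathcal P_k(e)]^d$, $p_{hb},r_{hb}\in\mathcal P_k(e)$. Define $$a_{h,K}(\mathbf u,\mathbf v)=\tfrac1{H_a^2}(\nabla_{w,k-1}\{\mathbf u,\mathbf 0\},\nabla_{w,k-1}\{\mathbf v,\mathbf 0\})_K+\tfrac1{H_a^2}\langle\tau\mathbf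 u,\mathbf v\rangle_{\partial K},$$ $$\tilde a_{h,K}(\mathbf B,\mathbf w)=\tfrac1{R_m^2}(\nabla_{w,k-1}\times\{\mathbf B,\mathbf 0\},\nabla_{w,k-1}\times\{\mathbf w,\mathbf 0\})_K+\tfrac1{R_m^2}\langle\tau\mathbf B\times\mathbf n,\mathbf w\times\mathbf n\rangle_{\partial K},$$ $$b_{h,K}(\mathbf v,q)=(\nabla_{w,k}\{q,0\},\mathbf v)_K,\qquad \tilde b_{h,K}(\mathbf w,\theta)=\tfrac1{R_m}(\nabla_{w,k}\{\theta,0\},\mathbf w)_K,$$ $$c_{h,K}(\Phi;\mathbf u,\mathbf v)=\tfrac1{2N}(\nabla_{w,k}\cdot\{\mathbf u\otimes\Phi,\mathbf 0\},\mathbf v)_K-\tfrac1{2N}(\nabla_{w,k}\cdot\{\mathbf v\otimes\Phi,\mathbf 0\},\mathbf u)_K,$$ $$\tilde c_{h,K}(\mathbf v;\mathbf B,\mathbf w)=\tfrac1{R_m}(\nabla_{w,k}\times\{\mathbf w,\mathbf 0\},\mathbf v\times\mathbf B)_K,$$ $$\mathbf F_K(\mathbf v)=(\mathbf f,\mathbf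 v)_K-\tfrac1{H_a^2}(\nabla_{w,k-1}\{\mathbf 0,\mathbf u_{hb}\},\nabla_{w,k-1}\{\mathbf v,\mathbf 0\})_K+\tfrac1{H_a^2}\langle\tau\mathbf u_{hb},\mathbf v\rangle_{\partial K}-(\nabla_{w,k}\{0,p_{hb}\},\mathbf v)_K-\tfrac1{2N}(\nabla_{w,k}\cdot\{\mathbf 0,\mathbf u_{hb}\otimes\mathbf u_{hb}\},\mathbf v)_K,$$ $$\mathbf G_K(\mathbf w)=\tfrac1{R_m}(\mathbf g,\mathbf w)_K-\tfrac1{R_m^2}(\nabla_{w,k-1}\times\{\mathbf 0,\mathbf B_{hb}\},\nabla_{w,k-1}\times\{\mathbf w,\mathbf 0\})_K+\tfrac1{R_m^2}\langle\tau\mathbf B_{hb}\times\mathbf n,\mathbf w\times\mathbf n\rangle_{\partial K}-\tfrac1{R_m}(\nabla_{w,k}\{0,r_{hb}\},\mathbf w)_K.$$ The local problem is: find $(\mathbf u_{ho},\mathbf B_{ho},p_{ho},r_{ho})\in[\mathcal P_k(K)]^d\times[\mathcal P_k(K)]^d\times\mathcal P_{k-1}(K)\times\mathcal P_{k-1}(K)$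 such that $$a_{h,K}(\mathbf u_{ho},\mathbf v)+\tilde a_{h,K}(\mathbf B_{ho},\mathbf w)+b_{h,K}(\mathbf v,p_{ho})-b_{h,K}(\mathbf u_{ho},q)+\tilde b_{h,K}(\mathbf w,r_{ho})-\tilde b_{h,K}(\mathbf B_{ho},\theta)$$ $$+c_{h,K}(\mathbf u_{ho};\mathbf u_{ho},\mathbf v)+\tilde c_{h,K}(\mathbf v;\mathbf B_{ho},\mathbf B_{ho})-\tilde c_{h,K}(\mathbf u_{ho};\mathbf B_{ho},\mathbf w)=\mathbf F_K(\mathbf v)+\mathbf G_K(\mathbf w)$$ for all $(\mathbf v,\mathbf w,q,\theta)$ in the same product space. Put $\bar{\mathbf V}_{h,K}=\{\mathbf v\in[\mathcal P_k(K)]^d: b_{h,K}(\mathbf v,q)=0\ \forall q\in\mathcal P_{k-1}(K)\}$, $\bar{\mathbf W}_{h,K}=\{\mathbf w\in[\mathcal P_k(K)]^d: \tilde b_{h,K}(\mathbf w,\theta)=0\ \forall\theta\in\mathcal P_{k-1}(K)\}$, $$|||\mathbf v|||_{D,K}=\big(\|\nabla_{w,k-1}\{\mathbf v,\mathbf 0\}\|_{0,K}^2+\|\tau^{1/2}\mathbf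 v\|_{0,\partial K}^2\big)^{1/2},\quad |||\mathbf w|||_{C,K}=\big(\|\nabla_{w,k-1}\times\{\mathbf w,\mathbf 0\}\|_{0,K}^2+\|\tau^{1/2}\mathbf w\times\mathbf n\|_{0,\partial K}^2\big)^{1/2},$$ $$M_{h,K}=\sup_{\mathbf 0\ne\Phi,\mathbf u,\mathbf v\in\bar{\mathbf V}_{h,K}}\frac{c_{h,K}(\Phi;\mathbf u,\mathbf v)}{|||\Phi|||_{D,K}|||\mathbf u|||_{D,K}|||\mathbf v|||_{D,K}},\quad \tilde M_{h,K}=\sup_{\mathbf 0\ne\mathbf w,\mathbf B\in\bar{\mathbf W}_{h,K},\ \mathbf 0\ne\mathbf v\in\bar{\mathbf V}_{h,K}}\frac{\tilde c_{h,K}(\mathbf v;\mathbf B,\mathbf w)}{|||\mathbf w|||_{C,K}|||\mathbf v|||_{D,K}|||\mathbf B|||_{C,K}},$$ $$\|\mathbf F_K\|_h=\sup_{\mathbf 0\ne\mathbf v\in\bar{\mathbf V}_{h,K}}\frac{\mathbf F_K(\mathbf v)}{|||\mathbf v|||_{D,K}},\quad \|\mathbf G_K\|_{\tilde h}=\sup_{\mathbf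 0\ne\mathbf w\in\bar{\mathbf W}_{h,K}}\frac{\mathbf G_K(\mathbf w)}{|||\mathbf w|||_{C,K}},\quad \tilde\delta=12\max\{H_a,R_m\}^3\max\{M_{h,K},\tilde M_{h,K}\}.$$ Then the local problem has at least one solution. If moreover $$\tilde\delta\big(H_a\|\mathbf F_K\|_h+R_m\|\mathbf G_K\|_{\tilde h}\big)<1,$$ then the local problem has exactly one solution. -/

import Mathlib

open MeasureTheory

namespace WGMHD

noncomputable section

/-! ### Polynomials and integrals on a simplex -/

/-- Real polynomials in `d` variables. -/
abbrev RPoly (d : ℕ) := MvPolynomial (Fin d) ℝ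

/-- Vectors of `d` polynomials in `d` variables, i.e. polynomial vector fields on `ℝ^d`. -/
abbrev VPoly (d : ℕ) := Fin d → RPoly d

/-- `ℝ^d` with its Euclidean norm. -/
abbrev E (d : ℕ) := EuclideanSpace ℝ (Fin d)

/-- A (nondegenerate) `d`-simplex in `ℝ^d`, given by its `d + 1` affinely independent vertices. -/
abbrev Element (d : ℕ) := Affine.Simplex ℝ (E d) d

/-- The space `P_m` of polynomials of total degree at most `m`. -/
abbrev PolyLE (d m : ℕ) : Submodule ℝ (RPoly d) := MvPolynomial.restrictTotalDegree (Fin d) ℝ m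

/-- The space `[P_m]^d` of vector fields with components in `P_m`. -/
def VPolyLE (d m : ℕ) : Submodule ℝ (VPoly d) := Submodule.pi Set.univ fun _ => PolyLE d m

/-- The value of a polynomial at a point. -/
def val {d : ℕ} (p : RPoly d) (x : E d) : ℝ := MvPolynomial.eval (fun j => x j) p

/-- The closed face of the simplex opposite to the vertex `i`. -/
def face {d : ℕ} [NeZero d] (K : Element d) (i : Fin (d + 1)) : Set (E d) :=
  (K.faceOpposite i).closedInterior

/-- The scalar product `(p, q)_K = ∫_K p q dx`. -/
def innerK {d : ℕ} (K : Element d) (p q : RPoly d) : ℝ :=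
  ∫ x in K.closedInterior, val p x * val q x

/-- The scalar product `⟨p, q⟩_e = ∫_e p q ds` on the face `e` opposite to the vertex `i`, with
respect to the `(d-1)`-dimensional surface measure. -/
def innerF {d : ℕ} [NeZero d] (K : Element d) (i : Fin (d + 1)) (p q : RPoly d) : ℝ :=
  ∫ x in face K i, val p x * val q x ∂μHE[d - 1]

/-- The outward unit normal vector of the simplex on the face opposite to the vertex `i`: the
normalized vector from this vertex to its orthogonal projection on the face. -/
def normal {d : ℕ} [NeZero d] (K : Element d) (i : Fin (d + 1)) : E d :=
  (K.height i)⁻¹ • (K.altitudeFoot i - K.points i)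

/-- The outward unit normal as a constant polynomial vector field. -/
def normalP {d : ℕ} [NeZero d] (K : Element d) (i : Fin (d + 1)) : VPoly d :=
  fun j => MvPolynomial.C (normal K i j)

/-- The diameter `h_K`. -/
def diamK {d : ℕ} (K : Element d) : ℝ := Metric.diam K.closedInterior

/-- The stabilization parameter `τ = h_K⁻¹`. -/
def tau {d : ℕ} (K : Element d) : ℝ := (diamK K)⁻¹

/-! ### Algebraic vector calculus -/

/-- Pointwise scalar product of two polynomial vector fields. -/
def dotP {d : ℕ} (v w : VPoly d) : RPoly d := ∑ j, v j * w j

/-- The classical divergence. -/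
def divP {d : ℕ} (v : VPoly d) : RPoly d := ∑ j, MvPolynomial.pderiv j (v j)

/-- The cross product of two vectors, with `2d - 3` components: `v₁w₂ - v₂w₁` for `d = 2` and the
usual one for `d = 3` (and `0` in other dimensions, which are not used). -/
def cross {R : Type*} [CommRing R] : (d : ℕ) → (Fin d → R) → (Fin d → R) → Fin (2 * d - 3) → R
  | 2, v, w => fun _ => v 0 * w 1 - v 1 * w 0
  | 3, v, w => ![v 1 * w 2 - v 2 * w 1, v 2 * w 0 - v 0 * w 2, v 0 * w 1 - v 1 * w 0]
  | _, _, _ => 0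

/-- The classical curl `∇ × φ` of a field `φ` with `2d - 3` components: `(∂₂φ, -∂₁φ)` for `d = 2`
and the usual curl for `d = 3` (and `0` in other dimensions, which are not used). -/
def curlP : (d : ℕ) → (Fin (2 * d - 3) → RPoly d) → VPoly d
  | 2, φ => ![MvPolynomial.pderiv 1 (φ 0), -MvPolynomial.pderiv 0 (φ 0)]
  | 3, φ => ![MvPolynomial.pderiv 1 (φ 2) - MvPolynomial.pderiv 2 (φ 1),
              MvPolynomial.pderiv 2 (φ 0) - MvPolynomial.pderiv 0 (φ 2),
              MvPolynomial.pderiv 0 (φ 1) - MvPolynomial.pderiv 1 (φ 0)]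
  | _, _ => 0

/-! ### Well-posedness of the discrete weak operators

The discrete weak operators are defined below as Riesz representatives in polynomial spaces. The
following facts provide existence and uniqueness of these representatives. -/

theorem continuous_val {d : ℕ} (p : RPoly d) : Continuous (val p) := by
  have h : Continuous fun x : E d => (fun j => x j : Fin d → ℝ) := by fun_prop
  exact (MvPolynomial.continuous_eval p).comp h

theorem measure_face_lt_top {d : ℕ} [NeZero d] (K : Element d) (i : Fin (d + 1)) :
    (μHE[d - 1] : Measure (E d)) (face K i) < ⊤ := by
  let S := K.faceOpposite i
  let A := affineSpan ℝ (Set.range S.points)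
  have hA : Nonempty A := ⟨⟨S.points 0, subset_affineSpan ℝ _ (Set.mem_range_self _)⟩⟩
  have hr : Module.finrank ℝ A.direction = d - 1 := by
    rw [direction_affineSpan]
    exact S.independent.finrank_vectorSpan (by simp)
  have hsub : face K i ⊆ (A : Set (E d)) := S.closedInterior_subset_affineSpan
  have hc : IsCompact (face K i) := S.isCompact_closedInterior
  have him : face K i = (Subtype.val : A → E d) '' ((Subtype.val : A → E d) ⁻¹' face K i) := by
    ext x
    constructor
    · intro hx
      exact ⟨⟨x, hsub hx⟩, hx, rfl⟩
    · rintro ⟨y, hy, rfl⟩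
      exact hy
  have hcl : IsClosed (A : Set (E d)) := A.closed_of_finiteDimensional
  have hc' : IsCompact ((Subtype.val : A → E d) ⁻¹' face K i) :=
    hcl.isClosedEmbedding_subtypeVal.isCompact_preimage hc
  have hmp := EuclideanGeometry.measurePreserving_vaddConst (Classical.arbitrary A)
  rw [him, AffineSubspace.euclideanHausdorffMeasure_coe_image, ← hr,
    ← hmp.measure_preimage hc'.isClosed.measurableSet.nullMeasurableSet]
  exact ((IsometryEquiv.vaddConst (Classical.arbitrary A)).toHomeomorph.isCompact_preimage.2
    hc').measure_lt_top

theorem integrable_innerK {d : ℕ} (K : Element d) (p q : RPoly d) :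
    Integrable (fun x => val p x * val q x) (volume.restrict K.closedInterior) :=
  ((continuous_val p).mul (continuous_val q)).continuousOn.integrableOn_compact
    K.isCompact_closedInterior

theorem integrable_innerF {d : ℕ} [NeZero d] (K : Element d) (i : Fin (d + 1)) (p q : RPoly d) :
    Integrable (fun x => val p x * val q x) ((μHE[d - 1] : Measure (E d)).restrict (face K i)) :=
  ((continuous_val p).mul (continuous_val q)).continuousOn.integrableOn_of_subset_isCompact
    (K.faceOpposite i).isCompact_closedInterior
    (K.faceOpposite i).isCompact_closedInterior.isClosed.measurableSet subset_rfl
    (measure_face_lt_top K i).ne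

theorem val_add {d : ℕ} (p q : RPoly d) (x : E d) : val (p + q) x = val p x + val q x := by
  simp [val]

theorem val_smul {d : ℕ} (c : ℝ) (p : RPoly d) (x : E d) : val (c • p) x = c * val p x := by
  simp [val, MvPolynomial.smul_eval]

theorem innerK_comm {d : ℕ} (K : Element d) (p q : RPoly d) : innerK K p q = innerK K q p := by
  simp only [innerK, mul_comm]

theorem innerF_comm {d : ℕ} [NeZero d] (K : Element d) (i : Fin (d + 1)) (p q : RPoly d) :
    innerF K i p q = innerF K i q p := by
  simp only [innerF, mul_comm]

theorem innerK_add_right {d : ℕ} (K : Element d) (p q r : RPoly d) :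
    innerK K p (q + r) = innerK K p q + innerK K p r := by
  simp only [innerK, val_add, mul_add]
  exact integral_add (integrable_innerK K p q) (integrable_innerK K p r)

theorem innerK_smul_right {d : ℕ} (K : Element d) (c : ℝ) (p q : RPoly d) :
    innerK K p (c • q) = c * innerK K p q := by
  simp only [innerK, val_smul, mul_left_comm _ c]
  exact integral_const_mul c _

theorem innerF_add_right {d : ℕ} [NeZero d] (K : Element d) (i : Fin (d + 1)) (p q r : RPoly d) :
    innerF K i p (q + r) = innerF K i p q + innerF K i p r := by
  simp only [innerF, val_add, mul_add]
  exact integral_add (integrable_innerF K i p q) (integrable_innerF K i p r)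

theorem innerF_smul_right {d : ℕ} [NeZero d] (K : Element d) (i : Fin (d + 1)) (c : ℝ)
    (p q : RPoly d) : innerF K i p (c • q) = c * innerF K i p q := by
  simp only [innerF, val_smul, mul_left_comm _ c]
  exact integral_const_mul c _

theorem innerK_self_eq_zero {d : ℕ} (K : Element d) {p : RPoly d} (h : innerK K p p = 0) :
    p = 0 := by
  have hae : (fun x => val p x * val p x) =ᵐ[volume.restrict K.closedInterior] 0 :=
    (integral_eq_zero_iff_of_nonneg (fun x => mul_self_nonneg _) (integrable_innerK K p p)).1 h
  have hint : (interior K.closedInterior).Nonempty := by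
    rw [← Affine.Simplex.convexHull_eq_closedInterior,
      interior_convexHull_nonempty_iff_affineSpan_eq_top]
    exact K.independent.affineSpan_eq_top_iff_card_eq_finrank_add_one.2 (by simp)
  have hae' : (fun x => val p x * val p x) =ᵐ[volume.restrict (interior K.closedInterior)] 0 :=
    ae_mono (Measure.restrict_mono interior_subset le_rfl) hae
  have heq : Set.EqOn (fun x => val p x * val p x) 0 (interior K.closedInterior) :=
    Measure.eqOn_open_of_ae_eq hae' isOpen_interior
      ((continuous_val p).mul (continuous_val p)).continuousOn continuousOn_const
  obtain ⟨y, hy⟩ := hint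
  let e := (EuclideanSpace.equiv (Fin d) ℝ).toHomeomorph
  have hopen : IsOpen (e.symm ⁻¹' interior K.closedInterior) :=
    isOpen_interior.preimage e.symm.continuous
  have hy' : e y ∈ e.symm ⁻¹' interior K.closedInterior := by simpa using hy
  obtain ⟨ε, hε, hball⟩ := Metric.isOpen_iff.1 hopen _ hy'
  refine MvPolynomial.funext_set (fun j => Metric.ball (e y j) ε)
    (fun j => infinite_of_mem_nhds (e y j) (Metric.ball_mem_nhds _ hε)) ?_
  intro x hx
  have hx' : x ∈ Metric.ball (e y) ε := by
    rw [ball_pi _ hε]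
    exact hx
  have h0 := heq (hball hx')
  simpa [val, e] using h0

theorem exists_riesz {d : ℕ} (K : Element d) (m : ℕ) (ℓ : RPoly d →ₗ[ℝ] ℝ) :
    ∃ g ∈ PolyLE d m, ∀ φ ∈ PolyLE d m, innerK K g φ = ℓ φ := by
  let B : PolyLE d m →ₗ[ℝ] Module.Dual ℝ (PolyLE d m) := LinearMap.mk₂ ℝ
    (fun p q => innerK K p q)
    (fun p q r => by
      rw [innerK_comm, Submodule.coe_add, innerK_add_right, innerK_comm, innerK_comm K r q])
    (fun c p q => by
      rw [innerK_comm, Submodule.coe_smul, innerK_smul_right, innerK_comm, smul_eq_mul])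
    (fun p q r => by rw [Submodule.coe_add, innerK_add_right])
    (fun c p q => by rw [Submodule.coe_smul, innerK_smul_right, smul_eq_mul])
  have hB : Function.Injective B := by
    rw [← LinearMap.ker_eq_bot, LinearMap.ker_eq_bot']
    intro p hp
    have h : innerK K p p = 0 := congrArg (fun f : Module.Dual ℝ (PolyLE d m) => f p) hp
    exact Subtype.ext (innerK_self_eq_zero K h)
  obtain ⟨g, hg⟩ := (LinearMap.injective_iff_surjective_of_finrank_eq_finrank
    (Subspace.dual_finrank_eq (K := ℝ) (V := PolyLE d m)).symm).1 hB
    (ℓ ∘ₗ (PolyLE d m).subtype)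
  exact ⟨g, g.2, fun φ hφ =>
    congrArg (fun f : Module.Dual ℝ (PolyLE d m) => f ⟨φ, hφ⟩) hg⟩

/-- Uniqueness of the representative. -/
theorem riesz_unique {d : ℕ} (K : Element d) (m : ℕ) {g g' : RPoly d} (hg : g ∈ PolyLE d m)
    (hg' : g' ∈ PolyLE d m) (h : ∀ φ ∈ PolyLE d m, innerK K g φ = innerK K g' φ) : g = g' := by
  have hm : g - g' ∈ PolyLE d m := Submodule.sub_mem _ hg hg'
  refine sub_eq_zero.1 (innerK_self_eq_zero K ?_)
  have h1 := h _ hm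
  have h2 : innerK K (g - g') (g - g') =
      innerK K (g - g') g + (-1) * innerK K (g - g') g' := by
    rw [← innerK_smul_right, ← innerK_add_right]
    simp [sub_eq_add_neg]
  rw [h2, innerK_comm, innerK_comm K _ g', h1]
  ring

theorem exists_riesz_vec {d : ℕ} (K : Element d) (m : ℕ) {n : ℕ}
    (ℓ : (Fin n → RPoly d) →ₗ[ℝ] ℝ) :
    ∃ g : Fin n → RPoly d, (∀ l, g l ∈ PolyLE d m) ∧
      ∀ φ : Fin n → RPoly d, (∀ l, φ l ∈ PolyLE d m) → ∑ l, innerK K (g l) (φ l) = ℓ φ := by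
  choose g hg hgφ using fun l : Fin n =>
    exists_riesz K m (ℓ ∘ₗ LinearMap.single ℝ (fun _ => RPoly d) l)
  refine ⟨g, hg, fun φ hφ => ?_⟩
  rw [Finset.sum_congr rfl fun l _ => hgφ l (φ l) (hφ l)]
  simp only [LinearMap.comp_apply, LinearMap.single_apply]
  rw [← map_sum, Finset.univ_sum_single]

/-! ### Discrete weak operators

A weak function on the simplex consists of an interior polynomial and of one polynomial on each
face, the latter represented by a polynomial in `d` variables (only its restriction to the face
matters). Faces are indexed by the opposite vertex. -/

/-- The functional `φ ↦ -(v_o, ∇·φ)_K + ⟨v_b, φ·n⟩_{∂K}`. -/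
def gradFunctional {d : ℕ} [NeZero d] (K : Element d) (vo : RPoly d)
    (vb : Fin (d + 1) → RPoly d) : VPoly d →ₗ[ℝ] ℝ where
  toFun φ := -innerK K vo (divP φ) + ∑ i, innerF K i (vb i) (dotP φ (normalP K i))
  map_add' φ ψ := by
    have h1 : divP (φ + ψ) = divP φ + divP ψ := by
      simp [divP, Finset.sum_add_distrib]
    have h2 : ∀ i, dotP (φ + ψ) (normalP K i) = dotP φ (normalP K i) + dotP ψ (normalP K i) := by
      intro i
      simp [dotP, add_mul, Finset.sum_add_distrib]
    simp only [h1, h2, innerK_add_right, innerF_add_right, Finset.sum_add_distrib]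
    ring
  map_smul' c φ := by
    have h1 : divP (c • φ) = c • divP φ := by
      simp [divP, Finset.smul_sum]
    have h2 : ∀ i, dotP (c • φ) (normalP K i) = c • dotP φ (normalP K i) := by
      intro i
      simp [dotP, Finset.smul_sum]
    simp only [h1, h2, innerK_smul_right, innerF_smul_right, RingHom.id_apply, smul_eq_mul,
      ← Finset.mul_sum]
    ring

/-- The discrete weak gradient `∇_{w,m} {v_o, v_b}`: the element `g` of `[P_m]^d` with
`(g, φ)_K = -(v_o, ∇·φ)_K + ⟨v_b, φ·n⟩_{∂K}` for all `φ ∈ [P_m]^d`. -/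
def weakGrad {d : ℕ} [NeZero d] (K : Element d) (m : ℕ) (vo : RPoly d)
    (vb : Fin (d + 1) → RPoly d) : VPoly d :=
  Classical.choose (exists_riesz_vec K m (gradFunctional K vo vb))

/-- The functional `φ ↦ -(w_o, ∇φ)_K + ⟨w_b·n, φ⟩_{∂K}`. -/
def divFunctional {d : ℕ} [NeZero d] (K : Element d) (wo : VPoly d)
    (wb : Fin (d + 1) → VPoly d) : RPoly d →ₗ[ℝ] ℝ where
  toFun φ := -(∑ j, innerK K (wo j) (MvPolynomial.pderiv j φ)) +
    ∑ i, innerF K i (dotP (wb i) (normalP K i)) φ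
  map_add' φ ψ := by
    simp only [map_add, innerK_add_right, innerF_add_right, Finset.sum_add_distrib]
    ring
  map_smul' c φ := by
    simp only [Derivation.map_smul, innerK_smul_right, innerF_smul_right, RingHom.id_apply,
      smul_eq_mul, ← Finset.mul_sum]
    ring

/-- The discrete weak divergence `∇_{w,m}·{w_o, w_b}`: the element `g` of `P_m` with
`(g, φ)_K = -(w_o, ∇φ)_K + ⟨w_b·n, φ⟩_{∂K}` for all `φ ∈ P_m`. -/
def weakDiv {d : ℕ} [NeZero d] (K : Element d) (m : ℕ) (wo : VPoly d)
    (wb : Fin (d + 1) → VPoly d) : RPoly d :=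
  Classical.choose (exists_riesz K m (divFunctional K wo wb))

theorem curlP_add (d : ℕ) (φ ψ : Fin (2 * d - 3) → RPoly d) :
    curlP d (φ + ψ) = curlP d φ + curlP d ψ := by
  rcases d with _ | _ | _ | _ | d
  · simp [curlP]
  · simp [curlP]
  · funext j
    fin_cases j <;> simp [curlP] <;> ring
  · funext j
    fin_cases j <;> simp [curlP] <;> ring
  · simp [curlP]

theorem curlP_smul (d : ℕ) (c : ℝ) (φ : Fin (2 * d - 3) → RPoly d) :
    curlP d (c • φ) = c • curlP d φ := by
  rcases d with _ | _ | _ | _ | d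
  · simp [curlP]
  · simp [curlP]
  · funext j
    fin_cases j <;> simp [curlP]
  · funext j
    fin_cases j <;> simp [curlP, smul_sub]
  · simp [curlP]

/-- The functional `φ ↦ (w_o, ∇×φ)_K - ⟨w_b×n, φ⟩_{∂K}`. -/
def curlFunctional {d : ℕ} [NeZero d] (K : Element d) (wo : VPoly d)
    (wb : Fin (d + 1) → VPoly d) : (Fin (2 * d - 3) → RPoly d) →ₗ[ℝ] ℝ where
  toFun φ := ∑ j, innerK K (wo j) (curlP d φ j) -
    ∑ i, ∑ l, innerF K i (cross d (wb i) (normalP K i) l) (φ l)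
  map_add' φ ψ := by
    simp only [curlP_add, Pi.add_apply, innerK_add_right, innerF_add_right,
      Finset.sum_add_distrib]
    ring
  map_smul' c φ := by
    simp only [curlP_smul, Pi.smul_apply, innerK_smul_right, innerF_smul_right,
      RingHom.id_apply, smul_eq_mul, ← Finset.mul_sum]
    ring

/-- The discrete weak curl `∇_{w,m}×{w_o, w_b}`: the element `g` of `[P_m]^{2d-3}` with
`(g, φ)_K = (w_o, ∇×φ)_K - ⟨w_b×n, φ⟩_{∂K}` for all `φ ∈ [P_m]^{2d-3}`. (The sign of the boundary
term is the one of Green's formula, so that smooth fields have weak curl the projected curl.) -/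
def weakCurl {d : ℕ} [NeZero d] (K : Element d) (m : ℕ) (wo : VPoly d)
    (wb : Fin (d + 1) → VPoly d) : Fin (2 * d - 3) → RPoly d :=
  Classical.choose (exists_riesz_vec K m (curlFunctional K wo wb))

/-- The weak gradient of a vector field, row by row. -/
def weakGradV {d : ℕ} [NeZero d] (K : Element d) (m : ℕ) (vo : VPoly d)
    (vb : Fin (d + 1) → VPoly d) : Fin d → VPoly d :=
  fun a => weakGrad K m (vo a) fun i => vb i a

/-- The tensor product `u ⊗ w`, with rows `u_a w`. -/
def tensor {d : ℕ} (u w : VPoly d) : Fin d → VPoly d := fun a b => u a * w b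

/-- The weak divergence of a tensor field, row by row; thus the weak divergence of `u ⊗ w` has the
components `∇·(u_a w)`. -/
def weakDivT {d : ℕ} [NeZero d] (K : Element d) (m : ℕ) (wo : Fin d → VPoly d)
    (wb : Fin (d + 1) → Fin d → VPoly d) : VPoly d :=
  fun a => weakDiv K m (wo a) fun i => wb i a

/-! ### The local forms -/

/-- `(v, w)_K` for fields with `n` components. -/
def innerKv {d n : ℕ} (K : Element d) (v w : Fin n → RPoly d) : ℝ := ∑ l, innerK K (v l) (w l)

/-- `⟨v, w⟩_{∂K}` for fields with `n` components, possibly different on each face. -/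
def innerBv {d n : ℕ} [NeZero d] (K : Element d) (v w : Fin (d + 1) → Fin n → RPoly d) : ℝ :=
  ∑ i, ∑ l, innerF K i (v i l) (w i l)

/-- The field `w × n` on the faces. -/
def crossN {d : ℕ} [NeZero d] (K : Element d) (w : Fin (d + 1) → VPoly d) :
    Fin (d + 1) → Fin (2 * d - 3) → RPoly d :=
  fun i => cross d (w i) (normalP K i)

/-- The trace on the faces of a field given on the simplex. -/
def tr {d : ℕ} (v : VPoly d) : Fin (d + 1) → VPoly d := fun _ => v

/-- `(∇_{w,m} v, ∇_{w,m} w)_K` for weak vector functions. -/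
def innerGrad {d : ℕ} [NeZero d] (K : Element d) (m : ℕ) (vo : VPoly d)
    (vb : Fin (d + 1) → VPoly d) (wo : VPoly d) (wb : Fin (d + 1) → VPoly d) : ℝ :=
  ∑ a, innerKv K (weakGradV K m vo vb a) (weakGradV K m wo wb a)

/-- `a_{h,K}(u_o, v_o)`, including the stabilization `s_{h,K}`. -/
def aK {d : ℕ} [NeZero d] (K : Element d) (k : ℕ) (Ha : ℝ) (u v : VPoly d) : ℝ :=
  1 / Ha ^ 2 * innerGrad K (k - 1) u 0 v 0 + 1 / Ha ^ 2 * (tau K * innerBv K (tr u) (tr v))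

/-- `ã_{h,K}(B_o, w_o)`, including the stabilization `s̃_{h,K}`. -/
def aTK {d : ℕ} [NeZero d] (K : Element d) (k : ℕ) (Rm : ℝ) (B w : VPoly d) : ℝ :=
  1 / Rm ^ 2 * innerKv K (weakCurl K (k - 1) B 0) (weakCurl K (k - 1) w 0) +
    1 / Rm ^ 2 * (tau K * innerBv K (crossN K (tr B)) (crossN K (tr w)))

/-- `b_{h,K}(v_o, q_o) = (∇_{w,k}{q_o, 0}, v_o)_K`. -/
def bK {d : ℕ} [NeZero d] (K : Element d) (k : ℕ) (v : VPoly d) (q : RPoly d) : ℝ :=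
  innerKv K (weakGrad K k q 0) v

/-- `b̃_{h,K}(w_o, θ_o) = (1/R_m) (∇_{w,k}{θ_o, 0}, w_o)_K`. -/
def bTK {d : ℕ} [NeZero d] (K : Element d) (k : ℕ) (Rm : ℝ) (w : VPoly d) (θ : RPoly d) : ℝ :=
  1 / Rm * innerKv K (weakGrad K k θ 0) w

/-- `c_{h,K}(Φ_o; u_o, v_o)`. -/
def cK {d : ℕ} [NeZero d] (K : Element d) (k : ℕ) (N : ℝ) (Φ u v : VPoly d) : ℝ :=
  1 / (2 * N) * innerKv K (weakDivT K k (tensor u Φ) fun _ => tensor 0 0) v -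
    1 / (2 * N) * innerKv K (weakDivT K k (tensor v Φ) fun _ => tensor 0 0) u

/-- `c̃_{h,K}(v_o; B_o, w_o) = (1/R_m) (∇_{w,k}×{w_o, 0}, v_o × B_o)_K`. -/
def cTK {d : ℕ} [NeZero d] (K : Element d) (k : ℕ) (Rm : ℝ) (v B w : VPoly d) : ℝ :=
  1 / Rm * innerKv K (weakCurl K k w 0) (cross d v B)

/-- `(f, v)_K` for a function `f` with values in `ℝ^d`. -/
def innerData {d : ℕ} (K : Element d) (f : E d → E d) (v : VPoly d) : ℝ :=
  ∫ x in K.closedInterior, ∑ j, f x j * val (v j) x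

/-- The functional `F_K`, depending on the load `f` and the traces `u_b`, `p_b`. -/
def FK {d : ℕ} [NeZero d] (K : Element d) (k : ℕ) (Ha N : ℝ) (f : E d → E d)
    (ub : Fin (d + 1) → VPoly d) (pb : Fin (d + 1) → RPoly d) (v : VPoly d) : ℝ :=
  innerData K f v - 1 / Ha ^ 2 * innerGrad K (k - 1) 0 ub v 0 +
    1 / Ha ^ 2 * (tau K * innerBv K ub (tr v)) - innerKv K (weakGrad K k 0 pb) v -
    1 / (2 * N) * innerKv K (weakDivT K k (tensor 0 0) fun i => tensor (ub i) (ub i)) v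

/-- The functional `G_K`, depending on the load `g` and the traces `B_b`, `r_b`. -/
def GK {d : ℕ} [NeZero d] (K : Element d) (k : ℕ) (Rm : ℝ) (g : E d → E d)
    (Bb : Fin (d + 1) → VPoly d) (rb : Fin (d + 1) → RPoly d) (w : VPoly d) : ℝ :=
  1 / Rm * innerData K g w -
    1 / Rm ^ 2 * innerKv K (weakCurl K (k - 1) 0 Bb) (weakCurl K (k - 1) w 0) +
    1 / Rm ^ 2 * (tau K * innerBv K (crossN K Bb) (crossN K (tr w))) -
    1 / Rm * innerKv K (weakGrad K k 0 rb) w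

/-! ### The local problem -/

/-- `(u_o, B_o, p_o, r_o)` belongs to `[P_k]^d × [P_k]^d × P_{k-1} × P_{k-1}` and solves the local
problem for the loads `f, g` and the numerical traces `u_b, B_b, p_b, r_b`. -/
def IsLocalSolution {d : ℕ} [NeZero d] (K : Element d) (k : ℕ) (Ha N Rm : ℝ) (f g : E d → E d)
    (ub Bb : Fin (d + 1) → VPoly d) (pb rb : Fin (d + 1) → RPoly d) (u B : VPoly d)
    (p r : RPoly d) : Prop :=
  u ∈ VPolyLE d k ∧ B ∈ VPolyLE d k ∧ p ∈ PolyLE d (k - 1) ∧ r ∈ PolyLE d (k - 1) ∧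
    ∀ v ∈ VPolyLE d k, ∀ w ∈ VPolyLE d k, ∀ q ∈ PolyLE d (k - 1), ∀ θ ∈ PolyLE d (k - 1),
      aK K k Ha u v + aTK K k Rm B w + bK K k v p - bK K k u q + bTK K k Rm w r - bTK K k Rm B θ
          + cK K k N u u v + cTK K k Rm v B B - cTK K k Rm u B w
        = FK K k Ha N f ub pb v + GK K k Rm g Bb rb w

/-- The space `V̄_{h,K}`. -/
def Vbar {d : ℕ} [NeZero d] (K : Element d) (k : ℕ) : Set (VPoly d) :=
  {v | v ∈ VPolyLE d k ∧ ∀ q ∈ PolyLE d (k - 1), bK K k v q = 0}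

/-- The space `W̄_{h,K}`. -/
def Wbar {d : ℕ} [NeZero d] (K : Element d) (k : ℕ) (Rm : ℝ) : Set (VPoly d) :=
  {w | w ∈ VPolyLE d k ∧ ∀ θ ∈ PolyLE d (k - 1), bTK K k Rm w θ = 0}

/-- The semi-norm `|||v|||_{D,K} = (‖∇_{w,k-1}{v, 0}‖²_K + ‖τ^{1/2} v‖²_{∂K})^{1/2}`. -/
def normD {d : ℕ} [NeZero d] (K : Element d) (k : ℕ) (v : VPoly d) : ℝ :=
  √(innerGrad K (k - 1) v 0 v 0 + tau K * innerBv K (tr v) (tr v))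

/-- The semi-norm `|||w|||_{C,K} = (‖∇_{w,k-1}×{w, 0}‖²_K + ‖τ^{1/2} w×n‖²_{∂K})^{1/2}`. -/
def normC {d : ℕ} [NeZero d] (K : Element d) (k : ℕ) (w : VPoly d) : ℝ :=
  √(innerKv K (weakCurl K (k - 1) w 0) (weakCurl K (k - 1) w 0) +
    tau K * innerBv K (crossN K (tr w)) (crossN K (tr w)))

/-- The constant `M_{h,K}`. -/
def MK {d : ℕ} [NeZero d] (K : Element d) (k : ℕ) (N : ℝ) : ℝ :=
  sSup {t | ∃ Φ ∈ Vbar K k, ∃ u ∈ Vbar K k, ∃ v ∈ Vbar K k, Φ ≠ 0 ∧ u ≠ 0 ∧ v ≠ 0 ∧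
    t = cK K k N Φ u v / (normD K k Φ * normD K k u * normD K k v)}

/-- The constant `M̃_{h,K}`. -/
def MTK {d : ℕ} [NeZero d] (K : Element d) (k : ℕ) (Rm : ℝ) : ℝ :=
  sSup {t | ∃ w ∈ Wbar K k Rm, ∃ B ∈ Wbar K k Rm, ∃ v ∈ Vbar K k, w ≠ 0 ∧ B ≠ 0 ∧ v ≠ 0 ∧
    t = cTK K k Rm v B w / (normC K k w * normD K k v * normC K k B)}

/-- The dual norm `‖F‖_h` of a functional on `V̄_{h,K}`. -/
def dualNormD {d : ℕ} [NeZero d] (K : Element d) (k : ℕ) (F : VPoly d → ℝ) : ℝ :=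
  sSup {t | ∃ v ∈ Vbar K k, v ≠ 0 ∧ t = F v / normD K k v}

/-- The dual norm `‖G‖_h̃` of a functional on `W̄_{h,K}`. -/
def dualNormC {d : ℕ} [NeZero d] (K : Element d) (k : ℕ) (Rm : ℝ) (G : VPoly d → ℝ) : ℝ :=
  sSup {t | ∃ w ∈ Wbar K k Rm, w ≠ 0 ∧ t = G w / normC K k w}

/-- The constant `δ̃ = 12 max{H_a, R_m}³ max{M_{h,K}, M̃_{h,K}}`. -/
def deltaK {d : ℕ} [NeZero d] (K : Element d) (k : ℕ) (Ha N Rm : ℝ) : ℝ :=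
  12 * max Ha Rm ^ 3 * max (MK K k N) (MTK K k Rm)

end

end WGMHD

/-! Existence comes from an energy argument in finite dimensions. Testing with elements of the two
kernel spaces removes the pressures, and what remains for `(u, B)` is a positive definite symmetric
form plus a quadratic term that vanishes when tested with the solution itself: `c(u; u, u) = 0` by
skew symmetry, and the two coupling terms `c̃(u; B, B)` cancel. The residual therefore points
outwards on large spheres, and Brouwer's theorem, in the form of `exists_zero_of_inner_pos`, gives a
zero. The pressures are then recovered by duality: a functional vanishing on the kernel is of the
form `b(·, p)` (`exists_pressure`).

Brouwer's theorem is derived from `no_retraction`: along the homotopy from the identity to a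
retraction, the integral of the Jacobian determinant is polynomial in `t` and equals the volume of
the ball for small `t`, hence also at `t = 1`, where the determinant is zero.

The analytic core is that the two energy forms are definite. For `|||·|||_D` the weak gradient is
tested with the classical gradient. For `|||·|||_C` (`formC_self_eq_zero`), a kernel field `w` is
exactly divergence free; vanishing weak curl and tangential traces make `∇w` symmetric, and then
`div ((w·∇)w) = |∇w|²`. The field `(w·∇)w` has no flux through the faces, so `w` is constant, and a
constant normal to all faces is zero.

All integrations by parts involve fields with vanishing normal component on every face, so no
surface term has to be evaluated. Vanishing on a face is turned into divisibility by a barycentric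
coordinate (`bary_dvd`), and `integral_divP_eq_zero` proves the required divergence theorem with
polynomial cut-offs.

For uniqueness, the energy identity bounds every solution by the data. In the difference of two
solutions tested with itself, the surviving trilinear terms are at most a fraction of the energy
under the smallness condition (`eq_zero_of_small`). The pressures agree because the divergence maps
`[P_k]^d` onto `P_{k-1}`. -/

namespace WGMHD

noncomputable section

/-! ### A zero of a coercive vector field -/

/-- A function that is Lipschitz on a closed set and vanishes on its frontier stays Lipschitz when
extended by zero. -/
theorem lipschitzWith_indicator {V W : Type*} [NormedAddCommGroup V] [NormedSpace ℝ V]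
    [NormedAddCommGroup W] {K : Set V} {C : NNReal} {f : V → W} (hK : IsClosed K)
    (hf : LipschitzOnWith C f K) (h0 : ∀ x ∈ frontier K, f x = 0) :
    LipschitzWith C (K.indicator f) := by
  -- The segment from `x` to `y` is connected, so it meets the frontier at some `z`; there `f z = 0`
  -- and `dist x z ≤ dist x y`.
  have key : ∀ x ∈ K, ∀ y ∉ K, dist (f x) 0 ≤ C * dist x y := by
    intro x hx y hy
    obtain ⟨z, hz, hzK⟩ : (segment ℝ x y ∩ frontier K).Nonempty := by
      by_contra hne
      rw [Set.not_nonempty_iff_eq_empty] at hne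
      have hin : ∀ z ∈ segment ℝ x y, z ∈ K → z ∈ interior K := fun z hz hzK =>
        by_contra fun hi => by
          have : z ∈ segment ℝ x y ∩ frontier K := ⟨hz, by
            rw [hK.frontier_eq]
            exact ⟨hzK, hi⟩⟩
          simp [hne] at this
      obtain ⟨z, -, hz1, hz2⟩ := (convex_segment (𝕜 := ℝ) x y).isPreconnected (interior K) Kᶜ
        isOpen_interior hK.isOpen_compl
        (fun z hz => (em (z ∈ K)).imp (hin z hz) id)
        ⟨x, left_mem_segment ℝ x y, hin x (left_mem_segment ℝ x y) hx⟩
        ⟨y, right_mem_segment ℝ x y, hy⟩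
      exact hz2 (interior_subset hz1)
    have h1 := hf.dist_le_mul x hx z (hK.frontier_subset hzK)
    rw [h0 z hzK] at h1
    refine h1.trans (mul_le_mul_of_nonneg_left ?_ C.coe_nonneg)
    have := dist_add_dist_of_mem_segment hz
    linarith [dist_nonneg (x := z) (y := y)]
  refine LipschitzWith.of_dist_le_mul fun x y => ?_
  by_cases hx : x ∈ K <;> by_cases hy : y ∈ K
  · simpa [hx, hy] using hf.dist_le_mul x hx y hy
  · simpa [hx, hy] using key x hx y hy
  · rw [dist_comm, dist_comm x y]
    simpa [hx, hy] using key y hy x hx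
  · simp only [Set.indicator_of_notMem hx, Set.indicator_of_notMem hy, dist_self]
    positivity

/-! ### Brouwer's theorem and solvability of energy-neutral quadratic problems -/

section Brouwer

variable {V : Type*} [NormedAddCommGroup V] [InnerProductSpace ℝ V] [FiniteDimensional ℝ V]

/-- `det (1 + t A)` is a polynomial in `t` of degree at most the dimension. -/
theorem exists_polynomial_det_one_add_smul (A : V →L[ℝ] V) :
    ∃ p : Polynomial ℝ, p.natDegree ≤ Module.finrank ℝ V ∧
      ∀ t : ℝ, p.eval t = (ContinuousLinearMap.id ℝ V + t • A).det := by
  let b := Module.finBasis ℝ V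
  let M := LinearMap.toMatrix b b A.toLinearMap
  refine ⟨((Polynomial.X : Polynomial ℝ) • M.map Polynomial.C +
    (1 : Matrix _ _ ℝ).map Polynomial.C).det, ?_, fun t => ?_⟩
  · simpa using Polynomial.natDegree_det_X_add_C_le M 1
  · have h : LinearMap.toMatrix b b ((ContinuousLinearMap.id ℝ V + t • A : V →L[ℝ] V) : V →ₗ[ℝ] V)
        = 1 + t • M := by
      rw [show ((ContinuousLinearMap.id ℝ V + t • A : V →L[ℝ] V) : V →ₗ[ℝ] V)
        = LinearMap.id + t • A.toLinearMap from rfl, map_add, map_smul, LinearMap.toMatrix_id]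
    rw [← Polynomial.coe_evalRingHom, RingHom.map_det, ContinuousLinearMap.det,
      ← LinearMap.det_toMatrix b, h]
    congr 1
    ext i j
    simp [Matrix.add_apply, Matrix.one_apply, apply_ite, add_comm]
    exact mul_comm _ _

/-- There is no `C¹` retraction of a ball onto its boundary sphere. -/
theorem no_retraction {f : V → V} (hf : ContDiff ℝ 1 f) {R : ℝ} (hR : 0 < R)
    (hS : ∀ x, ‖x‖ = R → f x = x) (hn : ∀ x, ‖f x‖ = R) : False := by
  let _ : MeasurableSpace V := borel V
  have _ : BorelSpace V := ⟨rfl⟩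
  let D : Set V := Metric.closedBall 0 R
  have hDc : IsCompact D := isCompact_closedBall 0 R
  have hDconv : Convex ℝ D := convex_closedBall 0 R
  have hfd : Differentiable ℝ f := hf.differentiable one_ne_zero
  let A : V → V →L[ℝ] V := fun x => fderiv ℝ f x - ContinuousLinearMap.id ℝ V
  have hAc : Continuous A := (hf.continuous_fderiv one_ne_zero).sub continuous_const
  have hA : ∀ x, HasFDerivAt (fun y => f y - y) (A x) x := fun x =>
    (hfd x).hasFDerivAt.sub (hasFDerivAt_id x)
  obtain ⟨L, hL0, hL⟩ : ∃ L : ℝ, 0 < L ∧ ∀ x ∈ D, ‖A x‖ ≤ L := by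
    obtain ⟨L, hL⟩ := hDc.exists_bound_of_continuousOn hAc.continuousOn
    exact ⟨max L 1, by positivity, fun x hx => (hL x hx).trans (le_max_left _ _)⟩
  let C : NNReal := ⟨L, hL0.le⟩
  have hlip : LipschitzOnWith C (fun y => f y - y) D :=
    hDconv.lipschitzOnWith_of_nnnorm_hasFDerivWithin_le
      (fun x _ => (hA x).hasFDerivWithinAt) (fun x hx => hL x hx)
  -- The displacement `f - id` vanishes on the sphere, so its extension by zero keeps the Lipschitz
  -- constant `L` on the whole space.
  have hG : LipschitzWith C (D.indicator fun y => f y - y) := by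
    refine lipschitzWith_indicator Metric.isClosed_closedBall hlip fun x hx => ?_
    have := Metric.frontier_closedBall_subset_sphere hx
    rw [hS x (by simpa using this), sub_self]
  let P : ℝ → V → V := fun t x => x + t • (f x - x)
  have hP : ∀ t x, HasFDerivAt (P t) (ContinuousLinearMap.id ℝ V + t • A x) x := fun t x =>
    (hasFDerivAt_id x).add ((hA x).const_smul t)
  -- `P t` maps the ball into itself by convexity. It is onto because `P t x = y` is a fixed point
  -- equation for a contraction of factor `t L`; a fixed point outside the ball would equal `y`,
  -- which lies in the ball.
  have himage : ∀ t : ℝ, 0 ≤ t → t ≤ 1 → t * L < 1 → P t '' D = D := by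
    intro t ht0 ht1 htL
    apply Set.Subset.antisymm
    · rintro _ ⟨x, hx, rfl⟩
      have hfx : f x ∈ D := by simp [D, hn x]
      have := hDconv hx hfx (sub_nonneg.2 ht1) ht0 (by ring)
      convert this using 1
      simp only [P]
      module
    · intro y hy
      let T : V → V := fun x => y - t • D.indicator (fun y => f y - y) x
      let t' : NNReal := ⟨t, ht0⟩
      have hT : ContractingWith (t' * C) T := by
        refine ⟨by exact_mod_cast htL, LipschitzWith.of_dist_le_mul fun a b => ?_⟩
        simp only [T, dist_sub_left]
        rw [dist_smul₀, Real.norm_of_nonneg ht0]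
        change _ ≤ t * L * dist a b
        rw [mul_assoc]
        exact mul_le_mul_of_nonneg_left (hG.dist_le_mul a b) ht0
      have hx : T (hT.fixedPoint T) = hT.fixedPoint T := hT.fixedPoint_isFixedPt
      set x := hT.fixedPoint T
      have hxD : x ∈ D := by
        by_contra hxD
        simp only [T, Set.indicator_of_notMem hxD, smul_zero, sub_zero] at hx
        exact hxD (hx ▸ hy)
      refine ⟨x, hxD, ?_⟩
      simp only [T, Set.indicator_of_mem hxD] at hx
      exact (sub_eq_iff_eq_add.1 hx).symm
  have hinj : ∀ t : ℝ, 0 ≤ t → t * L < 1 → Set.InjOn (P t) D := by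
    intro t ht0 htL x hx y hy hxy
    have h1 : x - y = t • ((f y - y) - (f x - x)) := by
      have : x + t • (f x - x) = y + t • (f y - y) := hxy
      rw [smul_sub, sub_eq_sub_iff_add_eq_add, this, add_comm]
    have h2 := hlip.dist_le_mul y hy x hx
    rw [dist_eq_norm, dist_eq_norm, norm_sub_rev y x] at h2
    have h3 : ‖x - y‖ ≤ t * (L * ‖x - y‖) := by
      conv_lhs => rw [h1, norm_smul, Real.norm_of_nonneg ht0]
      exact mul_le_mul_of_nonneg_left h2 ht0
    have h4 : ‖x - y‖ = 0 := by
      by_contra hne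
      have : 0 < ‖x - y‖ := lt_of_le_of_ne (norm_nonneg _) (Ne.symm hne)
      nlinarith
    exact sub_eq_zero.1 (norm_eq_zero.1 h4)
  choose p hpdeg hpeval using fun x => exists_polynomial_det_one_add_smul (A x)
  -- The determinant is `1` at `t = 0`. If it were not positive at `t`, it would vanish at some `s ≤
  -- t`, and a kernel vector would satisfy `‖v‖ ≤ s L ‖v‖ < ‖v‖`.
  have hdet : ∀ t : ℝ, 0 ≤ t → t * L < 1 → ∀ x ∈ D, 0 < (p x).eval t := by
    intro t ht0 htL x hx
    by_contra hneg
    have h0 : (p x).eval 0 = 1 := by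
      rw [hpeval, zero_smul, add_zero]
      exact LinearMap.det_id
    obtain ⟨s, hs, hs0⟩ : (0 : ℝ) ∈ (fun s => (p x).eval s) '' Set.Icc 0 t :=
      intermediate_value_Icc' ht0 (p x).continuous.continuousOn ⟨not_lt.1 hneg, by simp [h0]⟩
    simp only [hpeval] at hs0
    have hsurj := LinearMap.bot_lt_ker_of_det_eq_zero hs0
    obtain ⟨v, hv, hv0⟩ := (Submodule.ne_bot_iff _).1 hsurj.ne'
    have h1 : v = -(s • A x v) := eq_neg_of_add_eq_zero_left hv
    have h2 : ‖v‖ ≤ s * (L * ‖v‖) := by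
      conv_lhs => rw [h1, norm_neg, norm_smul, Real.norm_of_nonneg hs.1]
      exact mul_le_mul_of_nonneg_left
        (((A x).le_opNorm v).trans (mul_le_mul_of_nonneg_right (hL x hx) (norm_nonneg _))) hs.1
    have h3 : 0 < ‖v‖ := norm_pos_iff.2 hv0
    have h4 : s * L ≤ t * L := mul_le_mul_of_nonneg_right hs.2 hL0.le
    nlinarith
  have hcont : ∀ t : ℝ, Continuous fun x => (p x).eval t := by
    intro t
    simp only [hpeval]
    exact ContinuousLinearMap.continuous_det.comp (by fun_prop)
  have hint : ∀ t : ℝ, IntegrableOn (fun x => (p x).eval t) D volume := fun t =>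
    (hcont t).continuousOn.integrableOn_compact hDc
  -- For small `t` the map is an injection of the ball onto itself with positive Jacobian, so the
  -- change of variables formula applies without absolute value.
  have hvol : ∀ t : ℝ, 0 ≤ t → t ≤ 1 → t * L < 1 →
      ∫ x in D, (p x).eval t = (volume : Measure V).real D := by
    intro t ht0 ht1 htL
    have := integral_image_eq_integral_abs_det_fderiv_smul (volume : Measure V)
      Metric.isClosed_closedBall.measurableSet (fun x (_ : x ∈ D) => (hP t x).hasFDerivWithinAt)
      (hinj t ht0 htL) (fun _ => (1 : ℝ))
    rw [himage t ht0 ht1 htL] at this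
    simp only [smul_eq_mul, mul_one, integral_const, MeasurableSet.univ, measureReal_restrict_apply,
      Set.univ_inter] at this
    rw [this]
    refine setIntegral_congr_fun Metric.isClosed_closedBall.measurableSet fun x hx => ?_
    rw [hpeval, abs_of_pos]
    rw [← hpeval]
    exact hdet t ht0 htL x hx
  let n := Module.finrank ℝ V
  -- The identity is known only for `t ≤ 1` with `t L < 1`. The `n + 1` distinct nodes `ε / (j + 1)`
  -- all lie in this range and determine a polynomial of degree at most `n`.
  let ε : ℝ := min 1 (1 / (2 * L))
  have hε : 0 < ε := by positivity
  let τ : ℕ → ℝ := fun j => ε / (j + 1)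
  have hτinj : Set.InjOn τ (Finset.range (n + 1)) := by
    intro i _ j _ hij
    have hij' : ε / ((i : ℝ) + 1) = ε / (j + 1) := hij
    have h1 : (i : ℝ) + 1 ≠ 0 := by positivity
    have h2 : (j : ℝ) + 1 ≠ 0 := by positivity
    rw [div_eq_div_iff h1 h2] at hij'
    have := mul_left_cancel₀ hε.ne' hij'
    exact_mod_cast (add_right_cancel this).symm
  have hτ : ∀ j, 0 ≤ τ j ∧ τ j ≤ 1 ∧ τ j * L < 1 := by
    intro j
    have h1 : τ j ≤ ε := div_le_self hε.le (by simp)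
    refine ⟨by positivity, h1.trans (min_le_left _ _), ?_⟩
    have h2 : τ j ≤ 1 / (2 * L) := h1.trans (min_le_right _ _)
    calc τ j * L ≤ 1 / (2 * L) * L := mul_le_mul_of_nonneg_right h2 hL0.le
      _ = 1 / 2 := by field_simp
      _ < 1 := by norm_num
  -- Extrapolation weights from the nodes to `t = 1`. They do not depend on `x`, so extrapolation
  -- commutes with the integral; applied to the constant polynomial it shows that their sum is `1`.
  let ℓ : ℕ → ℝ := fun j => (Lagrange.basis (Finset.range (n + 1)) τ j).eval 1
  have hℓ : ∀ q : Polynomial ℝ, q.natDegree ≤ n →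
      q.eval 1 = ∑ j ∈ Finset.range (n + 1), q.eval (τ j) * ℓ j := by
    intro q hq
    have hdeg : q.degree < (Finset.range (n + 1)).card := by
      rw [Finset.card_range]
      exact Polynomial.degree_le_natDegree.trans_lt (by exact_mod_cast Nat.lt_succ_of_le hq)
    conv_lhs => rw [Lagrange.eq_interpolate hτinj hdeg]
    simp [Lagrange.interpolate_apply, Polynomial.eval_finsetSum, ℓ]
  have h1 : ∫ x in D, (p x).eval 1 = (volume : Measure V).real D := by
    simp only [fun x => hℓ (p x) (hpdeg x)]
    rw [integral_finsetSum _ fun j _ => (hint (τ j)).mul_const _]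
    simp only [integral_mul_const]
    rw [Finset.sum_congr rfl fun j _ => by rw [hvol (τ j) (hτ j).1 (hτ j).2.1 (hτ j).2.2]]
    have := hℓ 1 (by simp)
    simp only [Polynomial.eval_one, one_mul] at this
    rw [← Finset.mul_sum, ← this, mul_one]
  -- Differentiating `‖f‖² = R²` shows that the range of `f'(x)` is orthogonal to `f x`. An
  -- invertible `f'(x)` would have `f x` in its range, contradicting `R > 0`.
  have h0 : ∀ x, (p x).eval 1 = 0 := by
    intro x
    rw [hpeval, one_smul]
    have he : ContinuousLinearMap.id ℝ V + A x = fderiv ℝ f x := by simp [A]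
    rw [he]
    by_contra hne
    have horth : ∀ v, inner ℝ (f x) (fderiv ℝ f x v) = 0 := by
      intro v
      have hd := ((hfd x).hasFDerivAt.inner ℝ (hfd x).hasFDerivAt)
      have hc : (fun y => inner ℝ (f y) (f y)) = fun _ => R ^ 2 := by
        funext y
        rw [real_inner_self_eq_norm_sq, hn]
      rw [hc] at hd
      have := congrArg (fun B => B v) (hd.unique (hasFDerivAt_const (R ^ 2) x))
      simp [fderivInnerCLM_apply, real_inner_comm] at this
      linarith
    let e := LinearEquiv.ofIsUnitDet (f := (fderiv ℝ f x).toLinearMap)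
      (v := Module.finBasis ℝ V) (v' := Module.finBasis ℝ V)
      (by rw [LinearMap.det_toMatrix]; exact isUnit_iff_ne_zero.2 hne)
    have h2 := horth (e.symm (f x))
    have h3 : fderiv ℝ f x (e.symm (f x)) = f x := e.apply_symm_apply (f x)
    rw [h3, real_inner_self_eq_norm_sq, hn] at h2
    exact (pow_pos hR 2).ne' h2
  simp only [h0, integral_zero] at h1
  have hpos : 0 < (volume : Measure V) D := Metric.measure_closedBall_pos _ _ hR
  have hfin : (volume : Measure V) D < ⊤ := hDc.measure_lt_top
  exact (ENNReal.toReal_pos hpos.ne' hfin.ne).ne h1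

/-- A `C¹` vector field pointing outwards outside a ball has a zero. -/
theorem exists_zero_of_inner_pos {P : V → V} (hP : ContDiff ℝ 1 P) {R : ℝ} (hR : 0 < R)
    (h : ∀ x, R ≤ ‖x‖ → 0 < inner ℝ (P x) x) : ∃ x, P x = 0 := by
  by_contra! hne
  -- Blending with the identity between radii `R` and `2R` creates no zero, since both fields have
  -- positive inner product with `x` there. The blend is the identity on the sphere of radius `3R`,
  -- so scaling its values to length `3R` gives a forbidden retraction.
  let χ : ContDiffBump (0 : V) := ⟨R, 2 * R, hR, by linarith⟩
  let Q : V → V := fun x => χ x • P x + (1 - χ x) • x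
  have hQ : ContDiff ℝ 1 Q :=
    (χ.contDiff.smul hP).add ((contDiff_const.sub χ.contDiff).smul contDiff_id)
  have hQ0 : ∀ x, Q x ≠ 0 := by
    intro x
    rcases le_total ‖x‖ R with hx | hx
    · have : χ x = 1 := χ.one_of_mem_closedBall (by simpa [χ] using hx)
      simpa [Q, this] using hne x
    · intro h0
      have h1 : 0 < inner ℝ (Q x) x := by
        simp only [Q, inner_add_left, real_inner_smul_left, real_inner_self_eq_norm_sq]
        have h2 := h x hx
        have h3 : 0 < ‖x‖ ^ 2 := by
          have : 0 < ‖x‖ := hR.trans_le hx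
          positivity
        have h4 := χ.nonneg (x := x)
        have h5 := χ.le_one (x := x)
        rcases h4.eq_or_lt with h6 | h6
        · rw [← h6]
          linarith
        · have := mul_pos h6 h2
          have := mul_nonneg (sub_nonneg.2 h5) h3.le
          linarith
      simp [h0] at h1
  have hQR : ∀ x, ‖x‖ = 3 * R → Q x = x := by
    intro x hx
    have : χ x = 0 := χ.zero_of_le_dist (by simp [χ, hx]; linarith)
    simp [Q, this]
  refine no_retraction (f := fun x => (3 * R / ‖Q x‖) • Q x) (R := 3 * R) ?_ (by linarith) ?_ ?_
  · exact (contDiff_const.div (hQ.norm ℝ hQ0) fun x => norm_ne_zero_iff.2 (hQ0 x)).smul hQ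
  · intro x hx
    simp only [hQR x hx, hx]
    rw [div_self (by positivity), one_smul]
  · intro x
    have := norm_pos_iff.2 (hQ0 x)
    rw [norm_smul, Real.norm_of_nonneg (by positivity)]
    field_simp

/-- Solvability of a quadratic problem whose quadratic part is energy neutral. -/
theorem exists_solution_of_energy_neutral (T : V →ₗ[ℝ] V →ₗ[ℝ] V →ₗ[ℝ] ℝ)
    (hT : ∀ x, T x x x = 0) (F : V →ₗ[ℝ] ℝ) :
    ∃ x, ∀ y, inner ℝ x y + T x x y = F y := by
  let b := stdOrthonormalBasis ℝ V
  -- The Riesz representative of the residual at `x`; its zeros are the solutions.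
  let P : V → V := fun x => ∑ i, (inner ℝ x (b i) + T x x (b i) - F (b i)) • b i
  have hPi : ∀ x y, inner ℝ (P x) y = inner ℝ x y + T x x y - F y := by
    intro x y
    conv_rhs => rw [← b.sum_repr' y]
    simp only [P, sum_inner, real_inner_smul_left, inner_sum, real_inner_smul_right, map_sum,
      map_smul, smul_eq_mul, ← Finset.sum_add_distrib, ← Finset.sum_sub_distrib]
    exact Finset.sum_congr rfl fun i _ => by ring
  have hP : ContDiff ℝ 1 P := by
    refine ContDiff.sum fun i _ => ContDiff.smul ?_ contDiff_const
    refine ((contDiff_id.inner ℝ contDiff_const).add ?_).sub contDiff_const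
    have hexp : (fun x => T x x (b i)) = fun x =>
        ∑ j, inner ℝ (b j) x * T (b j) x (b i) := by
      funext x
      have h1 : T x = ∑ j, inner ℝ (b j) x • T (b j) := by
        conv_lhs => rw [← b.sum_repr' x]
        simp only [map_sum, map_smul]
      conv_lhs => rw [h1]
      simp only [LinearMap.sum_apply, LinearMap.smul_apply, smul_eq_mul]
    rw [hexp]
    refine ContDiff.sum fun j _ => (contDiff_const.inner ℝ contDiff_id).mul ?_
    exact (LinearMap.toContinuousLinearMap ((T (b j)).flip (b i))).contDiff
  let F' := LinearMap.toContinuousLinearMap F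
  -- By neutrality the inner product with `x` is `‖x‖² - F x`, which is positive as soon as `‖x‖`
  -- exceeds `‖F‖`.
  obtain ⟨x, hx⟩ := exists_zero_of_inner_pos hP (R := ‖F'‖ + 1) (by positivity) fun x hx => by
    rw [hPi, hT, real_inner_self_eq_norm_sq]
    have h1 : F x ≤ ‖F'‖ * ‖x‖ := (le_abs_self _).trans (F'.le_opNorm x)
    nlinarith [norm_nonneg F', norm_nonneg x]
  refine ⟨x, fun y => ?_⟩
  have := hPi x y
  rw [hx, inner_zero_left] at this
  linarith

end Brouwer

section Geometry

/-! ### Barycentric coordinates of the simplex as polynomials -/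

theorem val_mul {d : ℕ} (p q : RPoly d) (x : E d) : val (p * q) x = val p x * val q x := by
  simp [val]

theorem val_sub {d : ℕ} (p q : RPoly d) (x : E d) : val (p - q) x = val p x - val q x := by
  simp [val]

theorem val_zero {d : ℕ} (x : E d) : val (0 : RPoly d) x = 0 := by
  simp [val]

theorem val_C {d : ℕ} (c : ℝ) (x : E d) : val (MvPolynomial.C c : RPoly d) x = c := by
  simp [val]

theorem val_sum {d : ℕ} {ι : Type*} (s : Finset ι) (p : ι → RPoly d) (x : E d) :
    val (∑ i ∈ s, p i) x = ∑ i ∈ s, val (p i) x := by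
  simp [val]

variable {d : ℕ} [NeZero d] (K : Element d)

/-- The barycentric coordinate belonging to the vertex `i`. -/
def bary (i : Fin (d + 1)) : RPoly d :=
  MvPolynomial.C (1 + inner ℝ (normal K i) (K.points i) / K.height i) -
    ∑ j, MvPolynomial.C (normal K i j / K.height i) * MvPolynomial.X j

theorem val_bary (i : Fin (d + 1)) (x : E d) :
    val (bary K i) x = 1 - inner ℝ (normal K i) (x - K.points i) / K.height i := by
  have h : ∑ j, normal K i j / K.height i * x j = inner ℝ (normal K i) x / K.height i := by
    rw [PiLp.inner_apply, Finset.sum_div]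
    exact Finset.sum_congr rfl fun j _ => by simp; ring
  simp only [val, bary, map_sub, map_sum, map_mul, MvPolynomial.eval_C, MvPolynomial.eval_X, h,
    inner_sub_right]
  ring

theorem pderiv_bary (i : Fin (d + 1)) (j : Fin d) :
    MvPolynomial.pderiv j (bary K i) = MvPolynomial.C (-(normal K i j / K.height i)) := by
  simp [bary, MvPolynomial.pderiv_X, Pi.single_apply]

/-- The barycentric coordinate is affine with gradient `-n / height`. Conditions on normal or
tangential components can thus be expressed with its derivatives, which suits the Leibniz rule. -/
theorem normalP_eq (i : Fin (d + 1)) (j : Fin d) :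
    normalP K i j = MvPolynomial.C (-K.height i) * MvPolynomial.pderiv j (bary K i) := by
  rw [pderiv_bary, ← map_mul, normalP]
  congr 1
  field_simp [(K.height_pos i).ne']

/-- For `j ≠ i` the projection of the edge `points j - points i` onto the altitude is the whole
altitude. -/
theorem val_bary_point (i j : Fin (d + 1)) :
    val (bary K i) (K.points j) = if j = i then 1 else 0 := by
  rw [val_bary]
  split_ifs with h
  · simp [h]
  · have h1 := K.inner_vsub_vsub_altitudeFoot_eq_height_sq (i := i) (j := j) (Ne.symm h)
    have hpos := K.height_pos i
    simp only [vsub_eq_sub] at h1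
    rw [normal, real_inner_smul_left, real_inner_comm, ← neg_sub (K.points i) (K.points j),
      ← neg_sub (K.points i) (K.altitudeFoot i), inner_neg_neg, h1]
    field_simp
    simp

theorem val_bary_sum (i : Fin (d + 1)) {w : Fin (d + 1) → ℝ} (hw : ∑ l, w l = 1) :
    val (bary K i) (∑ l, w l • K.points l) = w i := by
  have h1 : ∑ l, w l • K.points l - K.points i = ∑ l, w l • (K.points l - K.points i) := by
    simp only [smul_sub, Finset.sum_sub_distrib, ← Finset.sum_smul, hw, one_smul]
  have h2 : val (bary K i) (∑ l, w l • K.points l) = ∑ l, w l * val (bary K i) (K.points l) := by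
    simp only [val_bary]
    rw [h1, inner_sum, Finset.sum_div]
    simp only [real_inner_smul_right, mul_sub, Finset.sum_sub_distrib, mul_one, hw, mul_div_assoc]
  rw [h2]
  simp [val_bary_point]

theorem exists_weights {d : ℕ} (K : Element d) (x : E d) : ∃ w : Fin (d + 1) → ℝ, ∑ l, w l = 1 ∧
    Finset.univ.affineCombination ℝ K.points w = x := by
  have htop : affineSpan ℝ (Set.range K.points) = ⊤ :=
    K.independent.affineSpan_eq_top_iff_card_eq_finrank_add_one.2 (by simp)
  obtain ⟨w, hw, h⟩ := eq_affineCombination_of_mem_affineSpan_of_fintype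
    (k := ℝ) (p := K.points) (p1 := x) (by rw [htop]; trivial)
  exact ⟨w, hw, h.symm⟩

theorem val_bary_affineCombination (i : Fin (d + 1)) {w : Fin (d + 1) → ℝ} (hw : ∑ l, w l = 1) :
    val (bary K i) (Finset.univ.affineCombination ℝ K.points w) = w i := by
  rw [Finset.affineCombination_eq_linear_combination _ _ _ hw, val_bary_sum K i hw]

theorem sum_val_bary (x : E d) : ∑ l, val (bary K l) x = 1 := by
  obtain ⟨w, hw, rfl⟩ := exists_weights K x
  simp only [val_bary_affineCombination K _ hw, hw]

theorem sum_val_bary_smul (x : E d) : ∑ l, val (bary K l) x • K.points l = x := by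
  obtain ⟨w, hw, rfl⟩ := exists_weights K x
  simp only [val_bary_affineCombination K _ hw]
  rw [Finset.affineCombination_eq_linear_combination _ _ _ hw]

theorem mem_closedInterior_iff (x : E d) :
    x ∈ K.closedInterior ↔ ∀ i, 0 ≤ val (bary K i) x := by
  obtain ⟨w, hw, rfl⟩ := exists_weights K x
  rw [Affine.Simplex.affineCombination_mem_closedInterior_iff hw]
  simp only [val_bary_affineCombination K _ hw]
  refine ⟨fun h i => (h i).1, fun h i => ⟨h i, ?_⟩⟩
  rw [← hw]
  exact Finset.single_le_sum (fun l _ => h l) (Finset.mem_univ i)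

theorem mem_affineSpan_faceOpposite_iff (i : Fin (d + 1)) (x : E d) :
    x ∈ affineSpan ℝ (Set.range (K.faceOpposite i).points) ↔ val (bary K i) x = 0 := by
  obtain ⟨w, hw, rfl⟩ := exists_weights K x
  rw [Affine.Simplex.affineCombination_mem_affineSpan_faceOpposite_iff hw,
    val_bary_affineCombination K _ hw]

theorem mem_face {i : Fin (d + 1)} {x : E d} (h0 : val (bary K i) x = 0)
    (h : ∀ l, 0 ≤ val (bary K l) x) : x ∈ face K i := by
  obtain ⟨w, hw, rfl⟩ := exists_weights K x
  simp only [val_bary_affineCombination K _ hw] at h0 h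
  rw [face, Affine.Simplex.faceOpposite,
    Affine.Simplex.affineCombination_mem_closedInterior_face_iff_nonneg _ _ hw]
  exact ⟨fun l _ => h l, fun l hl => by
    have : l = i := by simpa using hl
    rw [this, h0]⟩

theorem exists_val_bary_eq_zero_of_mem_frontier {x : E d} (hx : x ∈ frontier K.closedInterior) :
    ∃ i, val (bary K i) x = 0 := by
  by_contra! hne
  have hcl : IsClosed K.closedInterior := K.isCompact_closedInterior.isClosed
  have hxK := (mem_closedInterior_iff K x).1 (hcl.frontier_subset hx)
  rw [hcl.frontier_eq] at hx
  refine hx.2 (mem_interior.2 ⟨{y | ∀ i, 0 < val (bary K i) y}, fun y hy =>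
    (mem_closedInterior_iff K y).2 fun i => (hy i).le, ?_, fun i => (hxK i).lt_of_ne (hne i).symm⟩)
  simp only [Set.ofPred_forall]
  exact isOpen_iInter_of_finite fun i => isOpen_lt continuous_const (continuous_val _)

theorem ae_val_bary_ne_zero : ∀ᵐ x : E d, ∀ i, val (bary K i) x ≠ 0 := by
  rw [ae_all_iff]
  intro i
  have h := Measure.addHaar_affineSubspace (volume : Measure (E d))
    (affineSpan ℝ (Set.range (K.faceOpposite i).points)) (fun htop =>
      K.points_notMem_affineSpan_faceOpposite i (by rw [htop]; trivial))
  rw [ae_iff]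
  convert h using 2
  ext x
  simpa using (mem_affineSpan_faceOpposite_iff K i x).symm

theorem ae_restrict_val_bary_pos :
    ∀ᵐ x ∂(volume.restrict K.closedInterior), ∀ i, 0 < val (bary K i) x := by
  filter_upwards [ae_restrict_of_ae (ae_val_bary_ne_zero K),
    ae_restrict_mem K.isCompact_closedInterior.isClosed.measurableSet] with x hx hxK i
  exact ((mem_closedInterior_iff K x).1 hxK i).lt_of_ne (hx i).symm

theorem eq_zero_of_val_eq_zero {p : RPoly d}
    (h : ∀ x, (∀ i, 0 < val (bary K i) x) → val p x = 0) : p = 0 := by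
  refine innerK_self_eq_zero K ?_
  rw [innerK, ← integral_zero (E d) ℝ (μ := volume.restrict K.closedInterior)]
  refine integral_congr_ae ?_
  filter_upwards [ae_restrict_val_bary_pos K] with x hx
  rw [h x hx, zero_mul]

/-! ### Polynomials vanishing on a face -/

/-- On the affine span of the face the Hausdorff measure is Lebesgue measure, transported by an
isometry. The points of the relative interior where `q ≠ 0` form a relatively open null set, which
is empty. -/
theorem val_eq_zero_of_innerF_eq_zero {i : Fin (d + 1)} {q : RPoly d} (h : innerF K i q q = 0)
    {x : E d} (hx0 : val (bary K i) x = 0) (hx : ∀ l, l ≠ i → 0 < val (bary K l) x) :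
    val q x = 0 := by
  have hae := (integral_eq_zero_iff_of_nonneg (fun x => mul_self_nonneg _)
    (integrable_innerF K i q q)).1 h
  let A := affineSpan ℝ (Set.range (K.faceOpposite i).points)
  have hA : Nonempty A := ⟨⟨x, (mem_affineSpan_faceOpposite_iff K i x).2 hx0⟩⟩
  have hr : Module.finrank ℝ A.direction = d - 1 := by
    rw [direction_affineSpan]
    exact (K.faceOpposite i).independent.finrank_vectorSpan (by simp)
  by_contra hq
  let U : Set A := {y | (∀ l, l ≠ i → 0 < val (bary K l) y) ∧ val q y ≠ 0}
  have hUo : IsOpen U := by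
    have hc : ∀ p : RPoly d, Continuous fun y : A => val p y := fun p =>
      (continuous_val p).comp continuous_subtype_val
    have hU : U = (⋂ l, ⋂ (_ : l ≠ i), {y : A | 0 < val (bary K l) y}) ∩
        {y : A | val q y ≠ 0} := by
      ext y
      simp [U]
    rw [hU]
    refine IsOpen.inter ?_ (isOpen_ne_fun (hc q) continuous_const)
    exact isOpen_iInter_of_finite fun l => isOpen_iInter_of_finite fun _ =>
      isOpen_lt continuous_const (hc _)
  have hsub : Subtype.val '' U ⊆ face K i := by
    rintro _ ⟨y, hy, rfl⟩
    have hy0 := (mem_affineSpan_faceOpposite_iff K i y).1 y.2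
    refine mem_face K hy0 fun l => ?_
    by_cases hl : l = i
    · rw [hl, hy0]
    · exact (hy.1 l hl).le
  have hnull : (μHE[d - 1] : Measure (E d)) (Subtype.val '' U) = 0 := by
    rw [← Measure.restrict_eq_self _ hsub]
    refine measure_mono_null ?_ (ae_iff.1 hae)
    rintro _ ⟨y, hy, rfl⟩
    simpa using hy.2
  have hmp := EuclideanGeometry.measurePreserving_vaddConst (Classical.arbitrary A)
  rw [AffineSubspace.euclideanHausdorffMeasure_coe_image, ← hr,
    ← hmp.measure_preimage hUo.measurableSet.nullMeasurableSet] at hnull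
  have hpre : IsOpen (IsometryEquiv.vaddConst (Classical.arbitrary A) ⁻¹' U) :=
    hUo.preimage (IsometryEquiv.vaddConst (Classical.arbitrary A)).continuous
  have hempty := hpre.measure_eq_zero_iff volume |>.1 hnull
  have hxU : (⟨x, (mem_affineSpan_faceOpposite_iff K i x).2 hx0⟩ : A) ∈ U := ⟨hx, hq⟩
  obtain ⟨z, hz⟩ := (IsometryEquiv.vaddConst (Classical.arbitrary A)).surjective
    ⟨x, (mem_affineSpan_faceOpposite_iff K i x).2 hx0⟩
  rw [← hz] at hxU
  exact (hempty ▸ hxU : z ∈ (∅ : Set _))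

/-- A polynomial that vanishes on a face is divisible by the barycentric coordinate that cuts out
the face. -/
theorem bary_dvd {i : Fin (d + 1)} {q : RPoly d}
    (h : ∀ x, val (bary K i) x = 0 → (∀ l, l ≠ i → 0 < val (bary K l) x) → val q x = 0) :
    bary K i ∣ q := by
  -- The substitution `x ↦ x - λ_i(x) v` projects onto the hyperplane `λ_i = 0` along an edge at the
  -- vertex `i`. It changes `q` only by a multiple of `λ_i`, so it suffices that the substituted
  -- polynomial `θ` is zero.
  obtain ⟨m, hm⟩ : ∃ m : Fin (d + 1), m ≠ i := exists_ne i
  let v : E d := K.points i - K.points m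
  let g : Fin d → RPoly d := fun j => MvPolynomial.X j - bary K i * MvPolynomial.C (v j)
  let θ : RPoly d := MvPolynomial.aeval g q
  have hθ : bary K i ∣ q - θ := by
    rw [← Ideal.mem_span_singleton, ← Ideal.Quotient.eq]
    have hhom : (Ideal.Quotient.mk (Ideal.span {bary K i})) =
        (Ideal.Quotient.mk (Ideal.span {bary K i})).comp
          (MvPolynomial.aeval g : RPoly d →ₐ[ℝ] RPoly d).toRingHom := by
      refine MvPolynomial.ringHom_ext (fun r => by simp) fun j => ?_
      have h0 : Ideal.Quotient.mk (Ideal.span {bary K i}) (bary K i) = 0 :=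
        Ideal.Quotient.eq_zero_iff_mem.2 (Ideal.mem_span_singleton_self _)
      simp [g, h0]
    exact congrArg (fun f => f q) hhom
  have hval : ∀ x : E d, val θ x = val q (x - val (bary K i) x • v) := by
    intro x
    have hhom : (MvPolynomial.eval fun j => x j).comp
        (MvPolynomial.aeval g : RPoly d →ₐ[ℝ] RPoly d).toRingHom =
          MvPolynomial.eval fun j => (x - val (bary K i) x • v) j :=
      MvPolynomial.ringHom_ext (fun r => by simp) fun j => by simp [g, val]
    exact congrArg (fun f => f q) hhom
  have hθ0 : θ = 0 := by
    refine eq_zero_of_val_eq_zero K fun x hx => ?_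
    rw [hval]
    let c : ℝ := val (bary K i) x
    -- The projection moves the weight of vertex `i` to vertex `m`. An interior point therefore
    -- lands in the relative interior of the face, where `q` vanishes.
    have hw : ∀ l, val (bary K l) (x - c • v) =
        val (bary K l) x - c * ((if i = l then 1 else 0) - (if m = l then 1 else 0)) := by
      intro l
      have e1 : x - c • v = ∑ n, (val (bary K n) x - c * ((if i = n then 1 else 0) -
          (if m = n then 1 else 0))) • K.points n := by
        simp only [sub_smul, Finset.sum_sub_distrib, sum_val_bary_smul, mul_smul,
          ← Finset.smul_sum]
        simp [v]
      rw [e1, val_bary_sum]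
      simp [Finset.sum_sub_distrib, sum_val_bary, ← Finset.mul_sum]
    refine h _ ?_ fun l hl => ?_
    · rw [hw i]
      simp [hm, c]
    · rw [hw l]
      have h1 := hx l
      have h2 := hx i
      simp only [hl.symm, if_false, zero_sub, mul_neg, sub_neg_eq_add, mul_ite, mul_one, mul_zero]
      split_ifs
      · exact add_pos h1 h2
      · linarith
  rwa [hθ0, sub_zero] at hθ

theorem bary_dvd_of_innerF_eq_zero {i : Fin (d + 1)} {q : RPoly d} (h : innerF K i q q = 0) :
    bary K i ∣ q :=
  bary_dvd K fun _ => val_eq_zero_of_innerF_eq_zero K h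

end Geometry

/-! ### Integration by parts for fields with vanishing flux -/

theorem hasLineDerivAt_val {d : ℕ} (p : RPoly d) (x : E d) (j : Fin d) :
    HasLineDerivAt ℝ (val p) (val (MvPolynomial.pderiv j p) x) x (EuclideanSpace.single j 1) := by
  induction p using MvPolynomial.induction_on with
  | C a =>
    simpa [HasLineDerivAt, val] using hasDerivAt_const (0 : ℝ) a
  | add p q hp hq =>
    simpa only [HasLineDerivAt, val_add, map_add] using HasDerivAt.fun_add hp hq
  | mul_X p l hp =>
    have hX : HasDerivAt (fun t : ℝ => val (MvPolynomial.X l : RPoly d)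
        (x + t • EuclideanSpace.single j 1)) (if l = j then 1 else 0) 0 := by
      simp only [val, MvPolynomial.eval_X, PiLp.add_apply, PiLp.smul_apply,
        PiLp.single_apply, smul_eq_mul]
      simpa using ((hasDerivAt_id (0 : ℝ)).mul_const (if l = j then (1 : ℝ) else 0)).const_add (x l)
    have h := HasDerivAt.mul hp hX
    simp only [HasLineDerivAt, val_mul, Derivation.leibniz, MvPolynomial.pderiv_X, smul_eq_mul]
    convert! h using 1
    simp only [val, map_add, map_mul, MvPolynomial.eval_X, zero_smul, add_zero, Pi.single_apply]
    split_ifs <;> simp <;> ring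

theorem contDiff_val {d : ℕ} (p : RPoly d) : ContDiff ℝ 1 (val p) := by
  induction p using MvPolynomial.induction_on with
  | C a =>
    have : val (MvPolynomial.C a : RPoly d) = fun _ => a := funext fun x => val_C a x
    rw [this]
    exact contDiff_const
  | add p q hp hq =>
    rw [show val (p + q) = fun x => val p x + val q x from funext (val_add p q)]
    exact hp.add hq
  | mul_X p l hp =>
    rw [show val (p * MvPolynomial.X l) = fun x => val p x * x l from
      funext fun x => by rw [val_mul]; simp [val]]
    exact hp.mul (by fun_prop)

theorem convex_closedInterior {d : ℕ} (K : Element d) : Convex ℝ K.closedInterior := by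
  rw [← Affine.Simplex.convexHull_eq_closedInterior]
  exact convex_convexHull ℝ _

theorem integrableOn_val {d : ℕ} (K : Element d) (p : RPoly d) :
    IntegrableOn (val p) K.closedInterior :=
  (continuous_val p).continuousOn.integrableOn_compact K.isCompact_closedInterior

/-- The integral of a derivative of a polynomial vanishing on the boundary. -/
theorem integral_pderiv_eq_zero {d : ℕ} (K : Element d) {p : RPoly d} (j : Fin d)
    (hp : ∀ x ∈ frontier K.closedInterior, val p x = 0) :
    ∫ x in K.closedInterior, val (MvPolynomial.pderiv j p) x = 0 := by
  let S := K.closedInterior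
  have hSc : IsCompact S := K.isCompact_closedInterior
  have hScl : IsClosed S := hSc.isClosed
  obtain ⟨C, hC⟩ : ∃ C : NNReal, LipschitzOnWith C (val p) S := by
    obtain ⟨L, hL⟩ := hSc.exists_bound_of_continuousOn
      ((contDiff_val p).continuous_fderiv one_ne_zero).continuousOn
    refine ⟨⟨max L 0, le_max_right _ _⟩, (convex_closedInterior K).lipschitzOnWith_of_nnnorm_fderiv_le
      (fun x _ => (contDiff_val p).differentiable one_ne_zero x) fun x hx => ?_⟩
    exact (hL x hx).trans (le_max_left _ _)
  have hlip := lipschitzWith_indicator hScl hC hp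
  let v : E d := EuclideanSpace.single j 1
  have hsupp : HasCompactSupport (S.indicator (val p)) :=
    HasCompactSupport.intro hSc fun x hx => Set.indicator_of_notMem hx _
  -- Integration by parts for Lipschitz functions against the constant `1`: the extension by zero is
  -- Lipschitz with compact support, so the integral of its line derivative is zero.
  have h := LipschitzWith.integral_lineDeriv_mul_eq (μ := (volume : Measure (E d)))
    (LipschitzWith.const (1 : ℝ)) hlip hsupp v
  have h0 : ∀ x : E d, lineDeriv ℝ (fun _ : E d => (1 : ℝ)) x v = 0 := fun x => by
    simp [lineDeriv]
  simp only [h0, zero_mul, integral_zero, mul_one] at h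
  rw [← integral_indicator hScl.measurableSet]
  have hae : (fun x => lineDeriv ℝ (S.indicator (val p)) x (-v)) =ᵐ[volume]
      fun x => -S.indicator (val (MvPolynomial.pderiv j p)) x := by
    -- The frontier of a convex set is null; off it the extension agrees locally with `p` or with
    -- zero.
    have hfr : ∀ᵐ x : E d, x ∉ frontier S :=
      measure_eq_zero_iff_ae_notMem.1 ((convex_closedInterior K).addHaar_frontier volume)
    filter_upwards [hfr] with x hx
    rw [lineDeriv_neg]
    congr 1
    by_cases hxS : x ∈ S
    · have hint : x ∈ interior S := by
        by_contra hi
        exact hx (by rw [hScl.frontier_eq]; exact ⟨hxS, hi⟩)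
      rw [Set.indicator_of_mem hxS]
      refine HasLineDerivAt.lineDeriv ((hasLineDerivAt_val p x j).congr_of_eventuallyEq ?_)
      filter_upwards [mem_interior_iff_mem_nhds.1 hint] with y hy
      exact Set.indicator_of_mem hy _
    · rw [Set.indicator_of_notMem hxS]
      have : HasLineDerivAt ℝ (fun _ : E d => (0 : ℝ)) 0 x v := by
        simpa [HasLineDerivAt] using hasDerivAt_const (0 : ℝ) (0 : ℝ)
      refine HasLineDerivAt.lineDeriv (this.congr_of_eventuallyEq ?_)
      filter_upwards [hScl.isOpen_compl.mem_nhds hxS] with y hy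
      exact Set.indicator_of_notMem hy _
  rw [integral_congr_ae hae, integral_neg] at h
  exact neg_eq_zero.1 h.symm

/-- Bernoulli's inequality: `(n + 1) b ≤ 1 + n b ≤ (1 + b)^n`, and `(1 - b²)^n ≤ 1`. This uniform
bound dominates the gradient terms of the cut-offs in `integral_divP_eq_zero`. -/
theorem succ_mul_mul_one_sub_pow_le_one {b : ℝ} (h0 : 0 ≤ b) (h1 : b ≤ 1) (n : ℕ) :
    (n + 1) * (1 - b) ^ n * b ≤ 1 := by
  have h2 : 1 + (n : ℝ) * b ≤ (1 + b) ^ n := one_add_mul_le_pow (by linarith) n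
  have h3 : 0 ≤ (1 - b) ^ n := pow_nonneg (by linarith) n
  calc (n + 1) * (1 - b) ^ n * b = (1 - b) ^ n * (b + n * b) := by ring
    _ ≤ (1 - b) ^ n * (1 + b) ^ n := mul_le_mul_of_nonneg_left (by linarith) h3
    _ = (1 - b ^ 2) ^ n := by rw [← mul_pow]; ring
    _ ≤ 1 := pow_le_one₀ (by nlinarith) (by nlinarith)

/-- The divergence theorem for polynomial fields whose normal components vanish on all faces. -/
theorem integral_divP_eq_zero {d : ℕ} [NeZero d] (K : Element d) {F : VPoly d}
    (hF : ∀ i, bary K i ∣ ∑ j, F j * MvPolynomial.pderiv j (bary K i)) :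
    ∫ x in K.closedInterior, val (divP F) x = 0 := by
  -- By the Leibniz rule, the vanishing flux through each face makes `F · ∇β` divisible by the whole
  -- product `β`.
  let β : RPoly d := ∏ i, bary K i
  obtain ⟨G, hG⟩ : β ∣ ∑ j, F j * MvPolynomial.pderiv j β := by
    suffices ∀ s : Finset (Fin (d + 1)), ∏ i ∈ s, bary K i ∣
        ∑ j, F j * MvPolynomial.pderiv j (∏ i ∈ s, bary K i) from this Finset.univ
    intro s
    induction s using Finset.induction_on with
    | empty => simp
    | insert i s hi ih =>
      rw [Finset.prod_insert hi]
      have : ∑ j, F j * MvPolynomial.pderiv j (bary K i * ∏ l ∈ s, bary K l) =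
          bary K i * ∑ j, F j * MvPolynomial.pderiv j (∏ l ∈ s, bary K l) +
            (∑ j, F j * MvPolynomial.pderiv j (bary K i)) * ∏ l ∈ s, bary K l := by
        rw [Finset.mul_sum, Finset.sum_mul, ← Finset.sum_add_distrib]
        refine Finset.sum_congr rfl fun j _ => ?_
        rw [Derivation.leibniz, smul_eq_mul, smul_eq_mul]
        ring
      rw [this]
      exact dvd_add (mul_dvd_mul_left _ ih) (mul_dvd_mul_right (hF i) _)
  -- A polynomial cut-off: `η n` vanishes where `β = 0`, in particular on the boundary, and tends to
  -- `1` where `0 < β ≤ 1`. Since `F · ∇β = β G`, its gradient contributes `(n + 1) (1 - β)^n β G`,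
  -- which is bounded by `|G|` and tends to zero almost everywhere in the simplex.
  let η : ℕ → RPoly d := fun n => 1 - (1 - β) ^ (n + 1)
  have hval : ∀ n x, val (divP fun j => η n * F j) x =
      (1 - (1 - val β x) ^ (n + 1)) * val (divP F) x +
        (n + 1) * (1 - val β x) ^ n * val β x * val G x := by
    intro n x
    have hpoly : (divP fun j => η n * F j) =
        η n * divP F + (n + 1) * (1 - β) ^ n * (β * G) := by
      rw [← hG, divP, divP, Finset.mul_sum, Finset.mul_sum, ← Finset.sum_add_distrib]
      refine Finset.sum_congr rfl fun j _ => ?_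
      simp only [η, Derivation.leibniz, Derivation.leibniz_pow, map_sub, smul_eq_mul,
        Derivation.map_one_eq_zero, nsmul_eq_mul, Nat.add_sub_cancel]
      push_cast
      ring
    rw [hpoly]
    simp only [val, η, map_add, map_mul, map_sub, map_pow, map_one, map_natCast]
    ring
  have hzero : ∀ n, ∫ x in K.closedInterior, val (divP fun j => η n * F j) x = 0 := by
    intro n
    simp only [divP, val_sum]
    rw [integral_finsetSum _ fun j _ => integrableOn_val K _]
    refine Finset.sum_eq_zero fun j _ => integral_pderiv_eq_zero K j fun x hx => ?_
    obtain ⟨i, hi⟩ := exists_val_bary_eq_zero_of_mem_frontier K hx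
    have hβ : val β x = 0 := by
      simp only [val, β, map_prod]
      exact Finset.prod_eq_zero (Finset.mem_univ i) hi
    have : val (η n) x = 0 := by
      have : val (η n) x = 1 - (1 - val β x) ^ (n + 1) := by simp [val, η]
      rw [this, hβ]
      simp
    rw [val_mul, this, zero_mul]
  have hβ : ∀ᵐ x ∂(volume.restrict K.closedInterior), 0 < val β x ∧ val β x ≤ 1 := by
    filter_upwards [ae_restrict_val_bary_pos K] with x hx
    have hβx : val β x = ∏ i, val (bary K i) x := by simp [val, β]
    rw [hβx]
    refine ⟨Finset.prod_pos fun i _ => hx i, Finset.prod_le_one (fun i _ => (hx i).le) fun i _ => ?_⟩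
    rw [← sum_val_bary K x]
    exact Finset.single_le_sum (fun l _ => (hx l).le) (Finset.mem_univ i)
  have hlim := tendsto_integral_of_dominated_convergence
    (μ := volume.restrict K.closedInterior)
    (F := fun n x => val (divP fun j => η n * F j) x) (f := val (divP F))
    (fun x => |val (divP F) x| + |val G x|)
    (fun n => (continuous_val _).aestronglyMeasurable)
    ((integrableOn_val K _).abs.add (integrableOn_val K _).abs)
    (fun n => by
      filter_upwards [hβ] with x hx
      have e0 : 0 ≤ 1 - val β x := by linarith [hx.2]
      have e1 : 0 ≤ (1 - val β x) ^ (n + 1) := pow_nonneg e0 _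
      have e2 : (1 - val β x) ^ (n + 1) ≤ 1 := pow_le_one₀ e0 (by linarith [hx.1])
      have e3 := succ_mul_mul_one_sub_pow_le_one hx.1.le hx.2 n
      have e4 : 0 ≤ (n + 1) * (1 - val β x) ^ n * val β x :=
        mul_nonneg (mul_nonneg (by positivity) (pow_nonneg e0 _)) hx.1.le
      rw [hval, Real.norm_eq_abs]
      refine (abs_add_le _ _).trans (add_le_add ?_ ?_)
      · rw [abs_mul, abs_of_nonneg (by linarith)]
        exact mul_le_of_le_one_left (abs_nonneg _) (by linarith)
      · rw [abs_mul, abs_of_nonneg e4]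
        exact mul_le_of_le_one_left (abs_nonneg _) e3)
    (by
      filter_upwards [hβ] with x hx
      have e0 : |1 - val β x| < 1 := by
        rw [abs_lt]
        constructor <;> linarith [hx.1, hx.2]
      have t1 := tendsto_pow_atTop_nhds_zero_of_abs_lt_one e0
      have t2 := tendsto_self_mul_const_pow_of_abs_lt_one e0
      have t3 : Filter.Tendsto (fun n : ℕ => (1 - (1 - val β x) ^ n * (1 - val β x)) *
          val (divP F) x + (n * (1 - val β x) ^ n + (1 - val β x) ^ n) * val β x * val G x)
          Filter.atTop (nhds ((1 - 0 * (1 - val β x)) * val (divP F) x +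
            (0 + 0) * val β x * val G x)) :=
        ((tendsto_const_nhds.sub (t1.mul_const _)).mul_const _).add
          (((t2.add t1).mul_const _).mul_const _)
      convert! t3 using 2
      · rw [hval, pow_succ]
        ring
      · ring)
  simp only [hzero] at hlim
  exact (tendsto_nhds_unique hlim tendsto_const_nhds)

/-! ### Degrees of derivatives and antiderivatives -/

theorem monomial_mem_polyLE {d m : ℕ} {s : Fin d →₀ ℕ} (a : ℝ) (hs : s.degree ≤ m) :
    MvPolynomial.monomial s a ∈ PolyLE d m := by
  rw [MvPolynomial.mem_restrictTotalDegree]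
  exact (MvPolynomial.totalDegree_monomial_le s a).trans hs

theorem degree_le_of_mem_support {d m : ℕ} {p : RPoly d} (hp : p ∈ PolyLE d m) {s : Fin d →₀ ℕ}
    (hs : s ∈ p.support) : s.degree ≤ m :=
  (MvPolynomial.le_totalDegree hs).trans ((MvPolynomial.mem_restrictTotalDegree _ _ _).1 hp)

theorem pderiv_mem_polyLE {d m : ℕ} {p : RPoly d} (hp : p ∈ PolyLE d m) (j : Fin d) :
    MvPolynomial.pderiv j p ∈ PolyLE d (m - 1) := by
  rw [p.as_sum, map_sum]
  refine Submodule.sum_mem _ fun s hs => ?_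
  rw [MvPolynomial.pderiv_monomial]
  rcases Nat.eq_zero_or_pos (s j) with h | h
  · simp [h]
  · refine monomial_mem_polyLE _ ?_
    have h1 : s - Finsupp.single j 1 + Finsupp.single j 1 = s :=
      tsub_add_cancel_of_le (Finsupp.single_le_iff.2 h)
    have h2 := congrArg Finsupp.degree h1
    rw [map_add, Finsupp.degree_single] at h2
    have := degree_le_of_mem_support hp hs
    omega

theorem exists_pderiv_eq {d m : ℕ} {q : RPoly d} (hq : q ∈ PolyLE d m) (j : Fin d) :
    ∃ p ∈ PolyLE d (m + 1), MvPolynomial.pderiv j p = q := by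
  refine ⟨∑ s ∈ q.support, MvPolynomial.monomial (s + Finsupp.single j 1)
    (q.coeff s / (s j + 1)), Submodule.sum_mem _ fun s hs => monomial_mem_polyLE _ ?_, ?_⟩
  · rw [map_add, Finsupp.degree_single]
    have := degree_le_of_mem_support hq hs
    omega
  · conv_rhs => rw [q.as_sum]
    rw [map_sum]
    refine Finset.sum_congr rfl fun s _ => ?_
    rw [MvPolynomial.pderiv_monomial, add_tsub_cancel_right]
    congr 1
    have : (s j : ℝ) + 1 ≠ 0 := by positivity
    simp only [Finsupp.add_apply, Finsupp.single_eq_same]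
    push_cast
    field_simp

/-! ### Definiteness of the discrete semi-norms -/

theorem innerK_eq_integral {d : ℕ} (K : Element d) (p q : RPoly d) :
    innerK K p q = ∫ x in K.closedInterior, val (p * q) x := by
  simp only [innerK, val_mul]

theorem innerK_zero_left {d : ℕ} (K : Element d) (p : RPoly d) : innerK K 0 p = 0 := by
  simp [innerK, val_zero]

theorem innerF_zero_left {d : ℕ} [NeZero d] (K : Element d) (i : Fin (d + 1)) (p : RPoly d) :
    innerF K i 0 p = 0 := by
  simp [innerF, val_zero]

theorem innerK_self_nonneg {d : ℕ} (K : Element d) (p : RPoly d) : 0 ≤ innerK K p p :=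
  integral_nonneg fun _ => mul_self_nonneg _

theorem innerF_self_nonneg {d : ℕ} [NeZero d] (K : Element d) (i : Fin (d + 1)) (p : RPoly d) :
    0 ≤ innerF K i p p :=
  integral_nonneg fun _ => mul_self_nonneg _

theorem innerKv_self_nonneg {d n : ℕ} (K : Element d) (v : Fin n → RPoly d) :
    0 ≤ innerKv K v v :=
  Finset.sum_nonneg fun _ _ => innerK_self_nonneg K _

theorem innerKv_self_eq_zero {d n : ℕ} (K : Element d) {v : Fin n → RPoly d}
    (h : innerKv K v v = 0) : v = 0 :=
  funext fun l => innerK_self_eq_zero K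
    ((Finset.sum_eq_zero_iff_of_nonneg fun _ _ => innerK_self_nonneg K _).1 h l (Finset.mem_univ l))

theorem innerBv_self_nonneg {d n : ℕ} [NeZero d] (K : Element d)
    (v : Fin (d + 1) → Fin n → RPoly d) : 0 ≤ innerBv K v v :=
  Finset.sum_nonneg fun _ _ => Finset.sum_nonneg fun _ _ => innerF_self_nonneg K _ _

theorem bary_dvd_of_innerBv_self_eq_zero {d n : ℕ} [NeZero d] (K : Element d)
    {v : Fin (d + 1) → Fin n → RPoly d} (h : innerBv K v v = 0) (i : Fin (d + 1)) (l : Fin n) :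
    bary K i ∣ v i l := by
  have h1 := (Finset.sum_eq_zero_iff_of_nonneg fun i _ =>
    Finset.sum_nonneg fun l _ => innerF_self_nonneg K i (v i l)).1 h i (Finset.mem_univ i)
  have h2 := (Finset.sum_eq_zero_iff_of_nonneg fun l _ => innerF_self_nonneg K i (v i l)).1 h1 l
    (Finset.mem_univ l)
  exact bary_dvd_of_innerF_eq_zero K h2

theorem tau_pos {d : ℕ} [NeZero d] (K : Element d) : 0 < tau K := by
  rw [tau, inv_pos, diamK]
  obtain ⟨m, hm⟩ : ∃ m : Fin (d + 1), m ≠ 0 := exists_ne 0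
  refine (dist_pos.2 fun h => hm (K.independent.injective h)).trans_le
    (Metric.dist_le_diam_of_mem K.isCompact_closedInterior.isBounded
      (K.point_mem_closedInterior m) (K.point_mem_closedInterior 0))

theorem eq_C_of_pderiv_eq_zero {d : ℕ} {p : RPoly d} (h : ∀ j, MvPolynomial.pderiv j p = 0) :
    ∃ c, p = MvPolynomial.C c := by
  have hv : ∀ x, val p x = val p 0 := by
    intro x
    refine is_const_of_fderiv_eq_zero ((contDiff_val p).differentiable one_ne_zero) (fun y => ?_) x 0
    refine ContinuousLinearMap.coe_injective
      ((EuclideanSpace.basisFun (Fin d) ℝ).toBasis.ext fun j => ?_)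
    have h1 := ((contDiff_val p).differentiable one_ne_zero y).hasFDerivAt.hasLineDerivAt
      (EuclideanSpace.single j 1)
    have h2 := hasLineDerivAt_val p y j
    rw [h j, val_zero] at h2
    simpa using HasDerivAt.unique h1 h2
  refine ⟨val p 0, MvPolynomial.funext fun x => ?_⟩
  have := hv (WithLp.toLp 2 x)
  simpa [val] using this

/-- A vertex of the face opposite to `i` is a zero of the barycentric coordinate, and the constant
is evaluated there. -/
theorem eq_zero_of_bary_dvd_C {d : ℕ} [NeZero d] (K : Element d) (i : Fin (d + 1)) {c : ℝ}
    (h : bary K i ∣ MvPolynomial.C c) : c = 0 := by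
  obtain ⟨q, hq⟩ := h
  obtain ⟨m, hm⟩ : ∃ m : Fin (d + 1), m ≠ i := exists_ne i
  have := congrArg (fun p => val p (K.points m)) hq
  simpa [val_C, val_mul, val_bary_point, hm] using this

theorem integral_sum_sq_eq_zero {d : ℕ} (K : Element d) {ι : Type*} {s : Finset ι}
    {q : ι → RPoly d} (h : ∫ x in K.closedInterior, val (∑ j ∈ s, q j * q j) x = 0) :
    ∀ j ∈ s, q j = 0 := by
  simp only [val_sum] at h
  rw [integral_finsetSum _ fun j _ => integrableOn_val K _] at h
  simp only [← innerK_eq_integral] at h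
  exact fun j hj => innerK_self_eq_zero K
    ((Finset.sum_eq_zero_iff_of_nonneg fun _ _ => innerK_self_nonneg K _).1 h j hj)

/-! ### Defining identities of the weak operators -/

section WeakOperators

variable {d : ℕ} [NeZero d] (K : Element d) (m : ℕ)

theorem weakGrad_mem (vo : RPoly d) (vb : Fin (d + 1) → RPoly d) (l : Fin d) :
    weakGrad K m vo vb l ∈ PolyLE d m :=
  (Classical.choose_spec (exists_riesz_vec K m (gradFunctional K vo vb))).1 l

theorem weakGrad_spec (vo : RPoly d) (vb : Fin (d + 1) → RPoly d) {φ : VPoly d}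
    (hφ : ∀ l, φ l ∈ PolyLE d m) :
    innerKv K (weakGrad K m vo vb) φ = gradFunctional K vo vb φ :=
  (Classical.choose_spec (exists_riesz_vec K m (gradFunctional K vo vb))).2 φ hφ

theorem weakDiv_mem (wo : VPoly d) (wb : Fin (d + 1) → VPoly d) :
    weakDiv K m wo wb ∈ PolyLE d m :=
  (Classical.choose_spec (exists_riesz K m (divFunctional K wo wb))).1

theorem weakDiv_spec (wo : VPoly d) (wb : Fin (d + 1) → VPoly d) {φ : RPoly d}
    (hφ : φ ∈ PolyLE d m) : innerK K (weakDiv K m wo wb) φ = divFunctional K wo wb φ :=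
  (Classical.choose_spec (exists_riesz K m (divFunctional K wo wb))).2 φ hφ

theorem weakCurl_mem (wo : VPoly d) (wb : Fin (d + 1) → VPoly d) (l : Fin (2 * d - 3)) :
    weakCurl K m wo wb l ∈ PolyLE d m :=
  (Classical.choose_spec (exists_riesz_vec K m (curlFunctional K wo wb))).1 l

theorem weakCurl_spec (wo : VPoly d) (wb : Fin (d + 1) → VPoly d) {φ : Fin (2 * d - 3) → RPoly d}
    (hφ : ∀ l, φ l ∈ PolyLE d m) :
    innerKv K (weakCurl K m wo wb) φ = curlFunctional K wo wb φ :=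
  (Classical.choose_spec (exists_riesz_vec K m (curlFunctional K wo wb))).2 φ hφ

theorem gradFunctional_zero_right (vo : RPoly d) (φ : VPoly d) :
    gradFunctional K vo 0 φ = -innerK K vo (divP φ) := by
  simp [gradFunctional, innerF_zero_left]

theorem cross_zero_left {R : Type*} [CommRing R] (d : ℕ) (v : Fin d → R) : cross d 0 v = 0 := by
  rcases d with _ | _ | _ | _ | d
  · rfl
  · rfl
  · funext l
    simp [cross]
  · funext l
    fin_cases l <;> simp [cross]
  · rfl

theorem curlFunctional_zero_right (wo : VPoly d) (φ : Fin (2 * d - 3) → RPoly d) :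
    curlFunctional K wo 0 φ = ∑ j, innerK K (wo j) (curlP d φ j) := by
  simp [curlFunctional, cross_zero_left, innerF_zero_left]

end WeakOperators

theorem mem_VPolyLE {d m : ℕ} {v : VPoly d} : v ∈ VPolyLE d m ↔ ∀ l, v l ∈ PolyLE d m := by
  simp [VPolyLE, Submodule.mem_pi]

/-- The classical gradient `∇p` is an admissible test field, so `∫ p Δp = 0`. As `p ∇p` has no flux,
this gives `∫ |∇p|² = 0`; a constant that vanishes on a face is zero. -/
theorem eq_zero_of_weakGrad_eq_zero {d : ℕ} [NeZero d] (K : Element d) {k : ℕ} {p : RPoly d}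
    (hp : p ∈ PolyLE d k) (hg : weakGrad K (k - 1) p 0 = 0) (hb : ∀ i, bary K i ∣ p) : p = 0 := by
  let φ : VPoly d := fun j => MvPolynomial.pderiv j p
  have h1 := weakGrad_spec K (k - 1) p 0 (φ := φ) fun l => pderiv_mem_polyLE hp l
  rw [hg, gradFunctional_zero_right, innerK_eq_integral] at h1
  have h1' : ∫ x in K.closedInterior, val (p * divP φ) x = 0 := by
    simpa [innerKv, innerK_zero_left] using h1
  have h2 := integral_divP_eq_zero K (F := fun j => p * φ j) fun i => by
    refine Finset.dvd_sum fun j _ => ?_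
    exact Dvd.dvd.mul_right (Dvd.dvd.mul_right (hb i) _) _
  have h3 : (divP fun j => p * φ j) = p * divP φ + ∑ j, φ j * φ j := by
    rw [divP, divP, Finset.mul_sum, ← Finset.sum_add_distrib]
    exact Finset.sum_congr rfl fun j _ => by
      rw [Derivation.leibniz, smul_eq_mul, smul_eq_mul]
  simp only [h3, val_add] at h2
  rw [integral_add (integrableOn_val K _) (integrableOn_val K _), h1', zero_add] at h2
  obtain ⟨c, hc⟩ := eq_C_of_pderiv_eq_zero fun j =>
    integral_sum_sq_eq_zero K h2 j (Finset.mem_univ j)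
  have := eq_zero_of_bary_dvd_C K 0 (hc ▸ hb 0)
  rw [hc, this, map_zero]

/-- The scalar product belonging to `|||·|||_D`. -/
def formD {d : ℕ} [NeZero d] (K : Element d) (k : ℕ) (u v : VPoly d) : ℝ :=
  innerGrad K (k - 1) u 0 v 0 + tau K * innerBv K (tr u) (tr v)

/-- The scalar product belonging to `|||·|||_C`. -/
def formC {d : ℕ} [NeZero d] (K : Element d) (k : ℕ) (B w : VPoly d) : ℝ :=
  innerKv K (weakCurl K (k - 1) B 0) (weakCurl K (k - 1) w 0) +
    tau K * innerBv K (crossN K (tr B)) (crossN K (tr w))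

theorem innerGrad_self_nonneg {d : ℕ} [NeZero d] (K : Element d) (m : ℕ) (v : VPoly d) :
    0 ≤ innerGrad K m v 0 v 0 :=
  Finset.sum_nonneg fun _ _ => innerKv_self_nonneg K _

theorem formD_self_nonneg {d : ℕ} [NeZero d] (K : Element d) (k : ℕ) (v : VPoly d) :
    0 ≤ formD K k v v :=
  add_nonneg (innerGrad_self_nonneg K _ _) (mul_nonneg (tau_pos K).le (innerBv_self_nonneg K _))

theorem formC_self_nonneg {d : ℕ} [NeZero d] (K : Element d) (k : ℕ) (v : VPoly d) :
    0 ≤ formC K k v v :=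
  add_nonneg (innerKv_self_nonneg K _) (mul_nonneg (tau_pos K).le (innerBv_self_nonneg K _))

theorem formD_self_eq_zero {d : ℕ} [NeZero d] (K : Element d) {k : ℕ} {v : VPoly d}
    (hv : v ∈ VPolyLE d k) (h : formD K k v v = 0) : v = 0 := by
  have h1 := innerGrad_self_nonneg K (k - 1) v
  have h2 := mul_nonneg (tau_pos K).le (innerBv_self_nonneg K (tr v))
  rw [formD] at h
  have hg : innerGrad K (k - 1) v 0 v 0 = 0 := by linarith
  have hb : tau K * innerBv K (tr v) (tr v) = 0 := by linarith
  have hb' := (mul_eq_zero.1 hb).resolve_left (tau_pos K).ne'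
  funext a
  refine eq_zero_of_weakGrad_eq_zero K (mem_VPolyLE.1 hv a) ?_ fun i =>
    bary_dvd_of_innerBv_self_eq_zero K hb' i a
  exact innerKv_self_eq_zero K ((Finset.sum_eq_zero_iff_of_nonneg fun a _ =>
    innerKv_self_nonneg K _).1 hg a (Finset.mem_univ a))

set_option maxHeartbeats 800000 in
/-- A field with vanishing weak curl and vanishing tangential traces has a symmetric gradient. -/
theorem pderiv_comm_of_weakCurl_eq_zero {d : ℕ} [NeZero d] (hd : d = 2 ∨ d = 3) (K : Element d)
    {k : ℕ} {w : VPoly d} (hw : w ∈ VPolyLE d k) (hc : weakCurl K (k - 1) w 0 = 0)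
    (hb : ∀ i l, bary K i ∣ cross d w (fun j => MvPolynomial.pderiv j (bary K i)) l) (a b : Fin d) :
    MvPolynomial.pderiv a (w b) = MvPolynomial.pderiv b (w a) := by
  rw [mem_VPolyLE] at hw
  have h1 : ∀ φ : Fin (2 * d - 3) → RPoly d, (∀ l, φ l ∈ PolyLE d (k - 1)) →
      ∫ x in K.closedInterior, val (∑ j, w j * curlP d φ j) x = 0 := by
    intro φ hφ
    have h := weakCurl_spec K (k - 1) w 0 hφ
    rw [hc, curlFunctional_zero_right] at h
    simp only [val_sum]
    rw [integral_finsetSum _ fun j _ => integrableOn_val K _]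
    simp only [← innerK_eq_integral]
    rw [← h]
    simp [innerKv, innerK_zero_left]
  -- The test function `φ` is the classical curl of `w`. In three dimensions `div (φ × w) = w · curl
  -- φ - φ · curl w`, and `(φ × w) · n = φ · (w × n)` vanishes on the faces; hence `∫ |curl w|² =
  -- 0`. The planar case uses the analogous rotated field.
  rcases hd with rfl | rfl
  · let φ : RPoly 2 := MvPolynomial.pderiv 0 (w 1) - MvPolynomial.pderiv 1 (w 0)
    have hφ : φ ∈ PolyLE 2 (k - 1) :=
      Submodule.sub_mem _ (pderiv_mem_polyLE (hw 1) 0) (pderiv_mem_polyLE (hw 0) 1)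
    have e1 := h1 (fun _ => φ) fun _ => hφ
    have e2 := integral_divP_eq_zero K (F := ![-(φ * w 1), φ * w 0]) fun i => by
      have := hb i 0
      simp only [cross] at this
      convert! Dvd.dvd.mul_left this φ using 1
      simp [Fin.sum_univ_two]
      ring
    have e3 : divP ![-(φ * w 1), φ * w 0] = ∑ j, w j * curlP 2 (fun _ => φ) j -
        ∑ j ∈ ({0} : Finset (Fin 1)), φ * φ := by
      simp only [divP, curlP, Fin.sum_univ_two, Matrix.cons_val_zero, Matrix.cons_val_one,
        Derivation.leibniz, map_neg, smul_eq_mul, Finset.sum_singleton]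
      simp only [φ]
      ring
    simp only [e3, val_sub] at e2
    rw [integral_sub (integrableOn_val K _) (integrableOn_val K _), e1, zero_sub, neg_eq_zero] at e2
    have e4 : φ = 0 := integral_sum_sq_eq_zero K (s := ({0} : Finset (Fin 1))) e2 0 (by simp)
    have e5 := sub_eq_zero.1 e4
    match a, b with
    | 0, 0 => rfl
    | 0, 1 => exact e5
    | 1, 0 => exact e5.symm
    | 1, 1 => rfl
  · let φ : Fin 3 → RPoly 3 := ![MvPolynomial.pderiv 1 (w 2) - MvPolynomial.pderiv 2 (w 1),
      MvPolynomial.pderiv 2 (w 0) - MvPolynomial.pderiv 0 (w 2),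
      MvPolynomial.pderiv 0 (w 1) - MvPolynomial.pderiv 1 (w 0)]
    have hφ : ∀ l, φ l ∈ PolyLE 3 (k - 1) := by
      intro l
      fin_cases l <;>
        exact Submodule.sub_mem _ (pderiv_mem_polyLE (hw _) _) (pderiv_mem_polyLE (hw _) _)
    have e1 := h1 φ hφ
    have e2 := integral_divP_eq_zero K
      (F := ![φ 1 * w 2 - φ 2 * w 1, φ 2 * w 0 - φ 0 * w 2, φ 0 * w 1 - φ 1 * w 0]) fun i => by
      have := dvd_add (dvd_add (Dvd.dvd.mul_left (hb i 0) (φ 0)) (Dvd.dvd.mul_left (hb i 1) (φ 1)))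
        (Dvd.dvd.mul_left (hb i 2) (φ 2))
      simp only [cross] at this
      convert! this using 1
      simp [Fin.sum_univ_three]
      ring
    have e3 : divP ![φ 1 * w 2 - φ 2 * w 1, φ 2 * w 0 - φ 0 * w 2, φ 0 * w 1 - φ 1 * w 0] =
        ∑ j, w j * curlP 3 φ j - ∑ j, φ j * φ j := by
      have p0 : φ 0 = MvPolynomial.pderiv 1 (w 2) - MvPolynomial.pderiv 2 (w 1) := rfl
      have p1 : φ 1 = MvPolynomial.pderiv 2 (w 0) - MvPolynomial.pderiv 0 (w 2) := rfl
      have p2 : φ 2 = MvPolynomial.pderiv 0 (w 1) - MvPolynomial.pderiv 1 (w 0) := rfl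
      have q0 : curlP 3 φ 0 = MvPolynomial.pderiv 1 (φ 2) - MvPolynomial.pderiv 2 (φ 1) := rfl
      have q1 : curlP 3 φ 1 = MvPolynomial.pderiv 2 (φ 0) - MvPolynomial.pderiv 0 (φ 2) := rfl
      have q2 : curlP 3 φ 2 = MvPolynomial.pderiv 0 (φ 1) - MvPolynomial.pderiv 1 (φ 0) := rfl
      have r : ∑ j, φ j * φ j = φ 0 * (MvPolynomial.pderiv 1 (w 2) - MvPolynomial.pderiv 2 (w 1)) +
          φ 1 * (MvPolynomial.pderiv 2 (w 0) - MvPolynomial.pderiv 0 (w 2)) +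
          φ 2 * (MvPolynomial.pderiv 0 (w 1) - MvPolynomial.pderiv 1 (w 0)) := by
        rw [← p0, ← p1, ← p2]
        exact Fin.sum_univ_three _
      rw [r, Fin.sum_univ_three, q0, q1, q2]
      simp only [divP, Fin.sum_univ_three, Matrix.cons_val_zero, Matrix.cons_val_one,
        Matrix.cons_val, Derivation.leibniz, map_sub, smul_eq_mul]
      ring
    simp only [e3, val_sub] at e2
    rw [integral_sub (integrableOn_val K _) (integrableOn_val K _), e1, zero_sub, neg_eq_zero] at e2
    have e4 := integral_sum_sq_eq_zero K e2
    have f0 : MvPolynomial.pderiv 1 (w 2) = MvPolynomial.pderiv 2 (w 1) :=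
      sub_eq_zero.1 (e4 0 (Finset.mem_univ _))
    have f1 : MvPolynomial.pderiv 2 (w 0) = MvPolynomial.pderiv 0 (w 2) :=
      sub_eq_zero.1 (e4 1 (Finset.mem_univ _))
    have f2 : MvPolynomial.pderiv 0 (w 1) = MvPolynomial.pderiv 1 (w 0) :=
      sub_eq_zero.1 (e4 2 (Finset.mem_univ _))
    match a, b with
    | 0, 0 => rfl
    | 0, 1 => exact f2
    | 0, 2 => exact f1.symm
    | 1, 0 => exact f2.symm
    | 1, 1 => rfl
    | 1, 2 => exact f0
    | 2, 0 => exact f1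
    | 2, 1 => exact f0.symm
    | 2, 2 => rfl

/-! ### Rigidity of divergence-free fields normal to the faces -/

theorem exists_normal_ne_zero {d : ℕ} [NeZero d] (K : Element d) (i : Fin (d + 1)) :
    ∃ j, normal K i j ≠ 0 := by
  by_contra! h
  obtain ⟨m, hm⟩ : ∃ m : Fin (d + 1), m ≠ i := exists_ne i
  have h0 : normal K i = 0 := by
    ext j
    exact h j
  have h1 := val_bary K i (K.points m)
  rw [val_bary_point, if_neg hm, h0] at h1
  simp at h1

theorem bary_ne_zero {d : ℕ} [NeZero d] (K : Element d) (i : Fin (d + 1)) : bary K i ≠ 0 := by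
  intro h
  have := val_bary_point K i i
  simp [h, val_zero] at this

/-- The commutator of two derivations is a derivation, and this one kills every variable. -/
theorem pderiv_pderiv_comm {d : ℕ} (i j : Fin d) (p : RPoly d) :
    MvPolynomial.pderiv i (MvPolynomial.pderiv j p) =
      MvPolynomial.pderiv j (MvPolynomial.pderiv i p) := by
  let D : Fin d → Derivation ℝ (RPoly d) (RPoly d) := fun l => MvPolynomial.pderiv l
  have h : ⁅D i, D j⁆ = 0 := MvPolynomial.derivation_ext fun l => by
    rw [Derivation.commutator_apply]
    simp [D, MvPolynomial.pderiv_X, Pi.single_apply, apply_ite]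
  have h2 := congrArg (fun F => F p) h
  simp only [Derivation.commutator_apply] at h2
  exact sub_eq_zero.1 h2

/-- If `w` is divergence free, has a symmetric gradient and is normal to a face, then the field
`(w · ∇) w` has no flux through this face. -/
theorem bary_dvd_flux {d : ℕ} [NeZero d] (K : Element d) {w : VPoly d} (hdiv : divP w = 0)
    {i : Fin (d + 1)} (hb : ∀ a b, bary K i ∣ w a * MvPolynomial.pderiv b (bary K i) -
      w b * MvPolynomial.pderiv a (bary K i)) :
    bary K i ∣ ∑ j, (∑ a, w a * MvPolynomial.pderiv a (w j)) * MvPolynomial.pderiv j (bary K i) := by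
  set n : Fin d → RPoly d := fun j => MvPolynomial.pderiv j (bary K i) with hn
  have hnC : ∀ a b, MvPolynomial.pderiv a (n b) = 0 := fun a b => by
    simp only [hn]
    rw [pderiv_bary, MvPolynomial.pderiv_C]
  -- The tangential components `w_a n_b - w_b n_a` are `λ z_ab`. Since `z` is antisymmetric, its
  -- contraction with `n_a n_b` vanishes.
  choose z hz using hb
  have hanti : ∀ a b, z a b = -z b a := by
    intro a b
    refine mul_left_cancel₀ (bary_ne_zero K i) ?_
    rw [mul_neg, ← hz, ← hz]
    ring
  have hS : ∑ a, ∑ b, n a * n b * z a b = 0 := by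
    rw [← self_eq_neg]
    conv_lhs => rw [Finset.sum_comm]
    rw [← Finset.sum_neg_distrib]
    refine Finset.sum_congr rfl fun a _ => ?_
    rw [← Finset.sum_neg_distrib]
    refine Finset.sum_congr rfl fun b _ => ?_
    rw [hanti b a]
    ring
  -- The normal derivative of the normal component vanishes on the face: differentiating `w_a n_b -
  -- w_b n_a = λ z_ab` and contracting with `n_b` produces `|n|² div w`, which is zero, minus the
  -- sum in question, equal to a multiple of `λ` plus the vanishing contraction of `z`.
  have hD : bary K i ∣ ∑ a, ∑ b, n a * n b * MvPolynomial.pderiv a (w b) := by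
    have h1 : ∑ a, ∑ b, n b * MvPolynomial.pderiv a (w a * n b - w b * n a) =
        ∑ a, ∑ b, n b * MvPolynomial.pderiv a (bary K i * z a b) :=
      Finset.sum_congr rfl fun a _ => Finset.sum_congr rfl fun b _ => by rw [hz a b]
    have h2 : ∑ a, ∑ b, n b * MvPolynomial.pderiv a (w a * n b - w b * n a) =
        (∑ b, n b * n b) * divP w - ∑ a, ∑ b, n a * n b * MvPolynomial.pderiv a (w b) := by
      rw [divP, Finset.mul_sum, ← Finset.sum_sub_distrib]
      refine Finset.sum_congr rfl fun a _ => ?_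
      rw [Finset.sum_mul, ← Finset.sum_sub_distrib]
      refine Finset.sum_congr rfl fun b _ => ?_
      simp only [map_sub, Derivation.leibniz, hnC, smul_eq_mul]
      ring
    have h3 : ∑ a, ∑ b, n b * MvPolynomial.pderiv a (bary K i * z a b) =
        bary K i * ∑ a, ∑ b, n b * MvPolynomial.pderiv a (z a b) +
          ∑ a, ∑ b, n a * n b * z a b := by
      rw [Finset.mul_sum, ← Finset.sum_add_distrib]
      refine Finset.sum_congr rfl fun a _ => ?_
      rw [Finset.mul_sum, ← Finset.sum_add_distrib]
      refine Finset.sum_congr rfl fun b _ => ?_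
      simp only [Derivation.leibniz, smul_eq_mul, hn]
      ring
    rw [h2, h3, hS, hdiv, mul_zero, zero_sub, add_zero] at h1
    rw [← dvd_neg, h1]
    exact dvd_mul_right _ _
  -- Modulo `λ` the field `w` is parallel to `n`, so `|n|² w_a` may be replaced by `(w · n) n_a`;
  -- the flux then contains the factor treated in `hD`. The nonzero constant `|n|²` is cancelled at
  -- the end.
  have hN : bary K i ∣ (∑ b, n b * n b) *
      ∑ j, (∑ a, w a * MvPolynomial.pderiv a (w j)) * n j := by
    have h4 : (∑ b, n b * n b) * ∑ j, (∑ a, w a * MvPolynomial.pderiv a (w j)) * n j =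
        ∑ b, ∑ j, ∑ a, (w a * n b - w b * n a) * (n b * MvPolynomial.pderiv a (w j) * n j) +
          (∑ b, w b * n b) * ∑ a, ∑ j, n a * n j * MvPolynomial.pderiv a (w j) := by
      rw [Finset.sum_comm (f := fun a j => n a * n j * MvPolynomial.pderiv a (w j)),
        Finset.sum_mul, Finset.sum_mul, ← Finset.sum_add_distrib]
      refine Finset.sum_congr rfl fun b _ => ?_
      rw [Finset.mul_sum, Finset.mul_sum, ← Finset.sum_add_distrib]
      refine Finset.sum_congr rfl fun j _ => ?_
      rw [Finset.sum_mul, Finset.mul_sum, Finset.mul_sum, ← Finset.sum_add_distrib]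
      refine Finset.sum_congr rfl fun a _ => ?_
      ring
    rw [h4]
    refine dvd_add (Finset.dvd_sum fun b _ => Finset.dvd_sum fun j _ => Finset.dvd_sum fun a _ => ?_)
      (Dvd.dvd.mul_left hD _)
    rw [hz a b]
    exact Dvd.dvd.mul_right (dvd_mul_right _ _) _
  have hNC : ∑ b, n b * n b = MvPolynomial.C (∑ b, (normal K i b / K.height i) ^ 2) := by
    rw [map_sum]
    refine Finset.sum_congr rfl fun b _ => ?_
    simp only [hn]
    rw [pderiv_bary, ← map_mul]
    congr 1
    ring
  have hpos : 0 < ∑ b, (normal K i b / K.height i) ^ 2 := by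
    obtain ⟨b, hb⟩ := exists_normal_ne_zero K i
    have hh := K.height_pos i
    exact Finset.sum_pos' (fun _ _ => sq_nonneg _) ⟨b, Finset.mem_univ b, by positivity⟩
  rw [hNC] at hN
  exact ((hpos.ne'.isUnit.map MvPolynomial.C).dvd_mul_left).1 hN

/-- A divergence free field with symmetric gradient and vanishing tangential traces is zero. -/
theorem eq_zero_of_divP_eq_zero_of_pderiv_comm {d : ℕ} [NeZero d] (hd : 2 ≤ d) (K : Element d)
    {w : VPoly d} (hdiv : divP w = 0)
    (hcurl : ∀ a b, MvPolynomial.pderiv a (w b) = MvPolynomial.pderiv b (w a))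
    (hb : ∀ i a b, bary K i ∣ w a * MvPolynomial.pderiv b (bary K i) -
      w b * MvPolynomial.pderiv a (bary K i)) : w = 0 := by
  have h1 := integral_divP_eq_zero K (F := fun j => ∑ a, w a * MvPolynomial.pderiv a (w j))
    fun i => bary_dvd_flux K hdiv (hb i)
  -- The Leibniz rule gives `∑ ∂_j w_a ∂_a w_j + w · ∇ div w`; symmetry of the gradient turns the
  -- first sum into `|∇w|²`, and the second term vanishes.
  have h2 : (divP fun j => ∑ a, w a * MvPolynomial.pderiv a (w j)) =
      ∑ q : Fin d × Fin d, MvPolynomial.pderiv q.1 (w q.2) * MvPolynomial.pderiv q.1 (w q.2) := by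
    have h3 : ∀ a, ∑ j, MvPolynomial.pderiv j (MvPolynomial.pderiv a (w j)) = 0 := by
      intro a
      have h4 : ∀ j, MvPolynomial.pderiv j (MvPolynomial.pderiv a (w j)) =
          MvPolynomial.pderiv a (MvPolynomial.pderiv j (w j)) := fun j =>
        pderiv_pderiv_comm j a (w j)
      simp only [h4, ← map_sum]
      rw [show ∑ j, MvPolynomial.pderiv j (w j) = 0 from hdiv, map_zero]
    have h5 : (divP fun j => ∑ a, w a * MvPolynomial.pderiv a (w j)) =
        ∑ j, ∑ a, MvPolynomial.pderiv j (w a) * MvPolynomial.pderiv j (w a) +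
          ∑ a, w a * ∑ j, MvPolynomial.pderiv j (MvPolynomial.pderiv a (w j)) := by
      simp only [Finset.mul_sum]
      rw [Finset.sum_comm (f := fun a j => w a * _), ← Finset.sum_add_distrib, divP]
      refine Finset.sum_congr rfl fun j _ => ?_
      rw [map_sum, ← Finset.sum_add_distrib]
      refine Finset.sum_congr rfl fun a _ => ?_
      rw [Derivation.leibniz, smul_eq_mul, smul_eq_mul, hcurl a j]
      ring
    rw [h5, Fintype.sum_prod_type]
    simp [h3]
  rw [h2] at h1
  have h6 := integral_sum_sq_eq_zero K h1
  choose c hc using fun a => eq_C_of_pderiv_eq_zero (p := w a) fun j =>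
    h6 (j, a) (Finset.mem_univ _)
  have h7 : ∀ i a b, c a * normal K i b = c b * normal K i a := by
    intro i a b
    have h8 := hb i a b
    rw [hc a, hc b, pderiv_bary, pderiv_bary, ← map_mul, ← map_mul, ← map_sub] at h8
    have h9 := eq_zero_of_bary_dvd_C K i h8
    have hh := (K.height_pos i).ne'
    field_simp at h9
    linarith
  funext a
  rw [hc a]
  by_contra hne
  have hca : c a ≠ 0 := fun h0 => hne (by rw [h0, map_zero]; rfl)
  obtain ⟨b, hba⟩ : ∃ b : Fin d, b ≠ a := by
    have : Nontrivial (Fin d) := Fin.nontrivial_iff_two_le.2 hd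
    exact exists_ne a
  -- The constant field `c` is parallel to every face normal, so a vector `t` orthogonal to `c` is
  -- orthogonal to all normals. No barycentric coordinate distinguishes `t` from the origin, hence
  -- `t = 0`, although its `b`-th coordinate is `-c a ≠ 0`.
  let t : E d := c b • EuclideanSpace.single a 1 - c a • EuclideanSpace.single b 1
  have ht : ∀ i, inner ℝ (normal K i) t = 0 := by
    intro i
    simp only [t, inner_sub_right, real_inner_smul_right, EuclideanSpace.inner_single_right]
    have := h7 i a b
    simp
    linarith
  have hval : ∀ l, val (bary K l) t = val (bary K l) 0 := by
    intro l
    rw [val_bary, val_bary, inner_sub_right _ t, inner_sub_right _ 0, ht, inner_zero_right]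
  have ht0 : t = 0 := by
    rw [← sum_val_bary_smul K t, ← sum_val_bary_smul K 0]
    simp only [hval]
  have := congrArg (fun y : E d => y b) ht0
  simp [t, hba] at this
  exact hca this

theorem cross_smul_right {R : Type*} [CommRing R] (d : ℕ) (c : R) (v w : Fin d → R) :
    cross d v (c • w) = c • cross d v w := by
  rcases d with _ | _ | _ | _ | d
  · exact (smul_zero c).symm
  · exact (smul_zero c).symm
  · funext l
    simp [cross]
    ring
  · funext l
    fin_cases l <;> simp [cross] <;> ring
  · exact (smul_zero c).symm

theorem dvd_of_dvd_cross {R : Type*} [CommRing R] {d : ℕ} (hd : d = 2 ∨ d = 3) {q : R}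
    {v w : Fin d → R} (h : ∀ l, q ∣ cross d v w l) (a b : Fin d) : q ∣ v a * w b - v b * w a := by
  rcases hd with rfl | rfl
  · have h0 : q ∣ v 0 * w 1 - v 1 * w 0 := h 0
    match a, b with
    | 0, 0 => simp
    | 0, 1 => exact h0
    | 1, 0 => exact (dvd_sub_comm).1 h0
    | 1, 1 => simp
  · have h0 : q ∣ v 1 * w 2 - v 2 * w 1 := h 0
    have h1 : q ∣ v 2 * w 0 - v 0 * w 2 := h 1
    have h2 : q ∣ v 0 * w 1 - v 1 * w 0 := h 2
    match a, b with
    | 0, 0 => simp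
    | 0, 1 => exact h2
    | 0, 2 => exact (dvd_sub_comm).1 h1
    | 1, 0 => exact (dvd_sub_comm).1 h2
    | 1, 1 => simp
    | 1, 2 => exact h0
    | 2, 0 => exact h1
    | 2, 1 => exact (dvd_sub_comm).1 h0
    | 2, 2 => simp

/-! ### The kernel spaces and definiteness of the curl norm -/

theorem bK_eq {d : ℕ} [NeZero d] (K : Element d) {k : ℕ} {v : VPoly d} (hv : v ∈ VPolyLE d k)
    (q : RPoly d) : bK K k v q = -innerK K q (divP v) := by
  rw [bK, weakGrad_spec K k q 0 (mem_VPolyLE.1 hv), gradFunctional_zero_right]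

theorem bTK_eq {d : ℕ} [NeZero d] (K : Element d) (k : ℕ) (Rm : ℝ) (w : VPoly d) (θ : RPoly d) :
    bTK K k Rm w θ = 1 / Rm * bK K k w θ := rfl

/-- The forms `b̃` and `b` differ by the factor `1 / Rm`, so both kernels coincide and one subspace
serves for the two fields. -/
theorem mem_Wbar_iff {d : ℕ} [NeZero d] (K : Element d) (k : ℕ) {Rm : ℝ} (hRm : 0 < Rm)
    (w : VPoly d) : w ∈ Wbar K k Rm ↔ w ∈ Vbar K k := by
  simp [Wbar, Vbar, bTK_eq, hRm.ne']

theorem divP_mem_polyLE {d k : ℕ} {v : VPoly d} (hv : v ∈ VPolyLE d k) :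
    divP v ∈ PolyLE d (k - 1) :=
  Submodule.sum_mem _ fun j _ => pderiv_mem_polyLE (mem_VPolyLE.1 hv j) j

/-- The divergence lies in `P_{k-1}` and is itself an admissible test function, so the discrete
constraint holds exactly. -/
theorem divP_eq_zero_of_mem_Vbar {d : ℕ} [NeZero d] (K : Element d) {k : ℕ} {v : VPoly d}
    (hv : v ∈ Vbar K k) : divP v = 0 := by
  have h := hv.2 _ (divP_mem_polyLE hv.1)
  rw [bK_eq K hv.1, neg_eq_zero] at h
  exact innerK_self_eq_zero K h

theorem formC_self_eq_zero {d : ℕ} [NeZero d] (hd : d = 2 ∨ d = 3) (K : Element d) {k : ℕ}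
    {w : VPoly d} (hw : w ∈ Vbar K k) (h : formC K k w w = 0) : w = 0 := by
  have h1 := innerKv_self_nonneg K (weakCurl K (k - 1) w 0)
  have h2 := mul_nonneg (tau_pos K).le (innerBv_self_nonneg K (crossN K (tr w)))
  rw [formC] at h
  have hc : weakCurl K (k - 1) w 0 = 0 := innerKv_self_eq_zero K (by linarith)
  have hb : tau K * innerBv K (crossN K (tr w)) (crossN K (tr w)) = 0 := by linarith
  have hb' := (mul_eq_zero.1 hb).resolve_left (tau_pos K).ne'
  have hdvd : ∀ i l, bary K i ∣ cross d w (fun j => MvPolynomial.pderiv j (bary K i)) l := by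
    intro i l
    have h3 := bary_dvd_of_innerBv_self_eq_zero K hb' i l
    have h4 : normalP K i = (MvPolynomial.C (-K.height i) : RPoly d) •
        fun j => MvPolynomial.pderiv j (bary K i) := funext fun j => normalP_eq K i j
    simp only [crossN, tr] at h3
    rw [h4, cross_smul_right, Pi.smul_apply, smul_eq_mul] at h3
    have hh := (neg_ne_zero.2 (K.height_pos i).ne').isUnit.map (MvPolynomial.C (σ := Fin d))
    exact (hh.dvd_mul_left).1 h3
  exact eq_zero_of_divP_eq_zero_of_pderiv_comm (by omega) K (divP_eq_zero_of_mem_Vbar K hw)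
    (pderiv_comm_of_weakCurl_eq_zero hd K hw.1 hc hdvd) fun i => dvd_of_dvd_cross hd (hdvd i)

/-! ### Linearity of the weak operators and of the local forms -/

theorem innerK_add_left {d : ℕ} (K : Element d) (p q r : RPoly d) :
    innerK K (p + q) r = innerK K p r + innerK K q r := by
  rw [innerK_comm, innerK_add_right, innerK_comm K r p, innerK_comm K r q]

theorem innerK_smul_left {d : ℕ} (K : Element d) (c : ℝ) (p r : RPoly d) :
    innerK K (c • p) r = c * innerK K p r := by
  rw [innerK_comm, innerK_smul_right, innerK_comm K r p]

section InnerKv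

variable {d n : ℕ} (K : Element d)

theorem innerKv_comm (v w : Fin n → RPoly d) : innerKv K v w = innerKv K w v :=
  Finset.sum_congr rfl fun _ _ => innerK_comm K _ _

theorem innerKv_add_right (u v w : Fin n → RPoly d) :
    innerKv K u (v + w) = innerKv K u v + innerKv K u w := by
  simp [innerKv, innerK_add_right, Finset.sum_add_distrib]

theorem innerKv_smul_right (c : ℝ) (u v : Fin n → RPoly d) :
    innerKv K u (c • v) = c * innerKv K u v := by
  simp [innerKv, innerK_smul_right, Finset.mul_sum]

theorem innerKv_add_left (u v w : Fin n → RPoly d) :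
    innerKv K (u + v) w = innerKv K u w + innerKv K v w := by
  simp [innerKv, innerK_add_left, Finset.sum_add_distrib]

theorem innerKv_smul_left (c : ℝ) (u v : Fin n → RPoly d) :
    innerKv K (c • u) v = c * innerKv K u v := by
  simp [innerKv, innerK_smul_left, Finset.mul_sum]

/-- Linearity of the weak operators, which are obtained by choice, is deduced from this uniqueness.
-/
theorem riesz_unique_vec (m : ℕ) {v w : Fin n → RPoly d} (hv : ∀ l, v l ∈ PolyLE d m)
    (hw : ∀ l, w l ∈ PolyLE d m)
    (h : ∀ φ : Fin n → RPoly d, (∀ l, φ l ∈ PolyLE d m) → innerKv K v φ = innerKv K w φ) :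
    v = w := by
  refine sub_eq_zero.1 (innerKv_self_eq_zero K ?_)
  have h1 := h (v - w) fun l => Submodule.sub_mem _ (hv l) (hw l)
  have h2 : innerKv K (v - w) (v - w) =
      innerKv K v (v - w) + (-1) * innerKv K w (v - w) := by
    rw [← innerKv_smul_left, ← innerKv_add_left]
    congr 1
    module
  rw [h2, h1]
  ring

variable [NeZero d]

theorem innerBv_comm (v w : Fin (d + 1) → Fin n → RPoly d) : innerBv K v w = innerBv K w v :=
  Finset.sum_congr rfl fun _ _ => Finset.sum_congr rfl fun _ _ => innerF_comm K _ _ _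

theorem innerBv_add_right (u v w : Fin (d + 1) → Fin n → RPoly d) :
    innerBv K u (v + w) = innerBv K u v + innerBv K u w := by
  simp [innerBv, innerF_add_right, Finset.sum_add_distrib]

theorem innerBv_smul_right (c : ℝ) (u v : Fin (d + 1) → Fin n → RPoly d) :
    innerBv K u (c • v) = c * innerBv K u v := by
  simp [innerBv, innerF_smul_right, Finset.mul_sum]

end InnerKv

section Weak

variable {d : ℕ} [NeZero d] (K : Element d) (m : ℕ)

theorem divFunctional_zero_right (wo : VPoly d) (φ : RPoly d) :
    divFunctional K wo 0 φ = -∑ j, innerK K (wo j) (MvPolynomial.pderiv j φ) := by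
  simp [divFunctional, dotP, innerF_zero_left]

theorem weakGrad_add (p q : RPoly d) :
    weakGrad K m (p + q) 0 = weakGrad K m p 0 + weakGrad K m q 0 := by
  refine riesz_unique_vec K m (weakGrad_mem K m _ _) (fun l => Submodule.add_mem _
    (weakGrad_mem K m _ _ l) (weakGrad_mem K m _ _ l)) fun φ hφ => ?_
  rw [innerKv_add_left, weakGrad_spec K m _ _ hφ, weakGrad_spec K m _ _ hφ,
    weakGrad_spec K m _ _ hφ]
  simp only [gradFunctional_zero_right, innerK_add_left]
  ring

theorem weakGrad_smul (c : ℝ) (p : RPoly d) :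
    weakGrad K m (c • p) 0 = c • weakGrad K m p 0 := by
  refine riesz_unique_vec K m (weakGrad_mem K m _ _) (fun l => Submodule.smul_mem _ c
    (weakGrad_mem K m _ _ l)) fun φ hφ => ?_
  rw [innerKv_smul_left, weakGrad_spec K m _ _ hφ, weakGrad_spec K m _ _ hφ]
  simp only [gradFunctional_zero_right, innerK_smul_left]
  ring

theorem weakDiv_add (v w : VPoly d) :
    weakDiv K m (v + w) 0 = weakDiv K m v 0 + weakDiv K m w 0 := by
  refine riesz_unique K m (weakDiv_mem K m _ _) (Submodule.add_mem _
    (weakDiv_mem K m _ _) (weakDiv_mem K m _ _)) fun φ hφ => ?_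
  rw [innerK_add_left, weakDiv_spec K m _ _ hφ, weakDiv_spec K m _ _ hφ,
    weakDiv_spec K m _ _ hφ]
  simp only [divFunctional_zero_right, innerK_add_left, Pi.add_apply, Finset.sum_add_distrib]
  ring

theorem weakDiv_smul (c : ℝ) (v : VPoly d) :
    weakDiv K m (c • v) 0 = c • weakDiv K m v 0 := by
  refine riesz_unique K m (weakDiv_mem K m _ _) (Submodule.smul_mem _ c
    (weakDiv_mem K m _ _)) fun φ hφ => ?_
  rw [innerK_smul_left, weakDiv_spec K m _ _ hφ, weakDiv_spec K m _ _ hφ]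
  simp only [divFunctional_zero_right, innerK_smul_left, Pi.smul_apply, ← Finset.mul_sum]
  ring

theorem weakCurl_add (v w : VPoly d) :
    weakCurl K m (v + w) 0 = weakCurl K m v 0 + weakCurl K m w 0 := by
  refine riesz_unique_vec K m (weakCurl_mem K m _ _) (fun l => Submodule.add_mem _
    (weakCurl_mem K m _ _ l) (weakCurl_mem K m _ _ l)) fun φ hφ => ?_
  rw [innerKv_add_left, weakCurl_spec K m _ _ hφ, weakCurl_spec K m _ _ hφ,
    weakCurl_spec K m _ _ hφ]
  simp only [curlFunctional_zero_right, innerK_add_left, Pi.add_apply, Finset.sum_add_distrib]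

theorem weakCurl_smul (c : ℝ) (v : VPoly d) :
    weakCurl K m (c • v) 0 = c • weakCurl K m v 0 := by
  refine riesz_unique_vec K m (weakCurl_mem K m _ _) (fun l => Submodule.smul_mem _ c
    (weakCurl_mem K m _ _ l)) fun φ hφ => ?_
  rw [innerKv_smul_left, weakCurl_spec K m _ _ hφ, weakCurl_spec K m _ _ hφ]
  simp only [curlFunctional_zero_right, innerK_smul_left, Pi.smul_apply, ← Finset.mul_sum]

theorem weakGradV_add (v w : VPoly d) :
    weakGradV K m (v + w) 0 = weakGradV K m v 0 + weakGradV K m w 0 :=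
  funext fun a => weakGrad_add K m (v a) (w a)

theorem weakGradV_smul (c : ℝ) (v : VPoly d) :
    weakGradV K m (c • v) 0 = c • weakGradV K m v 0 :=
  funext fun a => weakGrad_smul K m c (v a)

theorem innerGrad_comm (v w : VPoly d) (vb wb : Fin (d + 1) → VPoly d) :
    innerGrad K m v vb w wb = innerGrad K m w wb v vb :=
  Finset.sum_congr rfl fun _ _ => innerKv_comm K _ _

theorem innerGrad_add_right (u v w : VPoly d) (ub : Fin (d + 1) → VPoly d) :
    innerGrad K m u ub (v + w) 0 = innerGrad K m u ub v 0 + innerGrad K m u ub w 0 := by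
  simp [innerGrad, weakGradV_add, innerKv_add_right, Finset.sum_add_distrib]

theorem innerGrad_smul_right (c : ℝ) (u v : VPoly d) (ub : Fin (d + 1) → VPoly d) :
    innerGrad K m u ub (c • v) 0 = c * innerGrad K m u ub v 0 := by
  simp [innerGrad, weakGradV_smul, innerKv_smul_right, Finset.mul_sum]

end Weak

section Cross

variable {R : Type*} [CommRing R] (d : ℕ)

theorem cross_add_left (u v w : Fin d → R) : cross d (u + v) w = cross d u w + cross d v w := by
  rcases d with _ | _ | _ | _ | d
  · exact (add_zero 0).symm
  · exact (add_zero 0).symm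
  · funext l
    simp [cross]
    ring
  · funext l
    fin_cases l <;> simp [cross] <;> ring
  · exact (add_zero 0).symm

theorem cross_add_right (u v w : Fin d → R) : cross d u (v + w) = cross d u v + cross d u w := by
  rcases d with _ | _ | _ | _ | d
  · exact (add_zero 0).symm
  · exact (add_zero 0).symm
  · funext l
    simp [cross]
    ring
  · funext l
    fin_cases l <;> simp [cross] <;> ring
  · exact (add_zero 0).symm

theorem cross_smul_left (c : R) (v w : Fin d → R) : cross d (c • v) w = c • cross d v w := by
  rcases d with _ | _ | _ | _ | d
  · exact (smul_zero c).symm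
  · exact (smul_zero c).symm
  · funext l
    simp [cross]
    ring
  · funext l
    fin_cases l <;> simp [cross] <;> ring
  · exact (smul_zero c).symm

end Cross

theorem real_smul_eq_C_smul {d n : ℕ} (c : ℝ) (v : Fin n → RPoly d) :
    c • v = (MvPolynomial.C c : RPoly d) • v :=
  funext fun l => by rw [Pi.smul_apply, Pi.smul_apply, MvPolynomial.smul_eq_C_mul, smul_eq_mul]

theorem cross_real_smul_left {d : ℕ} (c : ℝ) (v w : VPoly d) :
    cross d (c • v) w = c • cross d v w := by
  rw [real_smul_eq_C_smul, cross_smul_left, ← real_smul_eq_C_smul]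

theorem cross_real_smul_right {d : ℕ} (c : ℝ) (v w : VPoly d) :
    cross d v (c • w) = c • cross d v w := by
  rw [real_smul_eq_C_smul, cross_smul_right, ← real_smul_eq_C_smul]

section Forms

variable {d : ℕ} [NeZero d] (K : Element d)

theorem crossN_tr_add (v w : VPoly d) :
    crossN K (tr (v + w)) = crossN K (tr v) + crossN K (tr w) :=
  funext fun _ => cross_add_left d v w _

theorem crossN_tr_smul (c : ℝ) (v : VPoly d) :
    crossN K (tr (c • v)) = c • crossN K (tr v) :=
  funext fun _ => cross_real_smul_left c v _

theorem tr_add {d : ℕ} (v w : VPoly d) : tr (v + w) = tr v + tr w := rfl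

theorem tr_smul {d : ℕ} (c : ℝ) (v : VPoly d) : tr (c • v) = c • tr v := rfl

variable (k : ℕ)

theorem formD_comm (u v : VPoly d) : formD K k u v = formD K k v u := by
  rw [formD, formD, innerGrad_comm, innerBv_comm]

theorem formC_comm (u v : VPoly d) : formC K k u v = formC K k v u := by
  rw [formC, formC, innerKv_comm, innerBv_comm]

theorem isLinearMap_formD (u : VPoly d) : IsLinearMap ℝ (formD K k u) where
  map_add v w := by
    simp only [formD, innerGrad_add_right, tr_add, innerBv_add_right]
    ring
  map_smul c v := by
    simp only [formD, innerGrad_smul_right, tr_smul, innerBv_smul_right, smul_eq_mul]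
    ring

theorem isLinearMap_formC (u : VPoly d) : IsLinearMap ℝ (formC K k u) where
  map_add v w := by
    simp only [formC, weakCurl_add, innerKv_add_right, crossN_tr_add, innerBv_add_right]
    ring
  map_smul c v := by
    simp only [formC, weakCurl_smul, innerKv_smul_right, crossN_tr_smul, innerBv_smul_right,
      smul_eq_mul]
    ring

theorem aK_eq (Ha : ℝ) (u v : VPoly d) : aK K k Ha u v = 1 / Ha ^ 2 * formD K k u v := by
  rw [aK, formD]
  ring

theorem aTK_eq (Rm : ℝ) (u v : VPoly d) : aTK K k Rm u v = 1 / Rm ^ 2 * formC K k u v := by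
  rw [aTK, formC]
  ring

theorem normD_sq (v : VPoly d) : normD K k v ^ 2 = formD K k v v :=
  Real.sq_sqrt (formD_self_nonneg K k v)

theorem normC_sq (v : VPoly d) : normC K k v ^ 2 = formC K k v v :=
  Real.sq_sqrt (formC_self_nonneg K k v)

theorem isLinearMap_bK_left (q : RPoly d) : IsLinearMap ℝ fun v => bK K k v q where
  map_add _ _ := innerKv_add_right K _ _ _
  map_smul _ _ := innerKv_smul_right K _ _ _

theorem isLinearMap_bK_right (v : VPoly d) : IsLinearMap ℝ fun q => bK K k v q where
  map_add p q := by rw [bK, weakGrad_add, innerKv_add_left]; rfl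
  map_smul c p := by rw [bK, weakGrad_smul, innerKv_smul_left]; rfl

/-- The trilinear form `(∇·(u ⊗ Φ), v)_K`. -/
def divForm (Φ u v : VPoly d) : ℝ := ∑ a, innerK K (weakDiv K k (u a • Φ) 0) (v a)

theorem cK_eq (N : ℝ) (Φ u v : VPoly d) :
    cK K k N Φ u v = 1 / (2 * N) * (divForm K k Φ u v - divForm K k Φ v u) := by
  have h : (fun _ : Fin (d + 1) => (0 : VPoly d)) = 0 := rfl
  have h0 : ∀ a : Fin d, tensor (0 : VPoly d) 0 a = 0 := fun a => by
    funext b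
    simp [tensor]
  simp only [cK, innerKv, weakDivT, h0, h, divForm, mul_sub]
  rfl

theorem isLinearMap_divForm₁ (u v : VPoly d) : IsLinearMap ℝ fun Φ => divForm K k Φ u v where
  map_add Φ Ψ := by
    simp only [divForm, smul_add, weakDiv_add, innerK_add_left, Finset.sum_add_distrib]
  map_smul c Φ := by
    simp only [divForm, smul_comm _ c Φ, weakDiv_smul, innerK_smul_left, ← Finset.mul_sum,
      smul_eq_mul]

theorem isLinearMap_divForm₂ (Φ v : VPoly d) : IsLinearMap ℝ fun u => divForm K k Φ u v where
  map_add u u' := by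
    simp only [divForm, Pi.add_apply, add_smul, weakDiv_add, innerK_add_left,
      Finset.sum_add_distrib]
  map_smul c u := by
    simp only [divForm, Pi.smul_apply, smul_assoc, weakDiv_smul, innerK_smul_left,
      ← Finset.mul_sum, smul_eq_mul]

theorem isLinearMap_divForm₃ (Φ u : VPoly d) : IsLinearMap ℝ fun v => divForm K k Φ u v where
  map_add v w := by
    simp only [divForm, Pi.add_apply, innerK_add_right, Finset.sum_add_distrib]
  map_smul c v := by
    simp only [divForm, Pi.smul_apply, innerK_smul_right, ← Finset.mul_sum, smul_eq_mul]

theorem isLinearMap_cK₁ (N : ℝ) (u v : VPoly d) : IsLinearMap ℝ fun Φ => cK K k N Φ u v where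
  map_add Φ Ψ := by
    simp only [cK_eq, (isLinearMap_divForm₁ K k _ _).map_add]
    ring
  map_smul c Φ := by
    simp only [cK_eq, (isLinearMap_divForm₁ K k _ _).map_smul, smul_eq_mul]
    ring

theorem isLinearMap_cK₂ (N : ℝ) (Φ v : VPoly d) : IsLinearMap ℝ fun u => cK K k N Φ u v where
  map_add u u' := by
    simp only [cK_eq, (isLinearMap_divForm₂ K k _ _).map_add,
      (isLinearMap_divForm₃ K k _ _).map_add]
    ring
  map_smul c u := by
    simp only [cK_eq, (isLinearMap_divForm₂ K k _ _).map_smul,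
      (isLinearMap_divForm₃ K k _ _).map_smul, smul_eq_mul]
    ring

theorem cK_swap (N : ℝ) (Φ u v : VPoly d) : cK K k N Φ u v = -cK K k N Φ v u := by
  rw [cK_eq, cK_eq]
  ring

theorem cK_self (N : ℝ) (Φ u : VPoly d) : cK K k N Φ u u = 0 := by
  rw [cK_eq]
  ring

theorem isLinearMap_cK₃ (N : ℝ) (Φ u : VPoly d) : IsLinearMap ℝ fun v => cK K k N Φ u v where
  map_add v w := by
    simp only [cK_swap K k N Φ u, (isLinearMap_cK₂ K k N Φ u).map_add]
    ring
  map_smul c v := by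
    simp only [cK_swap K k N Φ u, (isLinearMap_cK₂ K k N Φ u).map_smul, smul_eq_mul]
    ring

theorem isLinearMap_cTK₁ (Rm : ℝ) (B w : VPoly d) : IsLinearMap ℝ fun v => cTK K k Rm v B w where
  map_add v v' := by
    simp only [cTK, cross_add_left, innerKv_add_right]
    ring
  map_smul c v := by
    simp only [cTK, cross_real_smul_left, innerKv_smul_right, smul_eq_mul]
    ring

theorem isLinearMap_cTK₂ (Rm : ℝ) (v w : VPoly d) : IsLinearMap ℝ fun B => cTK K k Rm v B w where
  map_add B B' := by
    simp only [cTK, cross_add_right, innerKv_add_right]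
    ring
  map_smul c B := by
    simp only [cTK, cross_real_smul_right, innerKv_smul_right, smul_eq_mul]
    ring

theorem isLinearMap_cTK₃ (Rm : ℝ) (v B : VPoly d) : IsLinearMap ℝ fun w => cTK K k Rm v B w where
  map_add w w' := by
    simp only [cTK, weakCurl_add, innerKv_add_left]
    ring
  map_smul c w := by
    simp only [cTK, weakCurl_smul, innerKv_smul_left, smul_eq_mul]
    ring

/-! ### Linearity of the data functionals -/

theorem integrable_data {d : ℕ} (K : Element d) {f : E d → E d} (hf : MemLp f 2 (volume.restrict K.closedInterior))
    (v : VPoly d) : Integrable (fun x => ∑ j, f x j * val (v j) x)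
      (volume.restrict K.closedInterior) := by
  have hfin : IsFiniteMeasure (volume.restrict K.closedInterior : Measure (E d)) :=
    ⟨by simpa using K.isCompact_closedInterior.measure_lt_top⟩
  refine integrable_finsetSum _ fun j _ => ?_
  have h1 : Integrable (fun x => f x j) (volume.restrict K.closedInterior) :=
    (EuclideanSpace.proj (𝕜 := ℝ) j).integrable_comp (hf.integrable one_le_two)
  exact IntegrableOn.mul_continuousOn h1 (continuous_val _).continuousOn
    K.isCompact_closedInterior

theorem isLinearMap_innerData {f : E d → E d}
    (hf : MemLp f 2 (volume.restrict K.closedInterior)) : IsLinearMap ℝ (innerData K f) where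
  map_add v w := by
    rw [innerData, innerData, innerData,
      ← integral_add (integrable_data K hf v) (integrable_data K hf w)]
    simp only [Pi.add_apply, val_add, mul_add, Finset.sum_add_distrib]
  map_smul c v := by
    rw [innerData, innerData, smul_eq_mul, ← integral_const_mul]
    simp only [Pi.smul_apply, val_smul, Finset.mul_sum, mul_left_comm c]

theorem isLinearMap_FK (Ha N : ℝ) {f : E d → E d}
    (hf : MemLp f 2 (volume.restrict K.closedInterior)) (ub : Fin (d + 1) → VPoly d)
    (pb : Fin (d + 1) → RPoly d) : IsLinearMap ℝ (FK K k Ha N f ub pb) where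
  map_add v w := by
    simp only [FK, (isLinearMap_innerData K hf).map_add, innerGrad_add_right, tr_add,
      innerBv_add_right, innerKv_add_right]
    ring
  map_smul c v := by
    simp only [FK, (isLinearMap_innerData K hf).map_smul, innerGrad_smul_right, tr_smul,
      innerBv_smul_right, innerKv_smul_right, smul_eq_mul]
    ring

theorem isLinearMap_GK (Rm : ℝ) {g : E d → E d}
    (hg : MemLp g 2 (volume.restrict K.closedInterior)) (Bb : Fin (d + 1) → VPoly d)
    (rb : Fin (d + 1) → RPoly d) : IsLinearMap ℝ (GK K k Rm g Bb rb) where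
  map_add v w := by
    simp only [GK, (isLinearMap_innerData K hg).map_add, weakCurl_add, crossN_tr_add,
      innerBv_add_right, innerKv_add_right]
    ring
  map_smul c v := by
    simp only [GK, (isLinearMap_innerData K hg).map_smul, weakCurl_smul, crossN_tr_smul,
      innerBv_smul_right, innerKv_smul_right, smul_eq_mul]
    ring

end Forms

/-! ### Energy forms on finite-dimensional spaces -/

/-- A symmetric, positive definite bilinear form. -/
structure IsEnergyForm {V : Type*} [AddCommGroup V] [Module ℝ V] (A : V → V → ℝ) : Prop where
  symm : ∀ x y, A x y = A y x
  isLinearMap : ∀ x, IsLinearMap ℝ (A x)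
  pos : ∀ x, x ≠ 0 → 0 < A x x

namespace IsEnergyForm

variable {V : Type*} [AddCommGroup V] [Module ℝ V] {A : V → V → ℝ}

theorem nonneg (hA : IsEnergyForm A) (x : V) : 0 ≤ A x x := by
  by_cases hx : x = 0
  · rw [hx, (hA.isLinearMap 0).map_zero]
  · exact (hA.pos x hx).le

/-- The inner product given by an energy form. -/
@[reducible]
def core (hA : IsEnergyForm A) : InnerProductSpace.Core ℝ V where
  inner := A
  conj_inner_symm x y := hA.symm y x
  re_inner_nonneg x := hA.nonneg x
  add_left x y z := by
    rw [hA.symm, (hA.isLinearMap z).map_add, hA.symm z x, hA.symm z y]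
  smul_left x y r := by
    rw [hA.symm, (hA.isLinearMap y).map_smul, hA.symm y x]
    rfl
  definite x hx := by
    by_contra hne
    exact (hA.pos x hne).ne' hx

theorem prod {W : Type*} [AddCommGroup W] [Module ℝ W] {B : W → W → ℝ} (hA : IsEnergyForm A)
    (hB : IsEnergyForm B) {a b : ℝ} (ha : 0 < a) (hb : 0 < b) :
    IsEnergyForm fun x y : V × W => a * A x.1 y.1 + b * B x.2 y.2 where
  symm x y := by rw [hA.symm, hB.symm]
  isLinearMap x :=
    { map_add := fun y z => by
        simp only [Prod.fst_add, Prod.snd_add, (hA.isLinearMap _).map_add,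
          (hB.isLinearMap _).map_add]
        ring
      map_smul := fun c y => by
        simp only [Prod.smul_fst, Prod.smul_snd, (hA.isLinearMap _).map_smul,
          (hB.isLinearMap _).map_smul, smul_eq_mul]
        ring }
  pos x hx := by
    have h1 := mul_nonneg ha.le (hA.nonneg x.1)
    have h2 := mul_nonneg hb.le (hB.nonneg x.2)
    by_cases h : x.1 = 0
    · have h3 := mul_pos hb (hB.pos x.2 fun h' => hx (Prod.ext h h'))
      linarith
    · have h3 := mul_pos ha (hA.pos x.1 h)
      linarith

variable [FiniteDimensional ℝ V]

/-- The energy form is made the inner product of the space, and the abstract solvability result is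
applied there. -/
theorem exists_solution (hA : IsEnergyForm A) {T : V → V → V → ℝ}
    (h₁ : ∀ y z, IsLinearMap ℝ fun x => T x y z) (h₂ : ∀ x z, IsLinearMap ℝ fun y => T x y z)
    (h₃ : ∀ x y, IsLinearMap ℝ fun z => T x y z) (hT : ∀ x, T x x x = 0) {F : V → ℝ}
    (hF : IsLinearMap ℝ F) : ∃ x, ∀ y, A x y + T x x y = F y := by
  let _ : NormedAddCommGroup V := hA.core.toNormedAddCommGroup
  let _ : InnerProductSpace ℝ V := InnerProductSpace.ofCore hA.core.toCore
  let T' : V →ₗ[ℝ] V →ₗ[ℝ] V →ₗ[ℝ] ℝ := LinearMap.mk₂ ℝ (fun x y => (h₃ x y).mk' _)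
    (fun x x' y => LinearMap.ext fun z => (h₁ y z).map_add x x')
    (fun c x y => LinearMap.ext fun z => (h₁ y z).map_smul c x)
    (fun x y y' => LinearMap.ext fun z => (h₂ x z).map_add y y')
    (fun c x y => LinearMap.ext fun z => (h₂ x z).map_smul c y)
  exact exists_solution_of_energy_neutral T' hT (hF.mk' _)

theorem exists_bound_linear (hA : IsEnergyForm A) (F : V →ₗ[ℝ] ℝ) :
    ∃ C, 0 ≤ C ∧ ∀ x, |F x| ≤ C * √(A x x) := by
  let _ : NormedAddCommGroup V := hA.core.toNormedAddCommGroup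
  let _ : InnerProductSpace ℝ V := InnerProductSpace.ofCore hA.core.toCore
  exact ⟨‖LinearMap.toContinuousLinearMap F‖, ContinuousLinearMap.opNorm_nonneg _, fun x =>
    (LinearMap.toContinuousLinearMap F).le_opNorm x⟩

/-- Expansion of `x` in a basis reduces a uniform bound to finitely many `f (b i)`, since
coordinates are bounded in the energy norm. The parameter set `α` is arbitrary so that the argument
can be iterated over several variables. -/
theorem exists_bound (hA : IsEnergyForm A) {α : Type*} {f : V → α → ℝ}
    (hf : ∀ a, IsLinearMap ℝ fun x => f x a) {g : α → ℝ}
    (hb : ∀ x, ∃ C, ∀ a, |f x a| ≤ C * g a) :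
    ∃ C, ∀ x a, |f x a| ≤ C * (√(A x x) * g a) := by
  let b := Module.finBasis ℝ V
  choose c hc0 hc using fun i => hA.exists_bound_linear (b.coord i)
  choose C hC using fun i => hb (b i)
  refine ⟨∑ i, c i * C i, fun x a => ?_⟩
  have h1 : f x a = ∑ i, b.coord i x * f (b i) a := by
    have h := congrArg ((hf a).mk' _) (b.sum_repr x)
    rw [map_sum] at h
    simp only [map_smul, smul_eq_mul] at h
    exact h.symm
  rw [h1, Finset.sum_mul]
  refine (Finset.abs_sum_le_sum_abs _ _).trans (Finset.sum_le_sum fun i _ => ?_)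
  rw [abs_mul]
  calc |b.coord i x| * |f (b i) a| ≤ (c i * √(A x x)) * (C i * g a) :=
        mul_le_mul (hc i x) (hC i a) (abs_nonneg _) (mul_nonneg (hc0 i) (Real.sqrt_nonneg _))
    _ = c i * C i * (√(A x x) * g a) := by ring

theorem exists_bound₃ {V₂ V₃ : Type*} [AddCommGroup V₂] [Module ℝ V₂] [FiniteDimensional ℝ V₂]
    [AddCommGroup V₃] [Module ℝ V₃] [FiniteDimensional ℝ V₃] {A₂ : V₂ → V₂ → ℝ}
    {A₃ : V₃ → V₃ → ℝ} (hA : IsEnergyForm A) (hA₂ : IsEnergyForm A₂) (hA₃ : IsEnergyForm A₃)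
    {f : V → V₂ → V₃ → ℝ} (h₁ : ∀ y z, IsLinearMap ℝ fun x => f x y z)
    (h₂ : ∀ x z, IsLinearMap ℝ fun y => f x y z) (h₃ : ∀ x y, IsLinearMap ℝ fun z => f x y z) :
    ∃ C, ∀ x y z, |f x y z| ≤ C * (√(A x x) * (√(A₂ y y) * √(A₃ z z))) := by
  obtain ⟨C, hC⟩ := hA.exists_bound (α := V₂ × V₃) (f := fun x a => f x a.1 a.2)
    (g := fun a => √(A₂ a.1 a.1) * √(A₃ a.2 a.2)) (fun a => h₁ a.1 a.2) fun x => by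
    obtain ⟨C, hC⟩ := hA₂.exists_bound (α := V₃) (f := fun y z => f x y z)
      (g := fun z => √(A₃ z z)) (fun z => h₂ x z) fun y => by
      obtain ⟨C, -, hC⟩ := hA₃.exists_bound_linear ((h₃ x y).mk' _)
      exact ⟨C, hC⟩
    exact ⟨C, fun a => hC a.1 a.2⟩
  exact ⟨C, fun x y z => hC x (y, z)⟩

end IsEnergyForm

/-- Estimates by a supremum of quotients which is invariant under a change of sign. -/
theorem abs_le_sSup_mul {α : Type*} {P : α → Prop} {f g : α → ℝ} (hg : ∀ a, P a → 0 < g a)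
    {C : ℝ} (hC : ∀ a, P a → |f a| ≤ C * g a)
    (hneg : ∀ a, P a → ∃ a', P a' ∧ f a' = -f a ∧ g a' = g a) :
    0 ≤ sSup {t | ∃ a, P a ∧ t = f a / g a} ∧
      ∀ a, P a → |f a| ≤ sSup {t | ∃ a, P a ∧ t = f a / g a} * g a := by
  -- Boundedness must be proved, because the real supremum of an unbounded set is `0` by convention.
  have hbdd : BddAbove {t | ∃ a, P a ∧ t = f a / g a} := by
    refine ⟨C, ?_⟩
    rintro _ ⟨a, ha, rfl⟩
    rw [div_le_iff₀ (hg a ha)]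
    exact (le_abs_self _).trans (hC a ha)
  have h1 : ∀ a, P a → f a ≤ sSup {t | ∃ a, P a ∧ t = f a / g a} * g a := fun a ha =>
    (div_le_iff₀ (hg a ha)).1 (le_csSup hbdd ⟨a, ha, rfl⟩)
  have h2 : ∀ a, P a → |f a| ≤ sSup {t | ∃ a, P a ∧ t = f a / g a} * g a := by
    intro a ha
    obtain ⟨a', ha', hf, hg'⟩ := hneg a ha
    refine abs_le.2 ⟨?_, h1 a ha⟩
    have := h1 a' ha'
    rw [hf, hg'] at this
    linarith
  refine ⟨?_, h2⟩
  -- With no admissible element the set of quotients is empty and its supremum is `0`.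
  by_cases hne : ∃ a, P a
  · obtain ⟨a, ha⟩ := hne
    exact nonneg_of_mul_nonneg_left ((abs_nonneg _).trans (h2 a ha)) (hg a ha)
  · have : {t | ∃ a, P a ∧ t = f a / g a} = ∅ := by
      ext t
      simp only [Set.mem_ofPred_eq, Set.mem_empty_iff_false, iff_false]
      rintro ⟨a, ha, -⟩
      exact hne ⟨a, ha⟩
    rw [this, Real.sSup_empty]

/-! ### The kernel space and the constants of the local problem -/

section Kernel

variable {d : ℕ} [NeZero d] (K : Element d) (k : ℕ)

/-- `V̄_{h,K}` as a subspace. -/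
def VbarS : Submodule ℝ (VPoly d) where
  carrier := Vbar K k
  add_mem' {v w} hv hw := ⟨Submodule.add_mem _ hv.1 hw.1, fun q hq => by
    rw [(isLinearMap_bK_left K k q).map_add, hv.2 q hq, hw.2 q hq, add_zero]⟩
  zero_mem' := ⟨Submodule.zero_mem _, fun q _ => (isLinearMap_bK_left K k q).map_zero⟩
  smul_mem' c v hv := ⟨Submodule.smul_mem _ c hv.1, fun q hq => by
    rw [(isLinearMap_bK_left K k q).map_smul, hv.2 q hq, smul_zero]⟩

instance finiteDimensional_VPolyLE (d m : ℕ) : FiniteDimensional ℝ (VPolyLE d m) := by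
  let g : VPolyLE d m →ₗ[ℝ] Fin d → PolyLE d m :=
    LinearMap.pi fun l => ((LinearMap.proj l).comp (VPolyLE d m).subtype).codRestrict _
      fun v => mem_VPolyLE.1 v.2 l
  refine FiniteDimensional.of_injective g fun v w h => Subtype.ext (funext fun l => ?_)
  exact congrArg Subtype.val (congrFun h l)

instance finiteDimensional_VbarS : FiniteDimensional ℝ (VbarS K k) :=
  Submodule.finiteDimensional_of_le (S₂ := VPolyLE d k) fun _ hv => hv.1

theorem isEnergyForm_formD : IsEnergyForm fun u v : VbarS K k => formD K k u v where
  symm u v := formD_comm K k u v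
  isLinearMap u := ⟨fun v w => (isLinearMap_formD K k u).map_add v w,
    fun c v => (isLinearMap_formD K k u).map_smul c v⟩
  pos u hu := (formD_self_nonneg K k u).lt_of_ne fun h =>
    hu (Subtype.ext (formD_self_eq_zero K u.2.1 h.symm))

theorem isEnergyForm_formC (hd : d = 2 ∨ d = 3) :
    IsEnergyForm fun u v : VbarS K k => formC K k u v where
  symm u v := formC_comm K k u v
  isLinearMap u := ⟨fun v w => (isLinearMap_formC K k u).map_add v w,
    fun c v => (isLinearMap_formC K k u).map_smul c v⟩
  pos u hu := (formC_self_nonneg K k u).lt_of_ne fun h =>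
    hu (Subtype.ext (formC_self_eq_zero hd K u.2 h.symm))

theorem normD_neg (v : VPoly d) : normD K k (-v) = normD K k v := by
  change √(formD K k (-v) (-v)) = √(formD K k v v)
  rw [(isLinearMap_formD K k _).map_neg, formD_comm, (isLinearMap_formD K k _).map_neg, neg_neg]

theorem normC_neg (v : VPoly d) : normC K k (-v) = normC K k v := by
  change √(formC K k (-v) (-v)) = √(formC K k v v)
  rw [(isLinearMap_formC K k _).map_neg, formC_comm, (isLinearMap_formC K k _).map_neg, neg_neg]

theorem normD_pos {v : VPoly d} (hv : v ∈ VbarS K k) (h : v ≠ 0) : 0 < normD K k v :=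
  Real.sqrt_pos.2 ((isEnergyForm_formD K k).pos ⟨v, hv⟩ fun h' => h (congrArg Subtype.val h'))

theorem normC_pos (hd : d = 2 ∨ d = 3) {v : VPoly d} (hv : v ∈ VbarS K k) (h : v ≠ 0) :
    0 < normC K k v :=
  Real.sqrt_pos.2 ((isEnergyForm_formC K k hd).pos ⟨v, hv⟩ fun h' => h (congrArg Subtype.val h'))

theorem dualNormD_bound {F : VPoly d → ℝ} (hF : IsLinearMap ℝ F) :
    0 ≤ dualNormD K k F ∧ ∀ v ∈ VbarS K k, |F v| ≤ dualNormD K k F * normD K k v := by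
  obtain ⟨C, -, hC⟩ := (isEnergyForm_formD K k).exists_bound_linear
    ((hF.mk' F).comp (VbarS K k).subtype)
  have h := abs_le_sSup_mul (P := fun v => v ∈ VbarS K k ∧ v ≠ 0) (f := F) (g := normD K k) (C := C)
    (fun v hv => normD_pos K k hv.1 hv.2) (fun v hv => hC ⟨v, hv.1⟩)
    fun v hv => ⟨-v, ⟨neg_mem hv.1, neg_ne_zero.2 hv.2⟩, hF.map_neg v, normD_neg K k v⟩
  have he : dualNormD K k F = sSup {t | ∃ v, (v ∈ VbarS K k ∧ v ≠ 0) ∧ t = F v / normD K k v} := by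
    rw [dualNormD]
    simp only [and_assoc]
    rfl
  rw [he]
  refine ⟨h.1, fun v hv => ?_⟩
  by_cases h0 : v = 0
  · rw [h0, hF.map_zero, abs_zero]
    exact mul_nonneg h.1 (Real.sqrt_nonneg _)
  · exact h.2 v ⟨hv, h0⟩

theorem mem_Wbar_iff_mem_VbarS {Rm : ℝ} (hRm : 0 < Rm) (w : VPoly d) :
    w ∈ Wbar K k Rm ↔ w ∈ VbarS K k :=
  mem_Wbar_iff K k hRm w

theorem dualNormC_bound (hd : d = 2 ∨ d = 3) {Rm : ℝ} (hRm : 0 < Rm) {F : VPoly d → ℝ}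
    (hF : IsLinearMap ℝ F) :
    0 ≤ dualNormC K k Rm F ∧ ∀ v ∈ VbarS K k, |F v| ≤ dualNormC K k Rm F * normC K k v := by
  obtain ⟨C, -, hC⟩ := (isEnergyForm_formC K k hd).exists_bound_linear
    ((hF.mk' F).comp (VbarS K k).subtype)
  have h := abs_le_sSup_mul (P := fun v => v ∈ VbarS K k ∧ v ≠ 0) (f := F) (g := normC K k) (C := C)
    (fun v hv => normC_pos K k hd hv.1 hv.2) (fun v hv => hC ⟨v, hv.1⟩)
    fun v hv => ⟨-v, ⟨neg_mem hv.1, neg_ne_zero.2 hv.2⟩, hF.map_neg v, normC_neg K k v⟩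
  have he : dualNormC K k Rm F =
      sSup {t | ∃ v, (v ∈ VbarS K k ∧ v ≠ 0) ∧ t = F v / normC K k v} := by
    rw [dualNormC]
    simp only [and_assoc, mem_Wbar_iff_mem_VbarS K k hRm]
  rw [he]
  refine ⟨h.1, fun v hv => ?_⟩
  by_cases h0 : v = 0
  · rw [h0, hF.map_zero, abs_zero]
    exact mul_nonneg h.1 (Real.sqrt_nonneg _)
  · exact h.2 v ⟨hv, h0⟩

theorem isLinearMap_restrict {V : Type*} [AddCommGroup V] [Module ℝ V] (S : Submodule ℝ V)
    {f : V → ℝ} (hf : IsLinearMap ℝ f) : IsLinearMap ℝ fun v : S => f v :=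
  ⟨fun v w => hf.map_add v w, fun c v => hf.map_smul c v⟩

/-- Finite dimension makes the quotients bounded, so the constant is a true supremum; a sign change
in the last argument gives the absolute value, and zero arguments are covered by linearity. -/
theorem MK_bound (N : ℝ) : 0 ≤ MK K k N ∧ ∀ Φ ∈ VbarS K k, ∀ u ∈ VbarS K k, ∀ v ∈ VbarS K k,
    |cK K k N Φ u v| ≤ MK K k N * (normD K k Φ * normD K k u * normD K k v) := by
  obtain ⟨C, hC⟩ := (isEnergyForm_formD K k).exists_bound₃ (isEnergyForm_formD K k)
    (isEnergyForm_formD K k) (f := fun Φ u v => cK K k N Φ u v)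
    (fun u v => isLinearMap_restrict _ (isLinearMap_cK₁ K k N u v))
    (fun Φ v => isLinearMap_restrict _ (isLinearMap_cK₂ K k N Φ v))
    (fun Φ u => isLinearMap_restrict _ (isLinearMap_cK₃ K k N Φ u))
  have h := abs_le_sSup_mul (α := VPoly d × VPoly d × VPoly d)
    (P := fun a => (a.1 ∈ VbarS K k ∧ a.2.1 ∈ VbarS K k ∧ a.2.2 ∈ VbarS K k) ∧
      a.1 ≠ 0 ∧ a.2.1 ≠ 0 ∧ a.2.2 ≠ 0)
    (f := fun a => cK K k N a.1 a.2.1 a.2.2)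
    (g := fun a => normD K k a.1 * normD K k a.2.1 * normD K k a.2.2) (C := C)
    (fun a ⟨h, h'⟩ => mul_pos (mul_pos (normD_pos K k h.1 h'.1) (normD_pos K k h.2.1 h'.2.1))
      (normD_pos K k h.2.2 h'.2.2))
    (fun a ⟨h, _⟩ => by
      rw [mul_assoc (normD K k a.1)]
      exact hC ⟨a.1, h.1⟩ ⟨a.2.1, h.2.1⟩ ⟨a.2.2, h.2.2⟩)
    (fun a ⟨h, h'⟩ => ⟨(a.1, a.2.1, -a.2.2), ⟨⟨h.1, h.2.1, neg_mem h.2.2⟩, h'.1, h'.2.1,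
      neg_ne_zero.2 h'.2.2⟩, (isLinearMap_cK₃ K k N a.1 a.2.1).map_neg a.2.2, by
        simp only [normD_neg]⟩)
  have he : MK K k N = sSup {t | ∃ a : VPoly d × VPoly d × VPoly d,
      ((a.1 ∈ VbarS K k ∧ a.2.1 ∈ VbarS K k ∧ a.2.2 ∈ VbarS K k) ∧
        a.1 ≠ 0 ∧ a.2.1 ≠ 0 ∧ a.2.2 ≠ 0) ∧
      t = cK K k N a.1 a.2.1 a.2.2 / (normD K k a.1 * normD K k a.2.1 * normD K k a.2.2)} := by
    rw [MK]
    congr 1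
    ext t
    constructor
    · rintro ⟨Φ, hΦ, u, hu, v, hv, h1, h2, h3, ht⟩
      exact ⟨(Φ, u, v), ⟨⟨hΦ, hu, hv⟩, h1, h2, h3⟩, ht⟩
    · rintro ⟨a, ⟨⟨hΦ, hu, hv⟩, h1, h2, h3⟩, ht⟩
      exact ⟨a.1, hΦ, a.2.1, hu, a.2.2, hv, h1, h2, h3, ht⟩
  rw [he]
  refine ⟨h.1, fun Φ hΦ u hu v hv => ?_⟩
  by_cases h0 : Φ ≠ 0 ∧ u ≠ 0 ∧ v ≠ 0
  · exact h.2 (Φ, u, v) ⟨⟨hΦ, hu, hv⟩, h0⟩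
  · have hz : cK K k N Φ u v = 0 := by
      by_cases h1 : Φ = 0
      · rw [h1]
        exact (isLinearMap_cK₁ K k N u v).map_zero
      by_cases h2 : u = 0
      · rw [h2]
        exact (isLinearMap_cK₂ K k N Φ v).map_zero
      · have h3 : v = 0 := by
          by_contra h3
          exact h0 ⟨h1, h2, h3⟩
        rw [h3]
        exact (isLinearMap_cK₃ K k N Φ u).map_zero
    rw [hz, abs_zero]
    exact mul_nonneg h.1 (mul_nonneg (mul_nonneg (Real.sqrt_nonneg _) (Real.sqrt_nonneg _))
      (Real.sqrt_nonneg _))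

theorem MTK_bound (hd : d = 2 ∨ d = 3) {Rm : ℝ} (hRm : 0 < Rm) :
    0 ≤ MTK K k Rm ∧ ∀ v ∈ VbarS K k, ∀ B ∈ VbarS K k, ∀ w ∈ VbarS K k,
      |cTK K k Rm v B w| ≤ MTK K k Rm * (normC K k w * normD K k v * normC K k B) := by
  obtain ⟨C, hC⟩ := (isEnergyForm_formC K k hd).exists_bound₃ (isEnergyForm_formD K k)
    (isEnergyForm_formC K k hd) (f := fun w v B => cTK K k Rm v B w)
    (fun v B => isLinearMap_restrict _ (isLinearMap_cTK₃ K k Rm v B))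
    (fun w B => isLinearMap_restrict _ (isLinearMap_cTK₁ K k Rm B w))
    (fun w v => isLinearMap_restrict _ (isLinearMap_cTK₂ K k Rm v w))
  have h := abs_le_sSup_mul (α := VPoly d × VPoly d × VPoly d)
    (P := fun a => (a.1 ∈ VbarS K k ∧ a.2.1 ∈ VbarS K k ∧ a.2.2 ∈ VbarS K k) ∧
      a.1 ≠ 0 ∧ a.2.1 ≠ 0 ∧ a.2.2 ≠ 0)
    (f := fun a => cTK K k Rm a.2.2 a.2.1 a.1)
    (g := fun a => normC K k a.1 * normD K k a.2.2 * normC K k a.2.1) (C := C)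
    (fun a ⟨h, h'⟩ => mul_pos (mul_pos (normC_pos K k hd h.1 h'.1) (normD_pos K k h.2.2 h'.2.2))
      (normC_pos K k hd h.2.1 h'.2.1))
    (fun a ⟨h, _⟩ => by
      rw [mul_assoc (normC K k a.1)]
      exact hC ⟨a.1, h.1⟩ ⟨a.2.2, h.2.2⟩ ⟨a.2.1, h.2.1⟩)
    (fun a ⟨h, h'⟩ => ⟨(a.1, a.2.1, -a.2.2), ⟨⟨h.1, h.2.1, neg_mem h.2.2⟩, h'.1, h'.2.1,
      neg_ne_zero.2 h'.2.2⟩, (isLinearMap_cTK₁ K k Rm a.2.1 a.1).map_neg a.2.2, by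
        simp only [normD_neg]⟩)
  have he : MTK K k Rm = sSup {t | ∃ a : VPoly d × VPoly d × VPoly d,
      ((a.1 ∈ VbarS K k ∧ a.2.1 ∈ VbarS K k ∧ a.2.2 ∈ VbarS K k) ∧
        a.1 ≠ 0 ∧ a.2.1 ≠ 0 ∧ a.2.2 ≠ 0) ∧
      t = cTK K k Rm a.2.2 a.2.1 a.1 /
        (normC K k a.1 * normD K k a.2.2 * normC K k a.2.1)} := by
    rw [MTK]
    congr 1
    ext t
    simp only [mem_Wbar_iff_mem_VbarS K k hRm]
    constructor
    · rintro ⟨w, hw, B, hB, v, hv, h1, h2, h3, ht⟩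
      exact ⟨(w, B, v), ⟨⟨hw, hB, hv⟩, h1, h2, h3⟩, ht⟩
    · rintro ⟨a, ⟨⟨hw, hB, hv⟩, h1, h2, h3⟩, ht⟩
      exact ⟨a.1, hw, a.2.1, hB, a.2.2, hv, h1, h2, h3, ht⟩
  rw [he]
  refine ⟨h.1, fun v hv B hB w hw => ?_⟩
  by_cases h0 : w ≠ 0 ∧ B ≠ 0 ∧ v ≠ 0
  · exact h.2 (w, B, v) ⟨⟨hw, hB, hv⟩, h0⟩
  · have hz : cTK K k Rm v B w = 0 := by
      by_cases h1 : w = 0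
      · rw [h1]
        exact (isLinearMap_cTK₃ K k Rm v B).map_zero
      by_cases h2 : B = 0
      · rw [h2]
        exact (isLinearMap_cTK₂ K k Rm v w).map_zero
      · have h3 : v = 0 := by
          by_contra h3
          exact h0 ⟨h1, h2, h3⟩
        rw [h3]
        exact (isLinearMap_cTK₁ K k Rm B w).map_zero
    rw [hz, abs_zero]
    exact mul_nonneg h.1 (mul_nonneg (mul_nonneg (Real.sqrt_nonneg _) (Real.sqrt_nonneg _))
      (Real.sqrt_nonneg _))

/-! ### Recovery of the pressures -/

/-- An antiderivative in the first variable, placed in the first component, raises the degree by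
one; `1 ≤ k` ensures that `k - 1 + 1 = k`. -/
theorem exists_divP_eq {q : RPoly d} (hk : 1 ≤ k) (hq : q ∈ PolyLE d (k - 1)) :
    ∃ v ∈ VPolyLE d k, divP v = q := by
  obtain ⟨p, hp, hpq⟩ := exists_pderiv_eq hq 0
  rw [Nat.sub_add_cancel hk] at hp
  refine ⟨Pi.single 0 p, mem_VPolyLE.2 fun l => ?_, ?_⟩
  · by_cases hl : l = 0
    · rw [hl, Pi.single_eq_same]
      exact hp
    · rw [Pi.single_eq_of_ne hl]
      exact Submodule.zero_mem _
  · rw [divP, Finset.sum_eq_single 0 (fun l _ hl => by rw [Pi.single_eq_of_ne hl, map_zero])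
      (fun h => absurd (Finset.mem_univ _) h), Pi.single_eq_same, hpq]

theorem eq_zero_of_bK_eq_zero (hk : 1 ≤ k) {p : RPoly d} (hp : p ∈ PolyLE d (k - 1))
    (h : ∀ v ∈ VPolyLE d k, bK K k v p = 0) : p = 0 := by
  obtain ⟨v, hv, hvp⟩ := exists_divP_eq k hk hp
  have h1 := h v hv
  rw [bK_eq K hv, hvp, neg_eq_zero] at h1
  exact innerK_self_eq_zero K h1

/-- The kernel is the annihilator of the functionals `b(·, q)`. In finite dimension the range of `q
↦ b(·, q)` is its own double annihilator, hence contains every functional that vanishes on the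
kernel. -/
theorem exists_pressure {L : VPoly d → ℝ} (hL : IsLinearMap ℝ L) (h : ∀ v ∈ VbarS K k, L v = 0) :
    ∃ p ∈ PolyLE d (k - 1), ∀ v ∈ VPolyLE d k, bK K k v p = L v := by
  let β : PolyLE d (k - 1) →ₗ[ℝ] Module.Dual ℝ (VPolyLE d k) := LinearMap.mk₂ ℝ
    (fun q v => bK K k v q)
    (fun q q' v => (isLinearMap_bK_right K k v).map_add q q')
    (fun c q v => (isLinearMap_bK_right K k v).map_smul c q)
    (fun q v w => (isLinearMap_bK_left K k q).map_add v w)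
    (fun c q v => (isLinearMap_bK_left K k q).map_smul c v)
  let L' : Module.Dual ℝ (VPolyLE d k) := (hL.mk' L).comp (VPolyLE d k).subtype
  have hmem : L' ∈ LinearMap.range β := by
    rw [← Subspace.dualCoannihilator_dualAnnihilator_eq (W := LinearMap.range β),
      Submodule.mem_dualAnnihilator]
    intro v hv
    rw [Submodule.mem_dualCoannihilator] at hv
    exact h v ⟨v.2, fun q hq => hv _ ⟨⟨q, hq⟩, rfl⟩⟩
  obtain ⟨p, hp⟩ := hmem
  exact ⟨p, p.2, fun v hv => congrArg (fun F : Module.Dual ℝ (VPolyLE d k) => F ⟨v, hv⟩) hp⟩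

end Kernel

/-! ### Existence for the local problem -/

section Local

variable {d : ℕ} [NeZero d] (K : Element d) (k : ℕ)

/-- A solution of the reduced problem on the kernel spaces extends, with suitable pressures, to a
solution of the local problem. -/
theorem exists_localSolution_of_reduced {Ha N Rm : ℝ} (hRm : 0 < Rm) {f g : E d → E d}
    (hf : MemLp f 2 (volume.restrict K.closedInterior))
    (hg : MemLp g 2 (volume.restrict K.closedInterior))
    (ub Bb : Fin (d + 1) → VPoly d) (pb rb : Fin (d + 1) → RPoly d) {u B : VPoly d}
    (hu : u ∈ VbarS K k) (hB : B ∈ VbarS K k)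
    (h : ∀ v ∈ VbarS K k, ∀ w ∈ VbarS K k, aK K k Ha u v + aTK K k Rm B w +
      (cK K k N u u v + cTK K k Rm v B B - cTK K k Rm u B w) =
        FK K k Ha N f ub pb v + GK K k Rm g Bb rb w) :
    ∃ p r, IsLocalSolution K k Ha N Rm f g ub Bb pb rb u B p r := by
  have hF := isLinearMap_FK K k Ha N hf ub pb
  have hG := isLinearMap_GK K k Rm hg Bb rb
  have haT0 : aTK K k Rm B 0 = 0 := by
    rw [aTK_eq, (isLinearMap_formC K k B).map_zero, mul_zero]
  have ha0 : aK K k Ha u 0 = 0 := by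
    rw [aK_eq, (isLinearMap_formD K k u).map_zero, mul_zero]
  have hc0 : cK K k N u u 0 = 0 := (isLinearMap_cK₃ K k N u u).map_zero
  have hcT1 : cTK K k Rm 0 B B = 0 := (isLinearMap_cTK₁ K k Rm B B).map_zero
  have hcT3 : cTK K k Rm u B 0 = 0 := (isLinearMap_cTK₃ K k Rm u B).map_zero
  let L₁ : VPoly d → ℝ := fun v =>
    FK K k Ha N f ub pb v - aK K k Ha u v - cK K k N u u v - cTK K k Rm v B B
  -- The factor `Rm` compensates the `1 / Rm` in `b̃`, so that the same pressure lemma for `b`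
  -- applies.
  let L₂ : VPoly d → ℝ := fun w => Rm * (GK K k Rm g Bb rb w - aTK K k Rm B w + cTK K k Rm u B w)
  have hL₁ : IsLinearMap ℝ L₁ :=
    { map_add := fun v w => by
        simp only [L₁, hF.map_add, aK_eq, (isLinearMap_formD K k u).map_add,
          (isLinearMap_cK₃ K k N u u).map_add, (isLinearMap_cTK₁ K k Rm B B).map_add]
        ring
      map_smul := fun c v => by
        simp only [L₁, hF.map_smul, aK_eq, (isLinearMap_formD K k u).map_smul,
          (isLinearMap_cK₃ K k N u u).map_smul, (isLinearMap_cTK₁ K k Rm B B).map_smul,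
          smul_eq_mul]
        ring }
  have hL₂ : IsLinearMap ℝ L₂ :=
    { map_add := fun v w => by
        simp only [L₂, hG.map_add, aTK_eq, (isLinearMap_formC K k B).map_add,
          (isLinearMap_cTK₃ K k Rm u B).map_add]
        ring
      map_smul := fun c v => by
        simp only [L₂, hG.map_smul, aTK_eq, (isLinearMap_formC K k B).map_smul,
          (isLinearMap_cTK₃ K k Rm u B).map_smul, smul_eq_mul]
        ring }
  obtain ⟨p, hp, hpL⟩ := exists_pressure K k hL₁ fun v hv => by
    have h1 := h v hv 0 (Submodule.zero_mem _)
    rw [haT0, hcT3, hG.map_zero] at h1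
    simp only [L₁]
    linarith
  obtain ⟨r, hr, hrL⟩ := exists_pressure K k hL₂ fun w hw => by
    have h1 := h 0 (Submodule.zero_mem _) w hw
    rw [ha0, hc0, hcT1, hF.map_zero] at h1
    simp only [L₂]
    rw [show GK K k Rm g Bb rb w - aTK K k Rm B w + cTK K k Rm u B w = 0 by linarith, mul_zero]
  refine ⟨p, r, hu.1, hB.1, hp, hr, fun v hv w hw q hq θ hθ => ?_⟩
  rw [hpL v hv, hu.2 q hq, bTK_eq, bTK_eq, hrL w hw, hB.2 θ hθ]
  simp only [L₁, L₂]
  field_simp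
  ring

theorem exists_localSolution (hd : d = 2 ∨ d = 3) {Ha N Rm : ℝ} (hHa : 0 < Ha) (hRm : 0 < Rm)
    {f g : E d → E d} (hf : MemLp f 2 (volume.restrict K.closedInterior))
    (hg : MemLp g 2 (volume.restrict K.closedInterior))
    (ub Bb : Fin (d + 1) → VPoly d) (pb rb : Fin (d + 1) → RPoly d) :
    ∃ (u B : VPoly d) (p r : RPoly d),
      IsLocalSolution K k Ha N Rm f g ub Bb pb rb u B p r := by
  have hA := (isEnergyForm_formD K k).prod (isEnergyForm_formC K k hd)
    (a := 1 / Ha ^ 2) (b := 1 / Rm ^ 2) (by positivity) (by positivity)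
  have hF := isLinearMap_FK K k Ha N hf ub pb
  have hG := isLinearMap_GK K k Rm hg Bb rb
  obtain ⟨x, hx⟩ := hA.exists_solution
    -- The nonlinearity is polarised into a trilinear form on pairs. With `x = y = z` the first term
    -- vanishes by skew symmetry and the two coupling terms cancel.
    (T := fun x y z => cK K k N x.1 y.1 z.1 + cTK K k Rm z.1 x.2 y.2 - cTK K k Rm x.1 y.2 z.2)
    (fun y z =>
      { map_add := fun x x' => by
          simp only [Prod.fst_add, Prod.snd_add, Submodule.coe_add,
            (isLinearMap_cK₁ K k N _ _).map_add, (isLinearMap_cTK₁ K k Rm _ _).map_add,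
            (isLinearMap_cTK₂ K k Rm _ _).map_add]
          ring
        map_smul := fun c x => by
          simp only [Prod.smul_fst, Prod.smul_snd, Submodule.coe_smul,
            (isLinearMap_cK₁ K k N _ _).map_smul, (isLinearMap_cTK₁ K k Rm _ _).map_smul,
            (isLinearMap_cTK₂ K k Rm _ _).map_smul, smul_eq_mul]
          ring })
    (fun x z =>
      { map_add := fun y y' => by
          simp only [Prod.fst_add, Prod.snd_add, Submodule.coe_add,
            (isLinearMap_cK₂ K k N _ _).map_add, (isLinearMap_cTK₃ K k Rm _ _).map_add,
            (isLinearMap_cTK₂ K k Rm _ _).map_add]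
          ring
        map_smul := fun c y => by
          simp only [Prod.smul_fst, Prod.smul_snd, Submodule.coe_smul,
            (isLinearMap_cK₂ K k N _ _).map_smul, (isLinearMap_cTK₃ K k Rm _ _).map_smul,
            (isLinearMap_cTK₂ K k Rm _ _).map_smul, smul_eq_mul]
          ring })
    (fun x y =>
      { map_add := fun z z' => by
          simp only [Prod.fst_add, Prod.snd_add, Submodule.coe_add,
            (isLinearMap_cK₃ K k N _ _).map_add, (isLinearMap_cTK₁ K k Rm _ _).map_add,
            (isLinearMap_cTK₃ K k Rm _ _).map_add]
          ring
        map_smul := fun c z => by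
          simp only [Prod.smul_fst, Prod.smul_snd, Submodule.coe_smul,
            (isLinearMap_cK₃ K k N _ _).map_smul, (isLinearMap_cTK₁ K k Rm _ _).map_smul,
            (isLinearMap_cTK₃ K k Rm _ _).map_smul, smul_eq_mul]
          ring })
    (fun x => by rw [cK_self]; ring)
    (F := fun z => FK K k Ha N f ub pb z.1 + GK K k Rm g Bb rb z.2)
    { map_add := fun z z' => by
        simp only [Prod.fst_add, Prod.snd_add, Submodule.coe_add, hF.map_add, hG.map_add]
        ring
      map_smul := fun c z => by
        simp only [Prod.smul_fst, Prod.smul_snd, Submodule.coe_smul, hF.map_smul, hG.map_smul,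
          smul_eq_mul]
        ring }
  obtain ⟨p, r, h⟩ := exists_localSolution_of_reduced K k hRm hf hg ub Bb pb rb x.1.2 x.2.2
    fun v hv w hw => by
      rw [aK_eq, aTK_eq]
      exact hx (⟨v, hv⟩, ⟨w, hw⟩)
  exact ⟨_, _, p, r, h⟩

/-! ### Necessary conditions and uniqueness -/

variable {K k}

/-- Testing with a single nonzero component separates the problem into its four equations. -/
theorem IsLocalSolution.reduced {Ha N Rm : ℝ} {f g : E d → E d}
    {ub Bb : Fin (d + 1) → VPoly d} {pb rb : Fin (d + 1) → RPoly d} {u B : VPoly d}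
    {p r : RPoly d} (hRm : 0 < Rm) (hf : MemLp f 2 (volume.restrict K.closedInterior))
    (hg : MemLp g 2 (volume.restrict K.closedInterior))
    (h : IsLocalSolution K k Ha N Rm f g ub Bb pb rb u B p r) :
    u ∈ VbarS K k ∧ B ∈ VbarS K k ∧
      (∀ v ∈ VPolyLE d k, bK K k v p = FK K k Ha N f ub pb v - aK K k Ha u v - cK K k N u u v -
        cTK K k Rm v B B) ∧
      (∀ w ∈ VPolyLE d k, bTK K k Rm w r = GK K k Rm g Bb rb w - aTK K k Rm B w +
        cTK K k Rm u B w) := by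
  obtain ⟨hu, hB, hp, hr, h⟩ := h
  have z1 : aTK K k Rm B 0 = 0 := by
    rw [aTK_eq, (isLinearMap_formC K k B).map_zero, mul_zero]
  have z2 : aK K k Ha u 0 = 0 := by
    rw [aK_eq, (isLinearMap_formD K k u).map_zero, mul_zero]
  have z3 : cK K k N u u 0 = 0 := (isLinearMap_cK₃ K k N u u).map_zero
  have z4 : cTK K k Rm 0 B B = 0 := (isLinearMap_cTK₁ K k Rm B B).map_zero
  have z5 : cTK K k Rm u B 0 = 0 := (isLinearMap_cTK₃ K k Rm u B).map_zero
  have z6 := (isLinearMap_FK K k Ha N hf ub pb).map_zero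
  have z7 := (isLinearMap_GK K k Rm hg Bb rb).map_zero
  have z8 : ∀ q, bK K k 0 q = 0 := fun q => (isLinearMap_bK_left K k q).map_zero
  have z9 : ∀ v, bK K k v 0 = 0 := fun v => (isLinearMap_bK_right K k v).map_zero
  have h0 := Submodule.zero_mem (VPolyLE d k)
  have h0' := Submodule.zero_mem (PolyLE d (k - 1))
  simp only [bTK_eq] at h ⊢
  refine ⟨⟨hu, fun q hq => ?_⟩, ⟨hB, fun θ hθ => ?_⟩, fun v hv => ?_, fun w hw => ?_⟩
  · have := h 0 h0 0 h0 q hq 0 h0'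
    simp only [z1, z2, z3, z4, z5, z6, z7, z8, z9] at this
    linarith
  · have := h 0 h0 0 h0 0 h0' θ hθ
    simp only [z1, z2, z3, z4, z5, z6, z7, z8, z9] at this
    have h2 : 1 / Rm * bK K k B θ = 0 := by linarith
    exact (mul_eq_zero.1 h2).resolve_left (by positivity)
  · have := h v hv 0 h0 0 h0' 0 h0'
    simp only [z1, z5, z7, z8, z9] at this
    linarith
  · have := h 0 h0 w hw 0 h0' 0 h0'
    simp only [z2, z3, z4, z6, z8, z9] at this
    linarith

/-- The smallness condition makes the difference of two solutions vanish: `a, b` are the norms of a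
solution, `x, y` those of the difference. -/
theorem eq_zero_of_small {Ha Rm M F G a b x y : ℝ} (hHa : 0 < Ha) (hRm : 0 < Rm) (hM : 0 ≤ M)
    (hF : 0 ≤ F) (hG : 0 ≤ G) (ha : 0 ≤ a) (hb : 0 ≤ b) (hx : 0 ≤ x) (hy : 0 ≤ y)
    (h₁ : 1 / Ha ^ 2 * a ^ 2 + 1 / Rm ^ 2 * b ^ 2 ≤ F * a + G * b)
    (h₂ : 1 / Ha ^ 2 * x ^ 2 + 1 / Rm ^ 2 * y ^ 2 ≤ M * (x * a * x + y * x * b + y * a * y))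
    (h₃ : 12 * max Ha Rm ^ 3 * M * (Ha * F + Rm * G) < 1) : x = 0 ∧ y = 0 := by
  set m := max Ha Rm with hm
  have hm0 : 0 < m := hHa.trans_le (le_max_left _ _)
  have hHm : Ha ≤ m := le_max_left _ _
  have hRm' : Rm ≤ m := le_max_right _ _
  -- Scaling by `Ha` and `Rm` turns both energies into plain sums of squares and makes `Ha F + Rm G`
  -- the natural size of the data.
  obtain ⟨U, rfl⟩ : ∃ U, a = Ha * U := ⟨a / Ha, by field_simp⟩
  obtain ⟨W, rfl⟩ : ∃ W, b = Rm * W := ⟨b / Rm, by field_simp⟩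
  obtain ⟨X, rfl⟩ : ∃ X, x = Ha * X := ⟨x / Ha, by field_simp⟩
  obtain ⟨Y, rfl⟩ : ∃ Y, y = Rm * Y := ⟨y / Rm, by field_simp⟩
  have hU : 0 ≤ U := nonneg_of_mul_nonneg_right ha hHa
  have hW : 0 ≤ W := nonneg_of_mul_nonneg_right hb hRm
  have hX : 0 ≤ X := nonneg_of_mul_nonneg_right hx hHa
  have hY : 0 ≤ Y := nonneg_of_mul_nonneg_right hy hRm
  have e₁ : 1 / Ha ^ 2 * (Ha * U) ^ 2 + 1 / Rm ^ 2 * (Rm * W) ^ 2 = U ^ 2 + W ^ 2 := by field_simp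
  have e₂ : 1 / Ha ^ 2 * (Ha * X) ^ 2 + 1 / Rm ^ 2 * (Rm * Y) ^ 2 = X ^ 2 + Y ^ 2 := by field_simp
  rw [e₁] at h₁
  rw [e₂] at h₂
  set t := Ha * F + Rm * G with ht
  have hf0 : 0 ≤ Ha * F := by positivity
  have hg0 : 0 ≤ Rm * G := by positivity
  -- The energy bound gives `max² ≤ U² + W² ≤ t · max`.
  have hUWt : max U W ≤ t := by
    by_contra hlt
    rw [not_le] at hlt
    have hmax : 0 ≤ max U W := hU.trans (le_max_left _ _)
    have i1 : Ha * F * U ≤ Ha * F * max U W := mul_le_mul_of_nonneg_left (le_max_left _ _) hf0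
    have i2 : Rm * G * W ≤ Rm * G * max U W := mul_le_mul_of_nonneg_left (le_max_right _ _) hg0
    have i3 : max U W ^ 2 ≤ U ^ 2 + W ^ 2 := by
      rcases max_choice U W with h | h <;> rw [h] <;> linarith [sq_nonneg U, sq_nonneg W]
    have ht0 : 0 ≤ t := add_nonneg hf0 hg0
    have i4 : t * max U W < max U W * max U W := mul_lt_mul_of_pos_right hlt (ht0.trans_lt hlt)
    have i5 : F * (Ha * U) + G * (Rm * W) ≤ t * max U W := by
      rw [ht, add_mul]
      linarith
    linarith [sq (max U W)]
  have hUt : U ≤ t := (le_max_left _ _).trans hUWt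
  have hWt : W ≤ t := (le_max_right _ _).trans hUWt
  have ht0 : 0 ≤ t := hU.trans hUt
  have j1 : Ha * X * (Ha * U) * (Ha * X) ≤ m ^ 3 * (t * X ^ 2) := by
    have : Ha ^ 3 ≤ m ^ 3 := pow_le_pow_left₀ hHa.le hHm 3
    calc Ha * X * (Ha * U) * (Ha * X) = Ha ^ 3 * (U * X ^ 2) := by ring
      _ ≤ m ^ 3 * (t * X ^ 2) := by gcongr
  have j2 : Rm * Y * (Ha * X) * (Rm * W) ≤ m ^ 3 * (t * (X * Y)) := by
    calc Rm * Y * (Ha * X) * (Rm * W) = Rm * Ha * Rm * (W * (X * Y)) := by ring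
      _ ≤ m * m * m * (t * (X * Y)) := by gcongr
      _ = m ^ 3 * (t * (X * Y)) := by ring
  have j3 : Rm * Y * (Ha * U) * (Rm * Y) ≤ m ^ 3 * (t * Y ^ 2) := by
    calc Rm * Y * (Ha * U) * (Rm * Y) = Rm * Ha * Rm * (U * Y ^ 2) := by ring
      _ ≤ m * m * m * (t * Y ^ 2) := by gcongr
      _ = m ^ 3 * (t * Y ^ 2) := by ring
  have j4 : X ^ 2 + Y ^ 2 ≤ m ^ 3 * M * t * (X ^ 2 + X * Y + Y ^ 2) := by
    calc X ^ 2 + Y ^ 2 ≤ _ := h₂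
      _ ≤ M * (m ^ 3 * (t * X ^ 2) + m ^ 3 * (t * (X * Y)) + m ^ 3 * (t * Y ^ 2)) := by gcongr
      _ = _ := by ring
  -- The constant `12` leaves room: with `X² + XY + Y² ≤ 2 (X² + Y²)` the right-hand side is at most
  -- one sixth of the left-hand side.
  have j5 : m ^ 3 * M * t < 1 / 12 := by
    have : 12 * (m ^ 3 * M * t) < 1 := by
      rw [← mul_assoc, ← mul_assoc]
      exact h₃
    linarith
  have j6 : X ^ 2 + X * Y + Y ^ 2 ≤ 2 * (X ^ 2 + Y ^ 2) := by
    linarith [two_mul_le_add_sq X Y, sq_nonneg X, sq_nonneg Y]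
  have j7 : m ^ 3 * M * t * (X ^ 2 + X * Y + Y ^ 2) ≤ 1 / 12 * (2 * (X ^ 2 + Y ^ 2)) :=
    mul_le_mul j5.le j6 (by positivity) (by norm_num)
  have j8 : X ^ 2 + Y ^ 2 ≤ 0 := by linarith
  have hX0 : X = 0 := by
    have : X ^ 2 = 0 := le_antisymm (by linarith [sq_nonneg Y]) (sq_nonneg X)
    exact pow_eq_zero_iff two_ne_zero |>.1 this
  have hY0 : Y = 0 := by
    have : Y ^ 2 = 0 := le_antisymm (by linarith [sq_nonneg X]) (sq_nonneg Y)
    exact pow_eq_zero_iff two_ne_zero |>.1 this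
  rw [hX0, hY0, mul_zero, mul_zero]
  exact ⟨rfl, rfl⟩

/-- One solution obeys the a priori bound, the difference `(x, y)` obeys an energy estimate with
that solution as coefficient, and smallness forces `(x, y) = 0`; the pressures follow from
surjectivity of the divergence. -/
theorem IsLocalSolution.unique (hd : d = 2 ∨ d = 3) (hk : 1 ≤ k) {Ha N Rm : ℝ} (hHa : 0 < Ha)
    (hRm : 0 < Rm) {f g : E d → E d} (hf : MemLp f 2 (volume.restrict K.closedInterior))
    (hg : MemLp g 2 (volume.restrict K.closedInterior))
    {ub Bb : Fin (d + 1) → VPoly d} {pb rb : Fin (d + 1) → RPoly d}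
    (hsmall : deltaK K k Ha N Rm * (Ha * dualNormD K k (FK K k Ha N f ub pb) +
      Rm * dualNormC K k Rm (GK K k Rm g Bb rb)) < 1)
    {u₁ B₁ u₂ B₂ : VPoly d} {p₁ r₁ p₂ r₂ : RPoly d}
    (h₁ : IsLocalSolution K k Ha N Rm f g ub Bb pb rb u₁ B₁ p₁ r₁)
    (h₂ : IsLocalSolution K k Ha N Rm f g ub Bb pb rb u₂ B₂ p₂ r₂) :
    u₁ = u₂ ∧ B₁ = B₂ ∧ p₁ = p₂ ∧ r₁ = r₂ := by
  obtain ⟨hu₁, hB₁, hp₁, hr₁⟩ := h₁.reduced hRm hf hg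
  obtain ⟨hu₂, hB₂, hp₂, hr₂⟩ := h₂.reduced hRm hf hg
  have hF := isLinearMap_FK K k Ha N hf ub pb
  have hG := isLinearMap_GK K k Rm hg Bb rb
  obtain ⟨hF0, hFb⟩ := dualNormD_bound K k hF
  obtain ⟨hG0, hGb⟩ := dualNormC_bound K k hd hRm hG
  obtain ⟨hM0, hMb⟩ := MK_bound K k N
  obtain ⟨hMT0, hMTb⟩ := MTK_bound K k hd hRm
  obtain ⟨x, rfl⟩ : ∃ x, u₁ = u₂ + x := ⟨u₁ - u₂, by abel⟩
  obtain ⟨y, rfl⟩ : ∃ y, B₁ = B₂ + y := ⟨B₁ - B₂, by abel⟩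
  have hx : x ∈ VbarS K k := by simpa using sub_mem hu₁ hu₂
  have hy : y ∈ VbarS K k := by simpa using sub_mem hB₁ hB₂
  set u := u₂ + x with hu
  set B := B₂ + y with hB
  have hbK : ∀ {v p}, v ∈ VbarS K k → p ∈ PolyLE d (k - 1) → bK K k v p = 0 :=
    fun hv hp => hv.2 _ hp
  have hbTK : ∀ {v p}, v ∈ VbarS K k → p ∈ PolyLE d (k - 1) → bTK K k Rm v p = 0 :=
    fun hv hp => by rw [bTK_eq, hv.2 _ hp, mul_zero]
  -- The first solution tested with itself: pressures and trilinear terms drop out.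
  have E₁ : 1 / Ha ^ 2 * normD K k u ^ 2 + 1 / Rm ^ 2 * normC K k B ^ 2 ≤
      dualNormD K k (FK K k Ha N f ub pb) * normD K k u +
        dualNormC K k Rm (GK K k Rm g Bb rb) * normC K k B := by
    have i1 := hp₁ u hu₁.1
    have i2 := hr₁ B hB₁.1
    rw [hbK hu₁ h₁.2.2.1, aK_eq, cK_self, ← normD_sq] at i1
    rw [hbTK hB₁ h₁.2.2.2.1, aTK_eq, ← normC_sq] at i2
    have i3 := (le_abs_self _).trans (hFb u hu₁)
    have i4 := (le_abs_self _).trans (hGb B hB₁)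
    linarith
  have E₂ : 1 / Ha ^ 2 * normD K k x ^ 2 + 1 / Rm ^ 2 * normC K k y ^ 2 ≤
      max (MK K k N) (MTK K k Rm) * (normD K k x * normD K k u * normD K k x +
        normC K k y * normD K k x * normC K k B + normC K k y * normD K k u * normC K k y) := by
    have i1 := hp₁ x hx.1
    have i2 := hp₂ x hx.1
    have i3 := hr₁ y hy.1
    have i4 := hr₂ y hy.1
    rw [hbK hx h₁.2.2.1, aK_eq] at i1
    rw [hbK hx h₂.2.2.1, aK_eq] at i2
    rw [hbTK hy h₁.2.2.2.1, aTK_eq] at i3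
    rw [hbTK hy h₂.2.2.2.1, aTK_eq] at i4
    have eu : u₂ = u - x := by rw [hu]; abel
    have eB : B₂ = B - y := by rw [hB]; abel
    have l1 : formD K k u₂ x = formD K k u x - formD K k x x := by
      rw [eu, formD_comm, (isLinearMap_formD K k x).map_sub, formD_comm K k x u]
    have l2 : formC K k B₂ y = formC K k B y - formC K k y y := by
      rw [eB, formC_comm, (isLinearMap_formC K k y).map_sub, formC_comm K k y B]
    have l3 : cK K k N u₂ u₂ x = cK K k N u u x - cK K k N x u x := by
      have e1 : cK K k N u₂ u₂ x = cK K k N u₂ u x - cK K k N u₂ x x := by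
        conv_lhs => rw [show cK K k N u₂ u₂ x = cK K k N u₂ (u - x) x by rw [← eu]]
        exact (isLinearMap_cK₂ K k N u₂ x).map_sub u x
      rw [e1, cK_self, sub_zero, eu]
      exact (isLinearMap_cK₁ K k N u x).map_sub u x
    have l4 : cTK K k Rm x B₂ B₂ = cTK K k Rm x B B - cTK K k Rm x B y -
        cTK K k Rm x y B + cTK K k Rm x y y := by
      have e1 := (isLinearMap_cTK₂ K k Rm x (B - y)).map_sub B y
      have e2 := (isLinearMap_cTK₃ K k Rm x B).map_sub B y
      have e3 := (isLinearMap_cTK₃ K k Rm x y).map_sub B y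
      rw [eB]
      linarith
    have l5 : cTK K k Rm u₂ B₂ y = cTK K k Rm u B y - cTK K k Rm u y y -
        cTK K k Rm x B y + cTK K k Rm x y y := by
      have e1 := (isLinearMap_cTK₁ K k Rm (B - y) y).map_sub u x
      have e2 := (isLinearMap_cTK₂ K k Rm u y).map_sub B y
      have e3 := (isLinearMap_cTK₂ K k Rm x y).map_sub B y
      rw [eB, eu]
      linarith
    rw [l1, l3, l4] at i2
    rw [l2, l5] at i4
    -- In the difference of the two equations tested with `(x, y)`, the term `c(u₂; x, x)` is zero,
    -- and the coupling terms `c̃(x; B, y)` and `c̃(x; y, y)` each appear with both signs and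
    -- cancel.
    have key : 1 / Ha ^ 2 * formD K k x x + 1 / Rm ^ 2 * formC K k y y =
        -cK K k N x u x - cTK K k Rm x y B + cTK K k Rm u y y := by
      linarith
    rw [normD_sq, normC_sq, key]
    have b1 := hMb x hx u hu₁ x hx
    have b2 := hMTb x hx y hy B hB₁
    have b3 := hMTb u hu₁ y hy y hy
    have n1 : ∀ v, 0 ≤ normD K k v := fun v => Real.sqrt_nonneg _
    have n2 : ∀ v, 0 ≤ normC K k v := fun v => Real.sqrt_nonneg _
    have c1 := mul_le_mul_of_nonneg_right (le_max_left (MK K k N) (MTK K k Rm))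
      (mul_nonneg (mul_nonneg (n1 x) (n1 u)) (n1 x))
    have c2 := mul_le_mul_of_nonneg_right (le_max_right (MK K k N) (MTK K k Rm))
      (mul_nonneg (mul_nonneg (n2 B) (n1 x)) (n2 y))
    have c3 := mul_le_mul_of_nonneg_right (le_max_right (MK K k N) (MTK K k Rm))
      (mul_nonneg (mul_nonneg (n2 y) (n1 u)) (n2 y))
    have d1 := neg_abs_le (cK K k N x u x)
    have d2 := neg_abs_le (cTK K k Rm x y B)
    have d3 := le_abs_self (cTK K k Rm u y y)
    have hcomm : normC K k y * normD K k x * normC K k B =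
        normC K k B * normD K k x * normC K k y := by ring
    rw [hcomm, mul_add, mul_add]
    linarith
  obtain ⟨hx0, hy0⟩ := eq_zero_of_small hHa hRm (hM0.trans (le_max_left _ (MTK K k Rm))) hF0 hG0
    (Real.sqrt_nonneg _) (Real.sqrt_nonneg _) (Real.sqrt_nonneg _) (Real.sqrt_nonneg _) E₁ E₂ hsmall
  have hx' : x = 0 := by
    by_contra hne
    exact (normD_pos K k hx hne).ne' hx0
  have hy' : y = 0 := by
    by_contra hne
    exact (normC_pos K k hd hy hne).ne' hy0
  have hu' : u = u₂ := by rw [hu, hx', add_zero]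
  have hB' : B = B₂ := by rw [hB, hy', add_zero]
  refine ⟨hu', hB', ?_, ?_⟩
  · refine sub_eq_zero.1 (eq_zero_of_bK_eq_zero K k hk
      (Submodule.sub_mem _ h₁.2.2.1 h₂.2.2.1) fun v hv => ?_)
    have i1 := hp₁ v hv
    have i2 := hp₂ v hv
    rw [hu', hB'] at i1
    rw [(isLinearMap_bK_right K k v).map_sub]
    linarith
  · refine sub_eq_zero.1 (eq_zero_of_bK_eq_zero K k hk
      (Submodule.sub_mem _ h₁.2.2.2.1 h₂.2.2.2.1) fun v hv => ?_)
    have i1 := hr₁ v hv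
    have i2 := hr₂ v hv
    rw [hu', hB', ← i2, bTK_eq, bTK_eq] at i1
    have i3 := mul_left_cancel₀ (by positivity : (1 / Rm) ≠ 0) i1
    rw [(isLinearMap_bK_right K k v).map_sub, i3, sub_self]

end Local

end

end WGMHD


theorem mainTheorem6 {d : ℕ} [NeZero d] (hd : d = 2 ∨ d = 3) (K : WGMHD.Element d)
    (k : ℕ) (hk : 1 ≤ k) (Ha N Rm : ℝ) (hHa : 0 < Ha) (hN : 0 < N) (hRm : 0 < Rm)
    (f g : WGMHD.E d → WGMHD.E d)
    (hf : MemLp f 2 (volume.restrict K.closedInterior))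
    (hg : MemLp g 2 (volume.restrict K.closedInterior))
    (ub Bb : Fin (d + 1) → WGMHD.VPoly d) (pb rb : Fin (d + 1) → WGMHD.RPoly d)
    (hub : ∀ i, ub i ∈ WGMHD.VPolyLE d k) (hBb : ∀ i, Bb i ∈ WGMHD.VPolyLE d k)
    (hpb : ∀ i, pb i ∈ WGMHD.PolyLE d k) (hrb : ∀ i, rb i ∈ WGMHD.PolyLE d k) :
    (∃ (u B : WGMHD.VPoly d) (p r : WGMHD.RPoly d),
      WGMHD.IsLocalSolution K k Ha N Rm f g ub Bb pb rb u B p r) ∧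
    (WGMHD.deltaK K k Ha N Rm *
        (Ha * WGMHD.dualNormD K k (WGMHD.FK K k Ha N f ub pb) +
          Rm * WGMHD.dualNormC K k Rm (WGMHD.GK K k Rm g Bb rb)) < 1 →
      ∃! s : WGMHD.VPoly d × WGMHD.VPoly d × WGMHD.RPoly d × WGMHD.RPoly d,
        WGMHD.IsLocalSolution K k Ha N Rm f g ub Bb pb rb s.1 s.2.1 s.2.2.1 s.2.2.2) := by
  have hex := WGMHD.exists_localSolution K k (N := N) hd hHa hRm hf hg ub Bb pb rb
  refine ⟨hex, fun hsmall => ?_⟩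
  obtain ⟨u, B, p, r, h⟩ := hex
  refine ⟨(u, B, p, r), h, ?_⟩
  rintro ⟨u', B', p', r'⟩ h'
  obtain ⟨h1, h2, h3, h4⟩ := h'.unique hd hk hHa hRm hf hg hsmall h
  simp only at h1 h2 h3 h4
  rw [h1, h2, h3, h4]
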